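/- Let $Y$ be a (Hausdorff, paracompact, boundaryless) $C^\infty$-manifold with sheaf $\mathcal{O}_Y$ of real $C^\infty$-functions, $\mathcal{O}_Y^{\mathbb{C}}=\mathcal{O}_Y\otimes_{\mathbb{R}}\mathbb{C}$, and tangent and cotangent sheaves $\mathcal{T}_*Y$, $\mathcal{T}^*Y$. Let $F$ be a $C^\infty$ complex vector bundle of finite rank on $Y$, $\mathcal{F}$ its sheaf of $C^\infty$-sections, and $Y^{nc}=(Y,\mathcal{O}_Y^{nc})$ with $\mathcal{O}_Y^{nc}=\mathcal{E}nd_{\mathcal{O}_Y^{\mathbb{C}}}(\mathcal{F})$. For an associative unital $S$-algebra $R$ whose centre $Z_R$ contains the image of $S$ and contains the image of a $C^\infty$-ring $A$, let $\Omega_{R/S}$ be the bi-$R$-module generated by the symbols $d(r)$, $r\in R$, subject to the relations: $d(a_1r_1+a_2r_2)=a_1d(r_1)+a_2d(r_2)=d(r_1)a_1+d(r_2)a_2$ for $a_i\in S$; $d(r_1r_2)=d(r_1)r_2+r_1d(r_2)$; $d(r_1)r_3=r_3d(r_1)$ for $r_3\in Z_R$; and $d(h(x_1,\dots,x_s))=\sum_{j}\partial_jh(x_1,\dots,x_s)\,d(x_j)$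 for $s\ge 1$, $h\in C^\infty(\mathbb{R}^s)$ and $x_1,\dots,x_s\in A$. Let $\mathcal{T}^*Y^{nc}$ and $\mathcal{T}^*_{Y^{nc}/Y}$ be the sheaves of bi-$\mathcal{O}_Y^{nc}$-modules associated to $U\mapsto\Omega_{\mathcal{O}_Y^{nc}(U)/\mathbb{C}}$ and $U\mapsto\Omega_{\mathcal{O}_Y^{nc}(U)/\mathcal{O}_Y^{\mathbb{C}}(U)}$ respectively, in both cases with $A=\mathcal{O}_Y(U)$, and let $\mathcal{O}_Y^{nc}\otimes_{\mathcal{O}_Y}\mathcal{T}^*Y$ be the sheaf tensor product, a bi-$\mathcal{O}_Y^{nc}$-module through its first factor. Then there is an exact sequence of sheaves of bi-$\mathcal{O}_Y^{nc}$-modules $$0\longrightarrow\mathcal{O}_Y^{nc}\otimes_{\mathcal{O}_Y}\mathcal{T}^*Y\stackrel{i}{\longrightarrow}\mathcal{T}^*Y^{nc}\stackrel{p}{\longrightarrow}\mathcal{T}^*_{Y^{nc}/Y}\longrightarrow 0$$ with the natural maps $i(a\otimes df)=a\,d(f\cdot 1)$, for local sections $a$ of $\mathcal{O}_Y^{nc}$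 and $f$ of $\mathcal{O}_Y$, and $p(dr)=dr$. Moreover, let $\nabla$ be a connection on $\mathcal{F}$, let $\nabla''$ be the induced connection on $\mathcal{O}_Y^{nc}$, given by $(\nabla''_\xi a)(s)=\nabla_\xi(a(s))-a(\nabla_\xi s)$, and call the derivation $\nabla''_\xi$ of $\mathcal{O}_Y^{nc}$ the horizontal lift of the vector field $\xi$. Then there is an epimorphism of sheaves of bi-$\mathcal{O}_Y^{nc}$-modules $$\pi^\nabla:\mathcal{T}^*Y^{nc}\longrightarrow\mathcal{O}_Y^{nc}\otimes_{\mathcal{O}_Y}\mathcal{T}^*Y$$ that sends $\omega$ to its composition with the horizontal lift, that is, for all local vector fields $\xi$ the contraction of $\pi^\nabla(\omega)$ with $\xi$ (where $a\otimes\theta\mapsto\theta(\xi)\,a$) equals the pairing of $\omega$ with $\nabla''_\xi$ (where $a\,dr\,b\mapsto a\,(\nabla''_\xi r)\,b$); and $\pi^\nabla$ splits the exact sequence: $\pi^\nabla\circ i=\mathrm{id}$. -/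

import Mathlib

set_option linter.unusedSectionVars false
open TopologicalSpace
open scoped ContDiff Manifold TensorProduct

namespace Azu
noncomputable section

/-! ### Presheaves of modules over a presheaf of rings, and sheafification -/

/-- A presheaf of (not necessarily commutative) rings on `Y`. -/
structure RingPresheaf (Y : Type*) [TopologicalSpace Y] where
  obj : Opens Y → Type*
  [ring : ∀ U, Ring (obj U)]
  res : ∀ {U W : Opens Y}, W ≤ U → obj U →+* obj W
  res_self : ∀ (U : Opens Y) (x : obj U), res (le_refl U) x = x
  res_res : ∀ {U W N : Opens Y} (h : W ≤ U) (k : N ≤ W) (x : obj U),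
    res k (res h x) = res (k.trans h) x

attribute [instance] RingPresheaf.ring

/-- A presheaf of left modules over the presheaf of rings `E`. -/
structure ModPresheaf {Y : Type*} [TopologicalSpace Y] (E : RingPresheaf Y) where
  obj : Opens Y → Type*
  [grp : ∀ U, AddCommGroup (obj U)]
  [mod : ∀ U, Module (E.obj U) (obj U)]
  res : ∀ {U W : Opens Y} (h : W ≤ U), obj U →ₛₗ[E.res h] obj W
  res_self : ∀ (U : Opens Y) (x : obj U), res (le_refl U) x = x
  res_res : ∀ {U W N : Opens Y} (h : W ≤ U) (k : N ≤ W) (x : obj U),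
    res k (res h x) = res (k.trans h) x

attribute [instance] ModPresheaf.grp ModPresheaf.mod

namespace ModPresheaf

section
variable {Y : Type*} [TopologicalSpace Y] {E : RingPresheaf Y}

theorem mem_inf {y : Y} {U W : Opens Y} (hU : y ∈ U) (hW : y ∈ W) : y ∈ U ⊓ W := ⟨hU, hW⟩

variable (P : ModPresheaf E)

/-- A section of `P` over some open neighbourhood of `y`. -/
structure LocSec (y : Y) where
  dom : Opens Y
  mem : y ∈ dom
  sec : P.obj dom

/-- Two local sections have the same germ at `y` if they agree on a neighbourhood of `y`. -/
instance stalkSetoid (y : Y) : Setoid (P.LocSec y) where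
  r s t := ∃ (N : Opens Y) (_ : y ∈ N) (h : N ≤ s.dom) (k : N ≤ t.dom),
    P.res h s.sec = P.res k t.sec
  iseqv :=
    { refl := fun s => ⟨s.dom, s.mem, le_refl _, le_refl _, rfl⟩
      symm := fun ⟨N, hN, h, k, e⟩ => ⟨N, hN, k, h, e.symm⟩
      trans := fun {s t u} ⟨N, hN, h, k, e⟩ ⟨N', hN', h', k', e'⟩ =>
        ⟨N ⊓ N', ⟨hN, hN'⟩, inf_le_left.trans h, inf_le_right.trans k', by
          rw [← P.res_res h inf_le_left, e, P.res_res, ← P.res_res k' inf_le_right, ← e',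
            P.res_res]⟩ }

/-- The stalk of `P` at `y`: germs of sections over open neighbourhoods of `y`. -/
def Stalk (y : Y) : Type _ := Quotient (P.stalkSetoid y)

/-- The germ at `y` of a section over `U ∋ y`. -/
def germMk {y : Y} {U : Opens Y} (hy : y ∈ U) (x : P.obj U) : P.Stalk y :=
  Quotient.mk (P.stalkSetoid y) ⟨U, hy, x⟩

theorem germMk_eq_iff {y : Y} {U W : Opens Y} (hU : y ∈ U) (hW : y ∈ W) (x : P.obj U)
    (x' : P.obj W) : P.germMk hU x = P.germMk hW x' ↔
      ∃ (N : Opens Y) (_ : y ∈ N) (h : N ≤ U) (k : N ≤ W), P.res h x = P.res k x' :=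
  Quotient.eq (r := P.stalkSetoid y)

theorem germMk_res {y : Y} {U W : Opens Y} (h : W ≤ U) (hy : y ∈ W) (x : P.obj U) :
    P.germMk hy (P.res h x) = P.germMk (h hy) x :=
  (P.germMk_eq_iff _ _ _ _).2 ⟨W, hy, le_refl W, h, P.res_self _ _⟩

theorem exists_germMk {y : Y} (t : P.Stalk y) :
    ∃ (U : Opens Y) (hy : y ∈ U) (x : P.obj U), t = P.germMk hy x := by
  obtain ⟨s, rfl⟩ := Quotient.exists_rep t
  exact ⟨s.dom, s.mem, s.sec, rfl⟩

/-- Two germs are represented by sections over the same neighbourhood. -/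
theorem exists_germMk₂ {y : Y} (t t' : P.Stalk y) :
    ∃ (U : Opens Y) (hy : y ∈ U) (x x' : P.obj U), t = P.germMk hy x ∧ t' = P.germMk hy x' := by
  obtain ⟨U, hU, x, rfl⟩ := P.exists_germMk t
  obtain ⟨U', hU', x', rfl⟩ := P.exists_germMk t'
  exact ⟨U ⊓ U', mem_inf hU hU', P.res inf_le_left x, P.res inf_le_right x',
    (P.germMk_res inf_le_left (mem_inf hU hU') x).symm,
    (P.germMk_res inf_le_right (mem_inf hU hU') x').symm⟩

instance (y : Y) : Zero (P.Stalk y) := ⟨P.germMk (U := ⊤) trivial 0⟩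

instance (y : Y) : Neg (P.Stalk y) where
  neg := Quotient.map (fun s => ⟨s.dom, s.mem, -s.sec⟩) (by
    rintro s t ⟨N, hN, h, k, e⟩
    exact ⟨N, hN, h, k, by rw [map_neg, map_neg, e]⟩)

instance (y : Y) : Add (P.Stalk y) where
  add := Quotient.map₂ (fun s t => ⟨s.dom ⊓ t.dom, ⟨s.mem, t.mem⟩,
      P.res inf_le_left s.sec + P.res inf_le_right t.sec⟩) (by
    rintro s s' ⟨N, hN, h, k, e⟩ t t' ⟨N', hN', h', k', e'⟩
    refine ⟨N ⊓ N', ⟨hN, hN'⟩, inf_le_inf h h', inf_le_inf k k', ?_⟩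
    simp only [map_add, P.res_res]
    congr 1
    · rw [← P.res_res h inf_le_left, e, P.res_res]
    · rw [← P.res_res h' inf_le_right, e', P.res_res])

theorem germMk_zero {y : Y} {U : Opens Y} (hy : y ∈ U) : P.germMk hy (0 : P.obj U) = 0 :=
  (P.germMk_eq_iff _ _ _ _).2 ⟨U, hy, le_refl U, le_top, by rw [map_zero, map_zero]⟩

theorem germMk_add {y : Y} {U : Opens Y} (hy : y ∈ U) (x x' : P.obj U) :
    P.germMk hy (x + x') = P.germMk hy x + P.germMk hy x' := by
  refine (P.germMk_eq_iff (W := U ⊓ U) _ ⟨hy, hy⟩ _ _).2 ⟨U, hy, le_refl U, le_inf le_rfl le_rfl, ?_⟩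
  simp only [map_add, P.res_res]

theorem germMk_neg {y : Y} {U : Opens Y} (hy : y ∈ U) (x : P.obj U) :
    P.germMk hy (-x) = -P.germMk hy x := rfl

instance (y : Y) : AddCommGroup (P.Stalk y) where
  add_assoc a b c := by
    obtain ⟨U, hU, a, b, rfl, rfl⟩ := P.exists_germMk₂ a b
    obtain ⟨U', hU', c, rfl⟩ := P.exists_germMk c
    rw [← P.germMk_res (inf_le_left : U ⊓ U' ≤ U) (mem_inf hU hU'),
      ← P.germMk_res (inf_le_left : U ⊓ U' ≤ U) (mem_inf hU hU'),
      ← P.germMk_res (inf_le_right : U ⊓ U' ≤ U') (mem_inf hU hU')]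
    simp only [← germMk_add, add_assoc]
  zero_add a := by
    obtain ⟨U, hU, a, rfl⟩ := P.exists_germMk a
    rw [← P.germMk_zero hU, ← germMk_add, zero_add]
  add_zero a := by
    obtain ⟨U, hU, a, rfl⟩ := P.exists_germMk a
    rw [← P.germMk_zero hU, ← germMk_add, add_zero]
  nsmul := nsmulRec
  zsmul := zsmulRec
  neg_add_cancel a := by
    obtain ⟨U, hU, a, rfl⟩ := P.exists_germMk a
    rw [← germMk_neg, ← germMk_add, neg_add_cancel, germMk_zero]
  add_comm a b := by
    obtain ⟨U, hU, a, b, rfl, rfl⟩ := P.exists_germMk₂ a b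
    rw [← germMk_add, add_comm, germMk_add]

/-- Taking germs at `y`, as a homomorphism of abelian groups. -/
def germ {y : Y} {U : Opens Y} (hy : y ∈ U) : P.obj U →+ P.Stalk y where
  toFun := P.germMk hy
  map_zero' := P.germMk_zero hy
  map_add' := P.germMk_add hy

theorem germ_res {y : Y} {U W : Opens Y} (h : W ≤ U) (hy : y ∈ W) (x : P.obj U) :
    P.germ hy (P.res h x) = P.germ (h hy) x := P.germMk_res h hy x

theorem germ_eq_iff {y : Y} {U W : Opens Y} (hU : y ∈ U) (hW : y ∈ W) (x : P.obj U)
    (x' : P.obj W) : P.germ hU x = P.germ hW x' ↔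
      ∃ (N : Opens Y) (_ : y ∈ N) (h : N ≤ U) (k : N ≤ W), P.res h x = P.res k x' :=
  P.germMk_eq_iff hU hW x x'

/-- Every germ at `y ∈ U` is the germ of a section over an open subset of `U`. -/
theorem stalk_induction {y : Y} {U : Opens Y} (hy : y ∈ U) {p : P.Stalk y → Prop}
    (h : ∀ (W : Opens Y) (_ : W ≤ U) (hW : y ∈ W) (x : P.obj W), p (P.germ hW x))
    (t : P.Stalk y) : p t := by
  obtain ⟨W, hW, x, rfl⟩ := P.exists_germMk t
  rw [← P.germMk_res (inf_le_left : W ⊓ U ≤ W) (mem_inf hW hy)]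
  exact h _ inf_le_right _ _

/-- Two additive maps out of a stalk agree if they agree on germs. -/
theorem stalk_hom_ext {A : Type*} [AddCommGroup A] {y : Y} {U : Opens Y} (hy : y ∈ U)
    {f g : P.Stalk y →+ A}
    (h : ∀ (W : Opens Y) (_ : W ≤ U) (hW : y ∈ W) (x : P.obj W),
      f (P.germ hW x) = g (P.germ hW x)) : f = g :=
  AddMonoidHom.ext (P.stalk_induction hy h)

/-- A family of additive maps `P(W) → Q(W)`, for `W ⊆ U` open, compatible with restriction,
induces a map of stalks at every point of `U`. -/
def stalkMap {E' : RingPresheaf Y} {P : ModPresheaf E} {Q : ModPresheaf E'} {U : Opens Y}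
    (f : ∀ W : Opens Y, W ≤ U → (P.obj W →+ Q.obj W))
    (hf : ∀ {W N : Opens Y} (h : W ≤ U) (k : N ≤ W) (x : P.obj W),
      Q.res k (f W h x) = f N (k.trans h) (P.res k x))
    {y : Y} (hy : y ∈ U) : P.Stalk y →+ Q.Stalk y where
  toFun := Quotient.lift (fun s : P.LocSec y => Q.germ (U := s.dom ⊓ U) ⟨s.mem, hy⟩
      (f _ inf_le_right (P.res inf_le_left s.sec))) (by
    rintro s t ⟨N, hN, h, k, e⟩
    refine (Q.germ_eq_iff _ _ _ _).2
      ⟨N ⊓ U, ⟨hN, hy⟩, inf_le_inf_right U h, inf_le_inf_right U k, ?_⟩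
    rw [hf, hf, P.res_res, P.res_res, ← P.res_res h inf_le_left, e, P.res_res])
  map_zero' := by
    change Q.germ (U := ⊤ ⊓ U) _ (f _ inf_le_right (P.res inf_le_left 0)) = 0
    rw [map_zero, map_zero, map_zero]
  map_add' t t' := by
    obtain ⟨W, hW, x, x', rfl, rfl⟩ := P.exists_germMk₂ t t'
    rw [← P.germMk_add]
    change Q.germ (U := W ⊓ U) _ (f _ inf_le_right (P.res inf_le_left (x + x'))) =
      Q.germ (U := W ⊓ U) _ (f _ inf_le_right (P.res inf_le_left x)) +
      Q.germ (U := W ⊓ U) _ (f _ inf_le_right (P.res inf_le_left x'))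
    simp only [map_add]

theorem stalkMap_germ {E' : RingPresheaf Y} {P : ModPresheaf E} {Q : ModPresheaf E'} {U : Opens Y}
    (f : ∀ W : Opens Y, W ≤ U → (P.obj W →+ Q.obj W))
    (hf : ∀ {W N : Opens Y} (h : W ≤ U) (k : N ≤ W) (x : P.obj W),
      Q.res k (f W h x) = f N (k.trans h) (P.res k x))
    {y : Y} (hy : y ∈ U) {W : Opens Y} (hW : y ∈ W) (h : W ≤ U) (x : P.obj W) :
    stalkMap f hf hy (P.germ hW x) = Q.germ hW (f W h x) := by
  change Q.germ (mem_inf hW hy) (f _ inf_le_right (P.res inf_le_left x)) = _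
  rw [← hf h, Q.germ_res]

/-- The action of a section of `E` over `U` on the stalks of `P` at the points of `U`. -/
def stalkSMul {y : Y} {U : Opens Y} (hy : y ∈ U) (e : E.obj U) : P.Stalk y →+ P.Stalk y :=
  stalkMap (P := P) (Q := P) (U := U)
    (fun W h => DistribSMul.toAddMonoidHom (P.obj W) (E.res h e))
    (fun h k x => by simp [E.res_res]) hy

theorem stalkSMul_germ {y : Y} {U W : Opens Y} (hW : y ∈ W) (h : W ≤ U) (e : E.obj U)
    (x : P.obj W) : P.stalkSMul (h hW) e (P.germ hW x) = P.germ hW (E.res h e • x) :=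
  stalkMap_germ _ (fun h k x => by simp [E.res_res]) _ _ h x

/-- Sections of `E` over `U` act on the stalks of `P` at the points of `U`. -/
def stalkAct {y : Y} {U : Opens Y} (hy : y ∈ U) : E.obj U →+* AddMonoid.End (P.Stalk y) where
  toFun e := P.stalkSMul hy e
  map_one' := by
    refine P.stalk_hom_ext hy fun W h hW x => ?_
    rw [P.stalkSMul_germ hW h, map_one, one_smul]; rfl
  map_zero' := by
    refine P.stalk_hom_ext hy fun W h hW x => ?_
    rw [P.stalkSMul_germ hW h, map_zero, zero_smul, map_zero]; rfl
  map_mul' a b := by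
    refine P.stalk_hom_ext hy fun W h hW x => ?_
    change _ = P.stalkSMul hy a (P.stalkSMul hy b (P.germ hW x))
    rw [P.stalkSMul_germ hW h, P.stalkSMul_germ hW h, P.stalkSMul_germ hW h, map_mul, mul_smul]
  map_add' a b := by
    refine P.stalk_hom_ext hy fun W h hW x => ?_
    change _ = P.stalkSMul hy a (P.germ hW x) + P.stalkSMul hy b (P.germ hW x)
    rw [P.stalkSMul_germ hW h, P.stalkSMul_germ hW h, P.stalkSMul_germ hW h, map_add, add_smul,
      map_add]

theorem stalkAct_germ {y : Y} {U W : Opens Y} (hW : y ∈ W) (h : W ≤ U) (e : E.obj U)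
    (x : P.obj W) : P.stalkAct (h hW) e (P.germ hW x) = P.germ hW (E.res h e • x) :=
  P.stalkSMul_germ hW h e x

theorem stalkAct_res {y : Y} {U W : Opens Y} (hW : y ∈ W) (h : W ≤ U) (e : E.obj U)
    (t : P.Stalk y) : P.stalkAct hW (E.res h e) t = P.stalkAct (h hW) e t := by
  refine P.stalk_induction hW (p := fun t => P.stalkAct hW (E.res h e) t = P.stalkAct (h hW) e t)
    (fun N hN hy x => ?_) t
  rw [P.stalkAct_germ hy hN, P.stalkAct_germ hy (hN.trans h), E.res_res]

/-- Sections over `U` of the sheaf associated to `P`: families of germs that are locally the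
germs of a section of `P`. -/
def shSections (U : Opens Y) : AddSubgroup (∀ y : U, P.Stalk y.1) where
  carrier := {s | ∀ y : U, ∃ (W : Opens Y) (h : W ≤ U) (_ : y.1 ∈ W) (x : P.obj W),
    ∀ (z : Y) (hz : z ∈ W), s ⟨z, h hz⟩ = P.germ hz x}
  zero_mem' y := ⟨U, le_refl U, y.2, 0, fun z hz => by simp⟩
  add_mem' := by
    intro s t hs ht y
    obtain ⟨W, h, hy, x, hx⟩ := hs y
    obtain ⟨W', h', hy', x', hx'⟩ := ht y
    refine ⟨W ⊓ W', inf_le_left.trans h, ⟨hy, hy'⟩, P.res inf_le_left x + P.res inf_le_right x',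
      fun z hz => ?_⟩
    rw [Pi.add_apply, hx z hz.1, hx' z hz.2, map_add, P.germ_res, P.germ_res]
  neg_mem' := by
    intro s hs y
    obtain ⟨W, h, hy, x, hx⟩ := hs y
    refine ⟨W, h, hy, -x, fun z hz => ?_⟩
    rw [Pi.neg_apply, hx z hz, map_neg]

/-- The module structure on the sections of the associated sheaf. -/
instance (U : Opens Y) : Module (E.obj U) (P.shSections U) where
  smul e s := ⟨fun y => P.stalkAct y.2 e (s.1 y), fun y => by
    obtain ⟨W, h, hy, x, hx⟩ := s.2 y
    refine ⟨W, h, hy, E.res h e • x, fun z hz => ?_⟩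
    change P.stalkAct (h hz) e (s.1 ⟨z, h hz⟩) = _
    rw [hx z hz]
    exact P.stalkAct_germ hz h e x⟩
  one_smul s := Subtype.ext (funext fun y => by
    change P.stalkAct y.2 1 (s.1 y) = s.1 y
    rw [map_one]; rfl)
  mul_smul a b s := Subtype.ext (funext fun y => by
    change P.stalkAct y.2 (a * b) (s.1 y) = P.stalkAct y.2 a (P.stalkAct y.2 b (s.1 y))
    rw [map_mul]; rfl)
  smul_zero a := Subtype.ext (funext fun y => map_zero (P.stalkAct y.2 a))
  smul_add a s t := Subtype.ext (funext fun y => map_add (P.stalkAct y.2 a) _ _)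
  add_smul a b s := Subtype.ext (funext fun y => by
    change P.stalkAct y.2 (a + b) (s.1 y) = P.stalkAct y.2 a (s.1 y) + P.stalkAct y.2 b (s.1 y)
    rw [map_add]; rfl)
  zero_smul s := Subtype.ext (funext fun y => by
    change P.stalkAct y.2 0 (s.1 y) = 0
    rw [map_zero]; rfl)

/-- The sheaf of modules associated to the presheaf `P`. -/
def sheafify : ModPresheaf E where
  obj U := P.shSections U
  res {U W} h :=
    { toFun := fun s => ⟨fun y => s.1 ⟨y.1, h y.2⟩, fun y => by
        obtain ⟨N, k, hy, x, hx⟩ := s.2 ⟨y.1, h y.2⟩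
        refine ⟨N ⊓ W, inf_le_right, ⟨hy, y.2⟩, P.res inf_le_left x, fun z hz => ?_⟩
        rw [P.germ_res]
        exact hx z hz.1⟩
      map_add' := fun s t => rfl
      map_smul' := fun e s => Subtype.ext (funext fun y =>
        (P.stalkAct_res y.2 h e (s.1 ⟨y.1, h y.2⟩)).symm) }
  res_self U s := rfl
  res_res h k s := rfl

/-- The canonical map from `P` to its associated sheaf. -/
def toSh (U : Opens Y) : P.obj U →ₗ[E.obj U] P.sheafify.obj U where
  toFun x := ⟨fun y => P.germ y.2 x, fun y => ⟨U, le_refl U, y.2, x, fun _ _ => rfl⟩⟩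
  map_add' x x' := Subtype.ext (funext fun y => map_add _ _ _)
  map_smul' e x := Subtype.ext (funext fun y => by
    have h := P.stalkAct_germ y.2 (le_refl U) e x
    rw [E.res_self] at h
    exact h.symm)

/-- The germ at `y ∈ U` of a section over `U` of the associated sheaf. -/
def germOf {P : ModPresheaf E} {U : Opens Y} (s : P.sheafify.obj U) {y : Y} (hy : y ∈ U) :
    P.Stalk y := (show P.shSections U from s).1 ⟨y, hy⟩

/-- A morphism of (pre)sheaves of modules. -/
structure Hom (P Q : ModPresheaf E) where
  app : ∀ U : Opens Y, P.obj U →ₗ[E.obj U] Q.obj U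
  naturality : ∀ {U W : Opens Y} (h : W ≤ U) (x : P.obj U),
    Q.res h (app U x) = app W (P.res h x)

/-- Monomorphism of sheaves: injective on sections. -/
def Hom.IsMono {P Q : ModPresheaf E} (f : Hom P Q) : Prop :=
  ∀ U : Opens Y, Function.Injective (f.app U)

/-- A section belongs to the image sheaf of `f`: it lifts locally. -/
def Hom.InImage {P Q : ModPresheaf E} (f : Hom P Q) {U : Opens Y} (x : Q.obj U) : Prop :=
  ∀ y ∈ U, ∃ (W : Opens Y) (h : W ≤ U) (_ : y ∈ W) (t : P.obj W), f.app W t = Q.res h x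

/-- Epimorphism of sheaves: every section lifts locally. -/
def Hom.IsEpi {P Q : ModPresheaf E} (f : Hom P Q) : Prop :=
  ∀ (U : Opens Y) (x : Q.obj U), f.InImage x

/-- Exactness in the middle: the image sheaf of `f` is the kernel of `g`. -/
def Hom.Exact {P Q T : ModPresheaf E} (f : Hom P Q) (g : Hom Q T) : Prop :=
  ∀ (U : Opens Y) (x : Q.obj U), g.app U x = 0 ↔ f.InImage x

end

end ModPresheaf
/-! ### Bimodules, `C^∞`-rings and the module of differentials -/

section Bimodules

/-- The enveloping algebra of a `ℂ`-algebra `R`.  A bi-`R`-module (with `ℂ` acting centrally) is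
the same as a left module over `Env R`, with `a · m · b = (a ⊗ b) • m`. -/
def Env (R : Type*) [Ring R] [Algebra ℂ R] : Type _ := R ⊗[ℂ] Rᵐᵒᵖ

section
variable {R : Type*} [Ring R] [Algebra ℂ R]

instance : Ring (Env R) := inferInstanceAs (Ring (R ⊗[ℂ] Rᵐᵒᵖ))

/-- The element `a ⊗ b` of the enveloping algebra, acting as `m ↦ a · m · b`. -/
def bi (a b : R) : Env R := a ⊗ₜ[ℂ] MulOpposite.op b

theorem bi_mul (a b a' b' : R) : bi a b * bi a' b' = bi (a * a') (b' * b) :=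
  Algebra.TensorProduct.tmul_mul_tmul a a' (MulOpposite.op b) (MulOpposite.op b')

theorem bi_one : (bi 1 1 : Env R) = 1 := rfl

theorem bi_add_left (a a' b : R) : bi (a + a') b = bi a b + bi a' b := TensorProduct.add_tmul _ _ _

theorem bi_add_right (a b b' : R) : bi a (b + b') = bi a b + bi a b' := TensorProduct.tmul_add _ _ _

theorem bi_smul (c : ℂ) (a b : R) : bi (c • a) b = bi a (c • b) :=
  TensorProduct.smul_tmul c a (MulOpposite.op b)

theorem env_induction {p : Env R → Prop} (h0 : p 0) (hadd : ∀ e e', p e → p e' → p (e + e'))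
    (hbi : ∀ a b : R, p (bi a b)) (e : Env R) : p e :=
  TensorProduct.induction_on (motive := p) e h0 (fun a b => hbi a b.unop) (fun e e' => hadd e e')

/-- The ring homomorphism of enveloping algebras induced by an algebra homomorphism. -/
def envMap {R' : Type*} [Ring R'] [Algebra ℂ R'] (f : R →ₐ[ℂ] R') : Env R →+* Env R' :=
  (Algebra.TensorProduct.map f (AlgHom.op f)).toRingHom

theorem envMap_bi {R' : Type*} [Ring R'] [Algebra ℂ R'] (f : R →ₐ[ℂ] R') (a b : R) :
    envMap f (bi a b) = bi (f a) (f b) := rfl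

/-- `R` as a bimodule over itself: `(a ⊗ b) • x = a x b`. -/
instance envSelf : Module (Env R) R :=
  Module.compHom R (AlgHom.mulLeftRight ℂ R).toRingHom

theorem bi_smul_self (a b x : R) : bi a b • x = a * x * b :=
  AlgHom.mulLeftRight_apply ℂ R a (MulOpposite.op b) x

instance envSelf_comm {A : Type*} [CommRing A] [Algebra A R] : SMulCommClass A (Env R) R where
  smul_comm c e x := by
    induction e using env_induction with
    | h0 => rw [zero_smul, zero_smul, smul_zero]
    | hadd e e' h h' => rw [add_smul, add_smul, smul_add, h, h']
    | hbi a b => rw [bi_smul_self, bi_smul_self, mul_smul_comm, smul_mul_assoc]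

end

/-- A smooth function of `s` real variables. -/
structure SmoothFun (s : ℕ) where
  fn : (Fin s → ℝ) → ℝ
  smooth : ContDiff ℝ ∞ fn

namespace SmoothFun

/-- The `i`-th coordinate function. -/
def proj {s : ℕ} (i : Fin s) : SmoothFun s := ⟨fun x => x i, contDiff_apply ℝ ℝ i⟩

/-- Composition of smooth functions. -/
def comp {s t : ℕ} (h : SmoothFun s) (g : Fin s → SmoothFun t) : SmoothFun t :=
  ⟨fun x => h.fn fun i => (g i).fn x, h.smooth.comp (contDiff_pi.2 fun i => (g i).smooth)⟩

/-- The sum of two variables. -/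
def add : SmoothFun 2 := ⟨fun x => x 0 + x 1, (contDiff_apply ℝ ℝ 0).add (contDiff_apply ℝ ℝ 1)⟩

/-- The product of two variables. -/
def mul : SmoothFun 2 := ⟨fun x => x 0 * x 1, (contDiff_apply ℝ ℝ 0).mul (contDiff_apply ℝ ℝ 1)⟩

/-- The partial derivative with respect to the `i`-th variable. -/
def pd {s : ℕ} (i : Fin s) (h : SmoothFun s) : SmoothFun s :=
  ⟨fun x => fderiv ℝ h.fn x (Pi.single i 1),
    (h.smooth.fderiv_right (m := ∞) le_rfl).clm_apply contDiff_const⟩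

end SmoothFun

/-- A `C^∞`-ring: a commutative ring on which all smooth functions operate, compatibly with
projections and compositions, the ring operations being those given by the smooth functions
`x₀ + x₁` and `x₀ x₁`. -/
class CInfRing (A : Type*) [CommRing A] where
  op : ∀ {s : ℕ}, SmoothFun s → (Fin s → A) → A
  op_proj : ∀ {s : ℕ} (i : Fin s) (a : Fin s → A), op (SmoothFun.proj i) a = a i
  op_comp : ∀ {s t : ℕ} (h : SmoothFun s) (g : Fin s → SmoothFun t) (a : Fin t → A),
    op (h.comp g) a = op h fun i => op (g i) a
  op_add : ∀ a : Fin 2 → A, op SmoothFun.add a = a 0 + a 1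
  op_mul : ∀ a : Fin 2 → A, op SmoothFun.mul a = a 0 * a 1

section Omega

variable (S A R : Type*) [CommRing S] [CommRing A] [CInfRing A] [Ring R] [Algebra ℂ R]
  [Algebra S R] [Algebra A R]

/-- The free bi-`R`-module on the symbols `d(r)`, `r ∈ R`. -/
abbrev FreeDiff (R : Type*) [Ring R] [Algebra ℂ R] : Type _ := R →₀ Env R

/-- The generator `d(r)`. -/
abbrev dsym {R : Type*} [Ring R] [Algebra ℂ R] (r : R) : FreeDiff R := Finsupp.single r 1

/-- The relations (difference of the two sides) between the symbols `d(r)`: `S`-linearity on both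
sides, the Leibniz rule, commutativity with the centre of `R`, and the chain rule for the smooth
functions of elements of the `C^∞`-ring `A`, which sits in the centre of `R`. -/
inductive DiffRel : FreeDiff R → Prop
  | linear_left (a₁ a₂ : S) (r₁ r₂ : R) : DiffRel
      (dsym (a₁ • r₁ + a₂ • r₂) -
        (bi (algebraMap S R a₁) 1 • dsym r₁ + bi (algebraMap S R a₂) 1 • dsym r₂))
  | linear_right (a₁ a₂ : S) (r₁ r₂ : R) : DiffRel
      (dsym (a₁ • r₁ + a₂ • r₂) -
        (bi 1 (algebraMap S R a₁) • dsym r₁ + bi 1 (algebraMap S R a₂) • dsym r₂))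
  | leibniz (r₁ r₂ : R) : DiffRel (dsym (r₁ * r₂) - (bi 1 r₂ • dsym r₁ + bi r₁ 1 • dsym r₂))
  | center (r₁ r₃ : R) (h : r₃ ∈ Subring.center R) : DiffRel
      (bi 1 r₃ • dsym r₁ - bi r₃ 1 • dsym r₁)
  | chain {s : ℕ} (hs : 1 ≤ s) (h : SmoothFun s) (a : Fin s → A) : DiffRel
      (dsym (algebraMap A R (CInfRing.op h a)) -
        ∑ i, bi (algebraMap A R (CInfRing.op (h.pd i) a)) 1 • dsym (algebraMap A R (a i)))

/-- The sub-bimodule spanned by the relations. -/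
def diffRelations : Submodule (Env R) (FreeDiff R) :=
  Submodule.span (Env R) {x | DiffRel S A R x}

/-- The bi-`R`-module of differentials of the `S`-algebra `R`, whose centre contains the
`C^∞`-ring `A`. -/
def Omega : Type _ := FreeDiff R ⧸ diffRelations S A R

instance : AddCommGroup (Omega S A R) := inferInstanceAs (AddCommGroup (_ ⧸ diffRelations S A R))

instance : Module (Env R) (Omega S A R) :=
  inferInstanceAs (Module (Env R) (_ ⧸ diffRelations S A R))

/-- The quotient map. -/
def Omega.mk : FreeDiff R →ₗ[Env R] Omega S A R := (diffRelations S A R).mkQ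

theorem Omega.mk_surjective : Function.Surjective (Omega.mk S A R) :=
  (diffRelations S A R).mkQ_surjective

/-- The universal derivation `r ↦ dr`. -/
def Omega.d (r : R) : Omega S A R := Omega.mk S A R (dsym r)

variable {S A R}

/-- The map out of the free bimodule determined by a map on the generators, semilinear along a
ring homomorphism `τ`. -/
def freeLift {T M : Type*} [Ring T] [AddCommGroup M] [Module T M] (τ : Env R →+* T)
    (D : R → M) : FreeDiff R →ₛₗ[τ] M where
  toFun x := x.sum fun r e => τ e • D r
  map_add' x y := Finsupp.sum_add_index' (by simp) (by simp [add_smul])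
  map_smul' e x := by
    rw [Finsupp.sum_smul_index' (by simp), Finsupp.smul_sum]
    simp only [smul_eq_mul, map_mul, mul_smul]

theorem freeLift_dsym {T M : Type*} [Ring T] [AddCommGroup M] [Module T M] (τ : Env R →+* T)
    (D : R → M) (r : R) : freeLift τ D (dsym r) = D r := by
  change (Finsupp.single r (1 : Env R)).sum (fun r e => τ e • D r) = D r
  rw [Finsupp.sum_single_index (by simp), map_one, one_smul]

/-- The map out of the module of differentials determined by a map on the generators that
respects the relations. -/
def Omega.lift {T M : Type*} [Ring T] [AddCommGroup M] [Module T M] (τ : Env R →+* T)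
    (D : R → M) (hD : ∀ x, DiffRel S A R x → freeLift τ D x = 0) : Omega S A R →ₛₗ[τ] M :=
  (diffRelations S A R).liftQ (freeLift τ D) (Submodule.span_le.2 hD)

theorem Omega.lift_d {T M : Type*} [Ring T] [AddCommGroup M] [Module T M] (τ : Env R →+* T)
    (D : R → M) (hD : ∀ x, DiffRel S A R x → freeLift τ D x = 0) (r : R) :
    Omega.lift τ D hD (Omega.d S A R r) = D r :=
  freeLift_dsym τ D r

/-- Semilinear maps out of the module of differentials are determined by the values on the `dr`. -/
theorem Omega.hom_ext {T M : Type*} [Ring T] [AddCommGroup M] [Module T M] {τ : Env R →+* T}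
    {f g : Omega S A R →ₛₗ[τ] M} (h : ∀ r, f (Omega.d S A R r) = g (Omega.d S A R r)) : f = g := by
  refine LinearMap.ext fun x => ?_
  obtain ⟨x, rfl⟩ := Omega.mk_surjective S A R x
  induction x using Finsupp.induction_linear with
  | zero => rw [map_zero, map_zero, map_zero]
  | add x y hx hy => rw [map_add, map_add, map_add, hx, hy]
  | single r e =>
    have : Finsupp.single r e = e • dsym r := by simp
    rw [this, map_smul]
    exact (f.map_smulₛₗ e _).trans ((congrArg (τ e • ·) (h r)).trans (g.map_smulₛₗ e _).symm)

theorem Omega.mk_rel {x : FreeDiff R} (h : DiffRel S A R x) : Omega.mk S A R x = 0 :=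
  (Submodule.Quotient.mk_eq_zero _).2 (Submodule.subset_span h)

/-- A map on generators respects the relations if it satisfies the corresponding identities. -/
theorem freeLift_eq_zero {T M : Type*} [Ring T] [AddCommGroup M] [Module T M] (τ : Env R →+* T)
    (D : R → M)
    (linear_left : ∀ (a₁ a₂ : S) (r₁ r₂ : R), D (a₁ • r₁ + a₂ • r₂) =
      τ (bi (algebraMap S R a₁) 1) • D r₁ + τ (bi (algebraMap S R a₂) 1) • D r₂)
    (linear_right : ∀ (a₁ a₂ : S) (r₁ r₂ : R), D (a₁ • r₁ + a₂ • r₂) =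
      τ (bi 1 (algebraMap S R a₁)) • D r₁ + τ (bi 1 (algebraMap S R a₂)) • D r₂)
    (leibniz : ∀ r₁ r₂ : R, D (r₁ * r₂) = τ (bi 1 r₂) • D r₁ + τ (bi r₁ 1) • D r₂)
    (center : ∀ r₁ r₃ : R, r₃ ∈ Subring.center R → τ (bi 1 r₃) • D r₁ = τ (bi r₃ 1) • D r₁)
    (chain : ∀ {s : ℕ} (_ : 1 ≤ s) (h : SmoothFun s) (a : Fin s → A),
      D (algebraMap A R (CInfRing.op h a)) =
        ∑ i, τ (bi (algebraMap A R (CInfRing.op (h.pd i) a)) 1) • D (algebraMap A R (a i)))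
    (x : FreeDiff R) (hx : DiffRel S A R x) : freeLift τ D x = 0 := by
  cases hx <;>
    simp only [map_sub, map_add, map_sum, LinearMap.map_smulₛₗ, freeLift_dsym, sub_eq_zero]
  · exact linear_left _ _ _ _
  · exact linear_right _ _ _ _
  · exact leibniz _ _
  · exact center _ _ ‹_›
  · exact chain ‹_› _ _

namespace Omega

theorem d_linear_left (a₁ a₂ : S) (r₁ r₂ : R) : d S A R (a₁ • r₁ + a₂ • r₂) =
    bi (algebraMap S R a₁) 1 • d S A R r₁ + bi (algebraMap S R a₂) 1 • d S A R r₂ := by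
  have h := mk_rel (DiffRel.linear_left (A := A) a₁ a₂ r₁ r₂)
  rwa [map_sub, map_add, map_smul, map_smul, sub_eq_zero] at h

theorem d_linear_right (a₁ a₂ : S) (r₁ r₂ : R) : d S A R (a₁ • r₁ + a₂ • r₂) =
    bi 1 (algebraMap S R a₁) • d S A R r₁ + bi 1 (algebraMap S R a₂) • d S A R r₂ := by
  have h := mk_rel (DiffRel.linear_right (A := A) a₁ a₂ r₁ r₂)
  rwa [map_sub, map_add, map_smul, map_smul, sub_eq_zero] at h

theorem d_mul (r₁ r₂ : R) : d S A R (r₁ * r₂) = bi 1 r₂ • d S A R r₁ + bi r₁ 1 • d S A R r₂ := by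
  have h := mk_rel (DiffRel.leibniz (S := S) (A := A) r₁ r₂)
  rwa [map_sub, map_add, map_smul, map_smul, sub_eq_zero] at h

theorem d_center (r₁ r₃ : R) (h₃ : r₃ ∈ Subring.center R) :
    bi 1 r₃ • d S A R r₁ = bi r₃ 1 • d S A R r₁ := by
  have h := mk_rel (DiffRel.center (S := S) (A := A) r₁ r₃ h₃)
  rwa [map_sub, map_smul, map_smul, sub_eq_zero] at h

theorem d_chain {s : ℕ} (hs : 1 ≤ s) (f : SmoothFun s) (a : Fin s → A) :
    d S A R (algebraMap A R (CInfRing.op f a)) =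
      ∑ i, bi (algebraMap A R (CInfRing.op (f.pd i) a)) 1 • d S A R (algebraMap A R (a i)) := by
  have h := mk_rel (DiffRel.chain (S := S) (R := R) hs f a)
  rw [map_sub, map_sum, sub_eq_zero] at h
  simp only [map_smul] at h
  exact h

variable {S' A' R' : Type*} [CommRing S'] [CommRing A'] [CInfRing A'] [Ring R'] [Algebra ℂ R']
  [Algebra S' R'] [Algebra A' R']

/-- Functoriality of the module of differentials. -/
def map (f : R →ₐ[ℂ] R') (σ : S →+* S') (α : A →+* A')
    (hσ : ∀ c, f (algebraMap S R c) = algebraMap S' R' (σ c))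
    (hα : ∀ c, f (algebraMap A R c) = algebraMap A' R' (α c))
    (hop : ∀ {s : ℕ} (h : SmoothFun s) (a : Fin s → A),
      α (CInfRing.op h a) = CInfRing.op h fun i => α (a i))
    (hcenter : ∀ r ∈ Subring.center R, f r ∈ Subring.center R') :
    Omega S A R →ₛₗ[envMap f] Omega S' A' R' :=
  lift (envMap f) (fun r => d S' A' R' (f r)) (freeLift_eq_zero _ _
    (fun a₁ a₂ r₁ r₂ => by
      simp only [envMap_bi, map_one, hσ, Algebra.smul_def, map_add, map_mul]
      simpa only [Algebra.smul_def] using d_linear_left (A := A') (σ a₁) (σ a₂) (f r₁) (f r₂))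
    (fun a₁ a₂ r₁ r₂ => by
      simp only [envMap_bi, map_one, hσ, Algebra.smul_def, map_add, map_mul]
      simpa only [Algebra.smul_def] using d_linear_right (A := A') (σ a₁) (σ a₂) (f r₁) (f r₂))
    (fun r₁ r₂ => by
      simp only [envMap_bi, map_one, map_mul]
      exact d_mul _ _)
    (fun r₁ r₃ h => by
      simp only [envMap_bi, map_one]
      exact d_center _ _ (hcenter _ h))
    (fun hs h a => by
      simp only [envMap_bi, map_one, hα, hop]
      exact d_chain hs h _))

theorem map_d (f : R →ₐ[ℂ] R') (σ : S →+* S') (α : A →+* A') (hσ hα hop hcenter) (r : R) :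
    map f σ α hσ hα hop hcenter (d S A R r) = d S' A' R' (f r) :=
  lift_d _ _ _ r

end Omega

theorem envMap_id {R : Type*} [Ring R] [Algebra ℂ R] (f : R →ₐ[ℂ] R) (hf : ∀ r, f r = r)
    (e : Env R) : envMap f e = e := by
  induction e using env_induction with
  | h0 => rw [map_zero]
  | hadd e e' h h' => rw [map_add, h, h']
  | hbi a b => rw [envMap_bi, hf, hf]

theorem envMap_comp {R R' R'' : Type*} [Ring R] [Algebra ℂ R] [Ring R'] [Algebra ℂ R'] [Ring R'']
    [Algebra ℂ R''] (f : R →ₐ[ℂ] R') (g : R' →ₐ[ℂ] R'') (k : R →ₐ[ℂ] R'')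
    (h : ∀ r, g (f r) = k r) (e : Env R) : envMap g (envMap f e) = envMap k e := by
  induction e using env_induction with
  | h0 => rw [map_zero, map_zero, map_zero]
  | hadd e e' h h' => rw [map_add, map_add, map_add, h, h']
  | hbi a b => rw [envMap_bi, envMap_bi, envMap_bi, h, h]

theorem Omega.induction {p : Omega S A R → Prop} (h0 : p 0)
    (hadd : ∀ x y, p x → p y → p (x + y)) (hd : ∀ (e : Env R) (r : R), p (e • Omega.d S A R r))
    (x : Omega S A R) : p x := by
  obtain ⟨x, rfl⟩ := Omega.mk_surjective S A R x
  induction x using Finsupp.induction_linear with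
  | zero => rw [map_zero]; exact h0
  | add x y hx hy => rw [map_add]; exact hadd _ _ hx hy
  | single r e =>
    have : Finsupp.single r e = e • dsym r := by simp
    rw [this, map_smul]
    exact hd e r


theorem Omega.map_self (f : R →ₐ[ℂ] R) (σ : S →+* S) (α : A →+* A) (hσ hα hop hcenter)
    (hf : ∀ r, f r = r) (x : Omega S A R) : Omega.map f σ α hσ hα hop hcenter x = x := by
  induction x using Omega.induction with
  | h0 => rw [map_zero]
  | hadd x y hx hy => rw [map_add, hx, hy]
  | hd e r => rw [LinearMap.map_smulₛₗ, Omega.map_d, envMap_id f hf, hf]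

theorem Omega.map_map {S' A' R' : Type*} [CommRing S'] [CommRing A'] [CInfRing A'] [Ring R']
    [Algebra ℂ R'] [Algebra S' R'] [Algebra A' R']
    {S'' A'' R'' : Type*} [CommRing S''] [CommRing A''] [CInfRing A''] [Ring R'']
    [Algebra ℂ R''] [Algebra S'' R''] [Algebra A'' R'']
    (f : R →ₐ[ℂ] R') (σ : S →+* S') (α : A →+* A') (hσ hα hop hcenter)
    (f' : R' →ₐ[ℂ] R'') (σ' : S' →+* S'') (α' : A' →+* A'') (hσ' hα' hop' hcenter')
    (f'' : R →ₐ[ℂ] R'') (σ'' : S →+* S'') (α'' : A →+* A'') (hσ'' hα'' hop'' hcenter'')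
    (hf : ∀ r, f' (f r) = f'' r) (x : Omega S A R) :
    Omega.map f' σ' α' hσ' hα' hop' hcenter' (Omega.map f σ α hσ hα hop hcenter x) =
      Omega.map f'' σ'' α'' hσ'' hα'' hop'' hcenter'' x := by
  induction x using Omega.induction with
  | h0 => simp only [map_zero]
  | hadd x y hx hy => simp only [map_add, hx, hy]
  | hd e r =>
    simp only [LinearMap.map_smulₛₗ, Omega.map_d, envMap_comp f f' f'' hf, hf]

end Omega
end Bimodules

/-! ### Smooth functions and smooth sections of vector bundles over open subsets -/

section Smooth

open Bundle

section Functions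

variable (E : Type*) [NormedAddCommGroup E] [NormedSpace ℝ E] {Y : Type*} [TopologicalSpace Y]
  [ChartedSpace E Y]

instance normedFieldContMDiffRing (𝕂 : Type*) [NormedField 𝕂] [NormedAlgebra ℝ 𝕂] :
    ContMDiffRing 𝓘(ℝ, 𝕂) ∞ 𝕂 where
  contMDiff_mul := by
    rw [contMDiff_iff]
    refine ⟨continuous_mul, fun x y => ?_⟩
    simp only [mfld_simps, chartAt_self_eq]
    rw [contDiffOn_univ]
    exact contDiff_mul

/-- The smooth `T`-valued functions on the open set `U`. -/
abbrev Fn (T : Type*) [NormedAddCommGroup T] [NormedSpace ℝ T] (U : Opens Y) : Type _ :=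
  C^∞⟮𝓘(ℝ, E), U; 𝓘(ℝ, T), T⟯

/-- Restriction of smooth functions. -/
def Fn.res (𝕂 : Type*) [NormedField 𝕂] [NormedAlgebra ℝ 𝕂] {U W : Opens Y} (h : W ≤ U) :
    Fn E 𝕂 U →+* Fn E 𝕂 W :=
  ContMDiffMap.restrictRingHom 𝓘(ℝ, E) 𝓘(ℝ, 𝕂) 𝕂 h

theorem Fn.res_apply {𝕂 : Type*} [NormedField 𝕂] [NormedAlgebra ℝ 𝕂] {U W : Opens Y} (h : W ≤ U)
    (f : Fn E 𝕂 U) (y : W) : Fn.res E 𝕂 h f y = f ⟨y.1, h y.2⟩ := rfl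

/-- The inclusion of the real-valued into the complex-valued smooth functions. -/
def Fn.toComplex (U : Opens Y) : Fn E ℝ U →+* Fn E ℂ U where
  toFun f := ⟨fun y => (f y : ℂ), Complex.ofRealCLM.contDiff.contMDiff.comp f.contMDiff⟩
  map_one' := ContMDiffMap.ext fun _ => Complex.ofReal_one
  map_mul' f g := ContMDiffMap.ext fun y => Complex.ofReal_mul (f y) (g y)
  map_zero' := ContMDiffMap.ext fun _ => Complex.ofReal_zero
  map_add' f g := ContMDiffMap.ext fun y => Complex.ofReal_add (f y) (g y)

/-- The constant complex-valued functions. -/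
def Fn.const (U : Opens Y) : ℂ →+* Fn E ℂ U where
  toFun c := ⟨fun _ => c, contMDiff_const⟩
  map_one' := rfl
  map_mul' _ _ := rfl
  map_zero' := rfl
  map_add' _ _ := rfl

/-- Smooth real functions form a `C^∞`-ring under composition. -/
instance (U : Opens Y) : CInfRing (Fn E ℝ U) where
  op h a := ⟨fun y => h.fn fun i => a i y,
    h.smooth.contMDiff.comp (contMDiff_pi_space.2 fun i => (a i).contMDiff)⟩
  op_proj _ _ := rfl
  op_comp _ _ _ := rfl
  op_add _ := rfl
  op_mul _ := rfl

theorem Fn.op_apply {U : Opens Y} {s : ℕ} (h : SmoothFun s) (a : Fin s → Fn E ℝ U) (y : U) :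
    CInfRing.op h a y = h.fn fun i => a i y := rfl

end Functions

section Sections

variable (E : Type*) [NormedAddCommGroup E] [NormedSpace ℝ E] {Y : Type*} [TopologicalSpace Y]
  [ChartedSpace E Y]
  (F : Type*) [NormedAddCommGroup F] [NormedSpace ℝ F] (V : Y → Type*)
  [TopologicalSpace (TotalSpace F V)] [∀ y, TopologicalSpace (V y)] [FiberBundle F V]

/-- A section `s` of the bundle `V` over the open set `U` is smooth. -/
def IsSmoothSec {U : Opens Y} (s : ∀ y : U, V y) : Prop :=
  ContMDiff 𝓘(ℝ, E) (𝓘(ℝ, E).prod 𝓘(ℝ, F)) ∞ fun y : U => TotalSpace.mk' F (E := V) y.1 (s y)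

variable {E F V} in
theorem isSmoothSec_iff {U : Opens Y} {s : ∀ y : U, V y} :
    IsSmoothSec E F V s ↔ ∀ y : U, ContMDiffAt 𝓘(ℝ, E) 𝓘(ℝ, F) ∞
      (fun z : U => (trivializationAt F V y.1 (TotalSpace.mk' F z.1 (s z))).2) y := by
  refine forall_congr' fun y => ?_
  rw [contMDiffAt_totalSpace]
  exact and_iff_right contMDiff_subtype_val.contMDiffAt

variable (𝕂 : Type*) [NontriviallyNormedField 𝕂] [NormedAlgebra ℝ 𝕂] [NormedSpace 𝕂 F]
  [IsScalarTower ℝ 𝕂 F] [∀ y, AddCommGroup (V y)] [∀ y, Module 𝕂 (V y)] [VectorBundle 𝕂 F V]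

variable {F V} in
/-- In a local trivialization the fibrewise operations are those of the model fibre. -/
theorem eventually_linear {U : Opens Y} (y : U) : ∀ᶠ z : U in nhds y,
    IsLinearMap 𝕂 fun v : V z.1 => (trivializationAt F V y.1 (TotalSpace.mk' F z.1 v)).2 := by
  have h : (trivializationAt F V y.1).baseSet ∈ nhds y.1 :=
    (trivializationAt F V y.1).open_baseSet.mem_nhds (mem_baseSet_trivializationAt F V y.1)
  filter_upwards [continuous_subtype_val.continuousAt.preimage_mem_nhds h] with z hz
  exact (trivializationAt F V y.1).linear 𝕂 hz

/-- The smooth sections of the bundle `V` (over the field `𝕂`) over the open set `U`. -/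
def Sec (U : Opens Y) : AddSubgroup (∀ y : U, V y) where
  carrier := {s | IsSmoothSec E F V s}
  zero_mem' := isSmoothSec_iff.2 fun y => by
    refine (contMDiffAt_const (c := (0 : F))).congr_of_eventuallyEq ?_
    filter_upwards [eventually_linear (F := F) (V := V) 𝕂 y] with z hz
    exact hz.map_zero
  add_mem' := fun {s t} hs ht => isSmoothSec_iff.2 fun y => by
    refine ((isSmoothSec_iff.1 hs y).add (isSmoothSec_iff.1 ht y)).congr_of_eventuallyEq ?_
    filter_upwards [eventually_linear (F := F) (V := V) 𝕂 y] with z hz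
    exact hz.map_add _ _
  neg_mem' := fun {s} hs => isSmoothSec_iff.2 fun y => by
    refine (isSmoothSec_iff.1 hs y).neg.congr_of_eventuallyEq ?_
    filter_upwards [eventually_linear (F := F) (V := V) 𝕂 y] with z hz
    exact hz.map_neg _

variable {F V} in
theorem IsSmoothSec.smul {U : Opens Y} (f : Fn E 𝕂 U) {s : ∀ y : U, V y}
    (hs : IsSmoothSec E F V s) : IsSmoothSec E F V fun y => f y • s y :=
  isSmoothSec_iff.2 fun y => by
    have h : ContMDiffAt 𝓘(ℝ, E) 𝓘(ℝ, F) ∞ (fun z : U => f z •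
        (trivializationAt F V y.1 (TotalSpace.mk' F z.1 (s z))).2) y :=
      (contDiff_smul (𝕜 := ℝ) (𝕜' := 𝕂) (F := F)).contMDiff.contMDiffAt.comp y
        (f.contMDiff.contMDiffAt.prodMk_space (isSmoothSec_iff.1 hs y))
    refine h.congr_of_eventuallyEq ?_
    filter_upwards [eventually_linear (F := F) (V := V) 𝕂 y] with z hz
    exact hz.map_smul _ _

/-- The smooth sections form a module over the smooth functions. -/
instance Sec.module (U : Opens Y) : Module (Fn E 𝕂 U) (Sec E F V 𝕂 U) where
  smul f s := ⟨fun y => f y • s.1 y, IsSmoothSec.smul E 𝕂 f s.2⟩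
  one_smul _ := Subtype.ext (funext fun _ => one_smul 𝕂 _)
  mul_smul _ _ _ := Subtype.ext (funext fun _ => mul_smul _ _ _)
  smul_zero _ := Subtype.ext (funext fun _ => smul_zero _)
  smul_add _ _ _ := Subtype.ext (funext fun _ => smul_add _ _ _)
  add_smul _ _ _ := Subtype.ext (funext fun _ => add_smul _ _ _)
  zero_smul _ := Subtype.ext (funext fun _ => zero_smul 𝕂 _)

variable {E F V 𝕂}

/-- Restriction of sections. -/
def Sec.res {U W : Opens Y} (h : W ≤ U) : Sec E F V 𝕂 U →+ Sec E F V 𝕂 W where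
  toFun s := ⟨fun y => s.1 ⟨y.1, h y.2⟩, ContMDiff.comp s.2 (contMDiff_inclusion h)⟩
  map_zero' := rfl
  map_add' _ _ := rfl

theorem Sec.res_apply {U W : Opens Y} (h : W ≤ U) (s : Sec E F V 𝕂 U) (y : W) :
    (Sec.res h s).1 y = s.1 ⟨y.1, h y.2⟩ := rfl

theorem Sec.smul_apply {U : Opens Y} (f : Fn E 𝕂 U) (s : Sec E F V 𝕂 U) (y : U) :
    (f • s).1 y = f y • s.1 y := rfl

theorem Sec.res_smul {U W : Opens Y} (h : W ≤ U) (f : Fn E 𝕂 U) (s : Sec E F V 𝕂 U) :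
    Sec.res h (f • s) = Fn.res E 𝕂 h f • Sec.res h s := rfl

theorem Sec.res_res {U W N : Opens Y} (h : W ≤ U) (k : N ≤ W) (s : Sec E F V 𝕂 U) :
    Sec.res k (Sec.res h s) = Sec.res (k.trans h) s := rfl

end Sections

section Calculus

variable (E : Type*) [NormedAddCommGroup E] [NormedSpace ℝ E] {Y : Type*} [TopologicalSpace Y]
  [ChartedSpace E Y]

/-- Extension by zero of a function on an open subset. -/
def extZero {T : Type*} [Zero T] {U : Opens Y} (f : U → T) : Y → T :=
  Function.extend Subtype.val f 0

theorem extZero_apply {T : Type*} [Zero T] {U : Opens Y} (f : U → T) (y : U) :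
    extZero f y.1 = f y := Subtype.val_injective.extend_apply f 0 y

theorem extZero_contMDiffAt {T : Type*} [NormedAddCommGroup T] [NormedSpace ℝ T] {U : Opens Y}
    (f : Fn E T U) (y : U) : ContMDiffAt 𝓘(ℝ, E) 𝓘(ℝ, T) ∞ (extZero f) y.1 := by
  rw [← contMDiffAt_subtype_iff]
  simp only [extZero_apply]
  exact f.contMDiff.contMDiffAt

theorem extZero_eventuallyEq {T : Type*} [Zero T] {U : Opens Y} {f : U → T} {g : Y → T} (y : U)
    (h : ∀ᶠ z : U in nhds y, f z = g z.1) : extZero f =ᶠ[nhds y.1] g := by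
  rw [Filter.EventuallyEq, ← map_nhds_subtype_coe_eq_nhds y.2 (U.2.mem_nhds y.2),
    Filter.eventually_map]
  filter_upwards [h] with z hz
  rw [extZero_apply, hz]

variable (Y) in
/-- The bundle of cotangent vectors with values in `T`. -/
abbrev CoT (T : Type*) [NormedAddCommGroup T] [NormedSpace ℝ T] (y : Y) : Type _ :=
  TangentSpace 𝓘(ℝ, E) y →L[ℝ] Bundle.Trivial Y T y

/-- The differential of a smooth function at a point of the open set `U`. -/
def dAt {T : Type*} [NormedAddCommGroup T] [NormedSpace ℝ T] {U : Opens Y} (f : Fn E T U)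
    (y : U) : CoT E Y T y.1 :=
  mfderiv 𝓘(ℝ, E) 𝓘(ℝ, T) (extZero f) y.1

variable [IsManifold 𝓘(ℝ, E) ∞ Y]

instance : IsManifold 𝓘(ℝ, E) 1 Y := IsManifold.of_le (n := ∞) (by norm_cast)

theorem dAt_smooth {T : Type*} [NormedAddCommGroup T] [NormedSpace ℝ T] {U : Opens Y}
    (f : Fn E T U) : IsSmoothSec E (E →L[ℝ] T) (CoT E Y T) (dAt E f) := by
  intro y
  rw [contMDiffAt_hom_bundle]
  refine ⟨contMDiff_subtype_val.contMDiffAt, ?_⟩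
  have h := (extZero_contMDiffAt E f y).mfderiv_const (m := ∞) le_rfl
  have h' := h.comp y (contMDiff_subtype_val (I := 𝓘(ℝ, E)) (n := ∞)).contMDiffAt
  refine h'.congr_of_eventuallyEq (Filter.Eventually.of_forall fun z => ?_)
  simp only [inTangentCoordinates, ContinuousLinearMap.inCoordinates, Function.comp]
  have h1 : Trivialization.continuousLinearMapAt ℝ
      (trivializationAt T (TangentSpace 𝓘(ℝ, T)) (extZero f y.1)) (extZero f z.1) =
      (1 : T →L[ℝ] T) := TangentBundle.continuousLinearMapAt_model_space _ _
  have h2 : Trivialization.continuousLinearMapAt ℝ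
      (trivializationAt T (Bundle.Trivial Y T) y.1) z.1 = (1 : T →L[ℝ] T) := by
    ext v
    exact congrFun (Trivialization.coe_linearMapAt_of_mem (R := ℝ)
      (trivializationAt T (Bundle.Trivial Y T) y.1) (Set.mem_univ z.1)) v
  refine ContinuousLinearMap.ext fun v => ?_
  refine (congrArg (fun l : T →L[ℝ] T => l _) h2).trans ?_
  exact (congrArg (fun l : T →L[ℝ] T => l _) h1).symm

variable (Y) in
/-- The tangent spaces of `Y`. -/
abbrev Tan (y : Y) : Type _ := TangentSpace 𝓘(ℝ, E) y

/-- Evaluating a smooth `T`-valued 1-form on a smooth vector field gives a smooth function. -/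
theorem contract_smooth {T : Type*} [NormedAddCommGroup T] [NormedSpace ℝ T] {U : Opens Y}
    {θ : ∀ y : U, CoT E Y T y.1} (hθ : IsSmoothSec E (E →L[ℝ] T) (CoT E Y T) θ)
    {ξ : ∀ y : U, Tan E Y y.1} (hξ : IsSmoothSec E E (Tan E Y) ξ) :
    ContMDiff 𝓘(ℝ, E) 𝓘(ℝ, T) ∞ fun y : U => (θ y (ξ y) : T) := by
  intro y
  have h := (hθ y).clm_bundle_apply (hξ y)
  rw [contMDiffAt_totalSpace] at h
  exact h.2

/-- The smooth vector fields on the open set `U`: sections of the tangent sheaf of `Y`. -/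
abbrev Vec (U : Opens Y) : Type _ := Sec E E (Tan E Y) ℝ U

/-- The smooth 1-forms on the open set `U`: sections of the cotangent sheaf of `Y`. -/
abbrev OneForm (U : Opens Y) : Type _ := Sec E (E →L[ℝ] ℝ) (CoT E Y ℝ) ℝ U

variable {E}

/-- The differential of a smooth real function. -/
def OneForm.d {U : Opens Y} (f : Fn E ℝ U) : OneForm E U := ⟨dAt E f, dAt_smooth E f⟩

/-- The value `θ(ξ)` of a 1-form on a vector field. -/
def contract {U : Opens Y} (ξ : Vec E U) (θ : OneForm E U) : Fn E ℝ U :=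
  ⟨fun y => θ.1 y (ξ.1 y), contract_smooth E θ.2 ξ.2⟩

/-- The derivative `ξ f` of a smooth function along a vector field. -/
def Vec.deriv {T : Type*} [NormedAddCommGroup T] [NormedSpace ℝ T] {U : Opens Y} (ξ : Vec E U)
    (f : Fn E T U) : Fn E T U :=
  ⟨fun y => dAt E f y (ξ.1 y), contract_smooth E (dAt_smooth E f) ξ.2⟩

theorem contract_add {U : Opens Y} (ξ : Vec E U) (θ θ' : OneForm E U) :
    contract ξ (θ + θ') = contract ξ θ + contract ξ θ' := rfl

theorem contract_smul {U : Opens Y} (ξ : Vec E U) (f : Fn E ℝ U) (θ : OneForm E U) :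
    contract ξ (f • θ) = f * contract ξ θ := rfl

theorem contract_res {U W : Opens Y} (h : W ≤ U) (ξ : Vec E U) (θ : OneForm E U) :
    Fn.res E ℝ h (contract ξ θ) = contract (Sec.res h ξ) (Sec.res h θ) := rfl

theorem dAt_congr {T : Type*} [NormedAddCommGroup T] [NormedSpace ℝ T] {U : Opens Y}
    (f : Fn E T U) {g : Y → T} (y : U) (h : ∀ᶠ z : U in nhds y, f z = g z.1) :
    dAt E f y = mfderiv 𝓘(ℝ, E) 𝓘(ℝ, T) g y.1 :=
  (extZero_eventuallyEq y h).mfderiv_eq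

theorem dAt_res {𝕂 : Type*} [NormedField 𝕂] [NormedAlgebra ℝ 𝕂] {U W : Opens Y} (h : W ≤ U)
    (f : Fn E 𝕂 U) (y : W) : dAt E (Fn.res E 𝕂 h f) y = dAt E f ⟨y.1, h y.2⟩ :=
  dAt_congr _ y (Filter.Eventually.of_forall fun z => (extZero_apply f ⟨z.1, h z.2⟩).symm)

theorem Vec.deriv_res {𝕂 : Type*} [NormedField 𝕂] [NormedAlgebra ℝ 𝕂] {U W : Opens Y} (h : W ≤ U)
    (ξ : Vec E U) (f : Fn E 𝕂 U) :
    Fn.res E 𝕂 h (ξ.deriv f) = Vec.deriv (Sec.res h ξ) (Fn.res E 𝕂 h f) :=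
  ContMDiffMap.ext fun y => by
    change dAt E f ⟨y.1, h y.2⟩ _ = dAt E (Fn.res E 𝕂 h f) y _
    rw [dAt_res]
    rfl

/-- The derivative along a vector field commutes with the inclusion of real functions into
complex functions. -/
theorem Vec.deriv_toComplex {U : Opens Y} (ξ : Vec E U) (f : Fn E ℝ U) :
    ξ.deriv (Fn.toComplex E U f) = Fn.toComplex E U (ξ.deriv f) :=
  ContMDiffMap.ext fun y => by
    have hf : MDifferentiableAt 𝓘(ℝ, E) 𝓘(ℝ, ℝ) (extZero f) y.1 :=
      (extZero_contMDiffAt E f y).mdifferentiableAt (by simp)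
    have hc : MDifferentiableAt 𝓘(ℝ, ℝ) 𝓘(ℝ, ℂ) (Complex.ofRealCLM) (extZero f y.1) :=
      Complex.ofRealCLM.contDiff.contMDiff.mdifferentiableAt (n := 1) (by simp)
    have h := dAt_congr (Fn.toComplex E U f) (g := Complex.ofRealCLM ∘ extZero f) y
      (Filter.Eventually.of_forall fun z => by
        rw [Function.comp_apply, extZero_apply]; rfl)
    change dAt E (Fn.toComplex E U f) y (ξ.1 y) = ((dAt E f y (ξ.1 y) : ℝ) : ℂ)
    rw [h, mfderiv_comp y.1 hc hf, mfderiv_eq_fderiv, ContinuousLinearMap.fderiv]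
    rfl

/-- The chain rule for the derivative along a vector field. -/
theorem Vec.deriv_op {U : Opens Y} (ξ : Vec E U) {s : ℕ} (h : SmoothFun s)
    (a : Fin s → Fn E ℝ U) : ξ.deriv (CInfRing.op h a) =
      ∑ i, CInfRing.op (h.pd i) a * ξ.deriv (a i) := by
  refine ContMDiffMap.ext fun y => ?_
  have ha : ∀ i, HasMFDerivAt 𝓘(ℝ, E) 𝓘(ℝ, ℝ) (extZero (a i)) y.1 (dAt E (a i) y) := fun i =>
    ((extZero_contMDiffAt E (a i) y).mdifferentiableAt (by simp)).hasMFDerivAt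
  have hp : HasMFDerivAt 𝓘(ℝ, E) 𝓘(ℝ, Fin s → ℝ) (fun z i => extZero (a i) z) y.1
      (ContinuousLinearMap.pi fun i => dAt E (a i) y) :=
    ⟨continuousAt_pi.2 fun i => (ha i).1, hasFDerivWithinAt_pi.2 fun i => (ha i).2⟩
  have hh : HasMFDerivAt 𝓘(ℝ, Fin s → ℝ) 𝓘(ℝ, ℝ) h.fn (fun i => extZero (a i) y.1)
      (fderiv ℝ h.fn fun i => extZero (a i) y.1) :=
    ((h.smooth.differentiable (by simp)) _).hasFDerivAt.hasMFDerivAt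
  have hc := (HasMFDerivAt.comp y.1 hh hp).mfderiv
  have h' := dAt_congr (CInfRing.op h a) (g := h.fn ∘ fun z i => extZero (a i) z) y
    (Filter.Eventually.of_forall fun z => by
      simp only [Function.comp_apply, extZero_apply]; rfl)
  have hsum : ∀ z : U, (∑ i, CInfRing.op (h.pd i) a * ξ.deriv (a i)) z =
      ∑ i, (CInfRing.op (h.pd i) a) z * (ξ.deriv (a i)) z := fun z => by
    rw [← ContMDiffMap.coeFnAddMonoidHom_apply]
    rw [map_sum, Finset.sum_apply]
    rfl
  rw [hsum]
  change dAt E (CInfRing.op h a) y (ξ.1 y) = _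
  rw [h', hc]
  change fderiv ℝ h.fn (fun i => extZero (a i) y.1) (fun i => dAt E (a i) y (ξ.1 y)) = _
  simp only [extZero_apply]
  rw [← ContinuousLinearMap.coe_coe, LinearMap.pi_apply_eq_sum_univ]
  refine Finset.sum_congr rfl fun i _ => ?_
  rw [smul_eq_mul, mul_comm]
  refine congrArg (· * _) (congrArg (fderiv ℝ h.fn fun i => a i y) (funext fun j => ?_))
  simp [Pi.single_apply, eq_comm]

theorem OneForm.d_res {U W : Opens Y} (h : W ≤ U) (f : Fn E ℝ U) :
    Sec.res h (OneForm.d f) = OneForm.d (Fn.res E ℝ h f) :=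
  Subtype.ext (funext fun y => (dAt_res h f y).symm)

theorem Vec.deriv_mul {U : Opens Y} (ξ : Vec E U) (f g : Fn E ℂ U) :
    ξ.deriv (f * g) = ξ.deriv f * g + f * ξ.deriv g := by
  refine ContMDiffMap.ext fun y => ?_
  have hf : ∀ f : Fn E ℂ U, HasMFDerivAt 𝓘(ℝ, E) 𝓘(ℝ, ℂ) (extZero f) y.1 (dAt E f y) := fun f =>
    ((extZero_contMDiffAt E f y).mdifferentiableAt (by simp)).hasMFDerivAt
  have h' := dAt_congr (f * g) (g := extZero f * extZero g) y
    (Filter.Eventually.of_forall fun z => by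
      simp only [Pi.mul_apply, extZero_apply]; rfl)
  change dAt E (f * g) y (ξ.1 y) = dAt E f y (ξ.1 y) * g y + f y * dAt E g y (ξ.1 y)
  rw [h', ((hf f).mul (hf g)).mfderiv]
  change extZero f y.1 * dAt E g y (ξ.1 y) + extZero g y.1 * dAt E f y (ξ.1 y) = _
  rw [extZero_apply, extZero_apply]
  ring

end Calculus
end Smooth

/-! ### The sheaf of endomorphisms of the sheaf of sections of a complex vector bundle -/

section Nc

open Bundle

variable (E : Type*) [NormedAddCommGroup E] [NormedSpace ℝ E] {Y : Type*} [TopologicalSpace Y]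
  [ChartedSpace E Y]
  (F : Type*) [NormedAddCommGroup F] [NormedSpace ℂ F] (V : Y → Type*)
  [TopologicalSpace (TotalSpace F V)] [∀ y, TopologicalSpace (V y)] [FiberBundle F V]
  [∀ y, AddCommGroup (V y)] [∀ y, Module ℂ (V y)] [VectorBundle ℂ F V]

/-- A complex vector bundle on the real manifold `Y` is smooth if its transition functions are
smooth. -/
class SmoothComplexBundle : Prop where
  contMDiffOn_coordChangeL : ∀ (e e' : Trivialization F (TotalSpace.proj : TotalSpace F V → Y))
    [MemTrivializationAtlas e] [MemTrivializationAtlas e'],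
    ContMDiffOn 𝓘(ℝ, E) 𝓘(ℝ, F →L[ℂ] F) ∞
      (fun b : Y => (e.coordChangeL ℂ e' b : F →L[ℂ] F)) (e.baseSet ∩ e'.baseSet)

/-- The ring of `𝒪^ℂ`-linear endomorphisms, over the open set `U`, of the sheaf of smooth sections
of `V`: families of linear endomorphisms over the open subsets of `U` that commute with
restriction. -/
def ncSubring (U : Opens Y) :
    Subring (∀ W : {W : Opens Y // W ≤ U}, Module.End (Fn E ℂ W.1) (Sec E F V ℂ W.1)) where
  carrier := {A | ∀ (W N : Opens Y) (h : W ≤ U) (k : N ≤ W) (s : Sec E F V ℂ W),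
    Sec.res k (A ⟨W, h⟩ s) = A ⟨N, k.trans h⟩ (Sec.res k s)}
  mul_mem' := fun {A B} hA hB W N h k s =>
    (hA W N h k _).trans (congrArg (A ⟨N, k.trans h⟩) (hB W N h k s))
  one_mem' _ _ _ _ _ := rfl
  add_mem' := fun {A B} hA hB W N h k s => by
    change Sec.res k (A ⟨W, h⟩ s + B ⟨W, h⟩ s) = _
    rw [map_add, hA W N h k, hB W N h k]
    rfl
  zero_mem' _ _ _ _ _ := rfl
  neg_mem' := fun {A} hA W N h k s => by
    change Sec.res k (-(A ⟨W, h⟩ s)) = _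
    rw [map_neg, hA W N h k]
    rfl

/-- The sections over `U` of the structure sheaf of the Azumaya manifold: endomorphisms of the
sheaf of smooth sections of `V`, restricted to `U`. -/
def Nc (U : Opens Y) : Type _ := ncSubring E F V U

instance (U : Opens Y) : Ring (Nc E F V U) := inferInstanceAs (Ring (ncSubring E F V U))

variable {E F V}

namespace Nc

/-- The action of an endomorphism over `U` on the sections over an open subset `W ⊆ U`. -/
def app {U : Opens Y} (A : Nc E F V U) {W : Opens Y} (h : W ≤ U) :
    Sec E F V ℂ W →ₗ[Fn E ℂ W] Sec E F V ℂ W := A.1 ⟨W, h⟩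

theorem app_res {U W N : Opens Y} (A : Nc E F V U) (h : W ≤ U) (k : N ≤ W) (s : Sec E F V ℂ W) :
    Sec.res k (A.app h s) = A.app (k.trans h) (Sec.res k s) := A.2 W N h k s

/-- An endomorphism from its components. -/
def mk {U : Opens Y} (A : ∀ W : Opens Y, W ≤ U → Module.End (Fn E ℂ W) (Sec E F V ℂ W))
    (hA : ∀ {W N : Opens Y} (h : W ≤ U) (k : N ≤ W) (s : Sec E F V ℂ W),
      Sec.res k (A W h s) = A N (k.trans h) (Sec.res k s)) : Nc E F V U :=
  ⟨fun W => A W.1 W.2, fun _ _ h k s => hA h k s⟩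

theorem ext {U : Opens Y} {A B : Nc E F V U}
    (h : ∀ (W : Opens Y) (k : W ≤ U) (s : Sec E F V ℂ W), A.app k s = B.app k s) : A = B :=
  Subtype.ext (funext fun W => LinearMap.ext fun s => h W.1 W.2 s)

theorem mk_app {U W : Opens Y} (A hA) (h : W ≤ U) (s : Sec E F V ℂ W) :
    (mk (E := E) (F := F) (V := V) (U := U) A hA).app h s = A W h s := rfl

theorem mul_app {U W : Opens Y} (A B : Nc E F V U) (h : W ≤ U) (s : Sec E F V ℂ W) :
    (A * B).app h s = A.app h (B.app h s) := rfl

theorem one_app {U W : Opens Y} (h : W ≤ U) (s : Sec E F V ℂ W) :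
    (1 : Nc E F V U).app h s = s := rfl

theorem zero_app {U W : Opens Y} (h : W ≤ U) (s : Sec E F V ℂ W) :
    (0 : Nc E F V U).app h s = 0 := rfl

theorem add_app {U W : Opens Y} (A B : Nc E F V U) (h : W ≤ U) (s : Sec E F V ℂ W) :
    (A + B).app h s = A.app h s + B.app h s := rfl

/-- Restriction of endomorphisms to an open subset. -/
def resHom {U W : Opens Y} (h : W ≤ U) : Nc E F V U →+* Nc E F V W where
  toFun A := mk (fun _ k => A.app (k.trans h)) (fun k l s => A.app_res (k.trans h) l s)
  map_one' := rfl
  map_mul' _ _ := rfl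
  map_zero' := rfl
  map_add' _ _ := rfl

theorem resHom_app {U W N : Opens Y} (h : W ≤ U) (k : N ≤ W) (A : Nc E F V U)
    (s : Sec E F V ℂ N) : (resHom h A).app k s = A.app (k.trans h) s := rfl

/-- Multiplication by a smooth complex-valued function. -/
def ofFn (U : Opens Y) : Fn E ℂ U →+* Nc E F V U where
  toFun f := mk (fun W h => LinearMap.lsmul (Fn E ℂ W) (Sec E F V ℂ W) (Fn.res E ℂ h f))
    (fun _ _ _ => rfl)
  map_one' := ext fun W h s => by
    change Fn.res E ℂ h 1 • s = s
    rw [map_one, one_smul]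
  map_mul' f g := ext fun W h s => by
    change Fn.res E ℂ h (f * g) • s = Fn.res E ℂ h f • Fn.res E ℂ h g • s
    rw [map_mul, mul_smul]
  map_zero' := ext fun W h s => by
    change Fn.res E ℂ h 0 • s = 0
    rw [map_zero, zero_smul]
  map_add' f g := ext fun W h s => by
    change Fn.res E ℂ h (f + g) • s = Fn.res E ℂ h f • s + Fn.res E ℂ h g • s
    rw [map_add, add_smul]

theorem ofFn_app {U W : Opens Y} (f : Fn E ℂ U) (h : W ≤ U) (s : Sec E F V ℂ W) :
    (ofFn U f : Nc E F V U).app h s = Fn.res E ℂ h f • s := rfl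

theorem resHom_ofFn {U W : Opens Y} (h : W ≤ U) (f : Fn E ℂ U) :
    resHom h (ofFn U f : Nc E F V U) = ofFn W (Fn.res E ℂ h f) := rfl

theorem ofFn_commutes {U : Opens Y} (f : Fn E ℂ U) (A : Nc E F V U) :
    ofFn U f * A = A * ofFn U f :=
  ext fun _ h s => ((A.app h).map_smul (Fn.res E ℂ h f) s).symm

/-- The endomorphisms form an algebra over the complex-valued smooth functions. -/
instance (U : Opens Y) : Algebra (Fn E ℂ U) (Nc E F V U) :=
  RingHom.toAlgebra' (ofFn U) ofFn_commutes

/-- The endomorphisms form an algebra over the real-valued smooth functions. -/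
instance (U : Opens Y) : Algebra (Fn E ℝ U) (Nc E F V U) :=
  RingHom.toAlgebra' ((ofFn U).comp (Fn.toComplex E U)) fun _ => ofFn_commutes _

/-- The endomorphisms form an algebra over the complex numbers. -/
instance (U : Opens Y) : Algebra ℂ (Nc E F V U) :=
  RingHom.toAlgebra' ((ofFn U).comp (Fn.const E U)) fun _ => ofFn_commutes _

/-- Restriction as a homomorphism of complex algebras. -/
def res {U W : Opens Y} (h : W ≤ U) : Nc E F V U →ₐ[ℂ] Nc E F V W :=
  { resHom h with commutes' := fun _ => rfl }

theorem res_app {U W N : Opens Y} (h : W ≤ U) (k : N ≤ W) (A : Nc E F V U)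
    (s : Sec E F V ℂ N) : (res h A).app k s = A.app (k.trans h) s := rfl

theorem res_self {U : Opens Y} (A : Nc E F V U) : res (le_refl U) A = A := rfl

theorem res_res {U W N : Opens Y} (h : W ≤ U) (k : N ≤ W) (A : Nc E F V U) :
    res k (res h A) = res (k.trans h) A := rfl

theorem algebraMap_complex {U : Opens Y} (f : Fn E ℂ U) :
    algebraMap (Fn E ℂ U) (Nc E F V U) f = ofFn U f := rfl

theorem algebraMap_real {U : Opens Y} (f : Fn E ℝ U) :
    algebraMap (Fn E ℝ U) (Nc E F V U) f = ofFn U (Fn.toComplex E U f) := rfl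

theorem algebraMap_const {U : Opens Y} (c : ℂ) :
    algebraMap ℂ (Nc E F V U) c = ofFn U (Fn.const E U c) := rfl

theorem res_smul {U W : Opens Y} (h : W ≤ U) (f : Fn E ℝ U) (A : Nc E F V U) :
    res h (f • A) = Fn.res E ℝ h f • res h A := rfl

end Nc
end Nc

/-! ### Restriction preserves the centre -/

section Center

open Bundle

variable {E : Type*} [NormedAddCommGroup E] [NormedSpace ℝ E] {Y : Type*} [TopologicalSpace Y]
  [ChartedSpace E Y]
  {F : Type*} [NormedAddCommGroup F] [NormedSpace ℂ F] {V : Y → Type*}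
  [TopologicalSpace (TotalSpace F V)] [∀ y, TopologicalSpace (V y)] [FiberBundle F V]
  [∀ y, AddCommGroup (V y)] [∀ y, Module ℂ (V y)] [VectorBundle ℂ F V]

theorem Sec.ext_germ {U : Opens Y} {s t : Sec E F V ℂ U}
    (h : ∀ y : U, ∃ (N : Opens Y) (_ : y.1 ∈ N) (k : N ≤ U), Sec.res k s = Sec.res k t) :
    s = t := by
  refine Subtype.ext (funext fun y => ?_)
  obtain ⟨N, hy, k, e⟩ := h y
  exact congrFun (congrArg Subtype.val e) ⟨y.1, hy⟩

open Classical in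
/-- Extension by zero from `M ∩ W` to `M` of a smooth section that vanishes off a closed subset
of `W`. -/
def extSec (W : Opens Y) {C : Set Y} (hC : IsClosed C) (hCW : C ⊆ W) (M : Opens Y)
    (t : Sec E F V ℂ (M ⊓ W : Opens Y)) (ht : ∀ z, z.1 ∉ C → t.1 z = 0) : Sec E F V ℂ M :=
  ⟨fun z => if h : z.1 ∈ W then t.1 ⟨z.1, z.2, h⟩ else 0, by
    refine isSmoothSec_iff.2 fun y => ?_
    by_cases hy : y.1 ∈ W
    · have hi : ContMDiffAt 𝓘(ℝ, E) 𝓘(ℝ, F) ∞ (extZero fun z : (M ⊓ W : Opens Y) =>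
          (trivializationAt F V y.1 (TotalSpace.mk' F z.1 (t.1 z))).2) y.1 := by
        rw [← contMDiffAt_subtype_iff (x := (⟨y.1, y.2, hy⟩ : (M ⊓ W : Opens Y)))]
        simp only [extZero_apply]
        exact isSmoothSec_iff.1 t.2 ⟨y.1, y.2, hy⟩
      have h2 := hi.comp y (contMDiff_subtype_val (I := 𝓘(ℝ, E)) (n := ∞)).contMDiffAt
      refine h2.congr_of_eventuallyEq ?_
      filter_upwards [continuous_subtype_val.continuousAt.preimage_mem_nhds (W.2.mem_nhds hy)]
        with z hz
      have hz' : z.1 ∈ W := hz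
      rw [Function.comp_apply, extZero_apply (U := M ⊓ W) _ ⟨z.1, z.2, hz'⟩, dif_pos hz']
    · have hyC : y.1 ∈ Cᶜ := fun h => hy (hCW h)
      refine (contMDiffAt_const (c := (0 : F))).congr_of_eventuallyEq ?_
      filter_upwards [continuous_subtype_val.continuousAt.preimage_mem_nhds
        (hC.isOpen_compl.mem_nhds hyC), eventually_linear (F := F) (V := V) ℂ y] with z hz hl
      have hz' : z.1 ∉ C := hz
      have : (if h : z.1 ∈ W then t.1 ⟨z.1, z.2, h⟩ else 0 : V z.1) = 0 := by
        split_ifs with h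
        · exact ht ⟨z.1, z.2, h⟩ hz'
        · rfl
      rw [this]
      exact hl.map_zero⟩

theorem extSec_of_mem {W : Opens Y} {C : Set Y} {hC : IsClosed C} {hCW : C ⊆ W} {M : Opens Y}
    {t : Sec E F V ℂ (M ⊓ W : Opens Y)} {ht : ∀ z, z.1 ∉ C → t.1 z = 0} (z : M) (h : z.1 ∈ W) :
    (extSec W hC hCW M t ht).1 z = t.1 ⟨z.1, z.2, h⟩ := dif_pos h

theorem extSec_of_notMem {W : Opens Y} {C : Set Y} {hC : IsClosed C} {hCW : C ⊆ W} {M : Opens Y}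
    {t : Sec E F V ℂ (M ⊓ W : Opens Y)} {ht : ∀ z, z.1 ∉ C → t.1 z = 0} (z : M) (h : z.1 ∉ W) :
    (extSec W hC hCW M t ht).1 z = 0 := dif_neg h

theorem extSec_eq {W : Opens Y} {C : Set Y} {hC : IsClosed C} {hCW : C ⊆ W} {M : Opens Y}
    {t : Sec E F V ℂ (M ⊓ W : Opens Y)} {ht : ∀ z, z.1 ∉ C → t.1 z = 0} {s : Sec E F V ℂ M}
    (h₁ : ∀ (z : M) (h : z.1 ∈ W), s.1 z = t.1 ⟨z.1, z.2, h⟩)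
    (h₂ : ∀ z : M, z.1 ∉ W → s.1 z = 0) : s = extSec W hC hCW M t ht :=
  Subtype.ext (funext fun z => by
    by_cases h : z.1 ∈ W
    · rw [h₁ z h, extSec_of_mem z h]
    · rw [h₂ z h, extSec_of_notMem z h])

theorem Sec.add_apply {U : Opens Y} (s t : Sec E F V ℂ U) (y : U) :
    (s + t).1 y = s.1 y + t.1 y := rfl

/-- The restriction to `U` of a smooth function on `Y`. -/
def Fn.global {χ : Y → ℂ} (hs : ContMDiff 𝓘(ℝ, E) 𝓘(ℝ, ℂ) ∞ χ) (U : Opens Y) : Fn E ℂ U :=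
  ⟨fun z => χ z.1, hs.comp contMDiff_subtype_val⟩

/-- The section `χ B s` over `M ∩ W`, for a smooth function `χ` on `Y`. -/
def Nc.cut {W : Opens Y} {χ : Y → ℂ} (hs : ContMDiff 𝓘(ℝ, E) 𝓘(ℝ, ℂ) ∞ χ) (B : Nc E F V W)
    (M : Opens Y) : Sec E F V ℂ M →+ Sec E F V ℂ (M ⊓ W : Opens Y) where
  toFun s := Fn.global hs (M ⊓ W) •
    B.app inf_le_right (Sec.res inf_le_left s)
  map_zero' := by rw [map_zero, map_zero, smul_zero]
  map_add' s s' := by rw [map_add, map_add, smul_add]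

theorem Nc.cut_eq_zero {W : Opens Y} {χ : Y → ℂ} (hs : ContMDiff 𝓘(ℝ, E) 𝓘(ℝ, ℂ) ∞ χ)
    (B : Nc E F V W) (M : Opens Y) (s : Sec E F V ℂ M) (z : (M ⊓ W : Opens Y))
    (hz : z.1 ∉ tsupport χ) : (cut hs B M s).1 z = 0 := by
  change χ z.1 • (B.app inf_le_right (Sec.res inf_le_left s)).1 z = 0
  rw [image_eq_zero_of_notMem_tsupport hz, zero_smul]

theorem Nc.cut_smul {W : Opens Y} {χ : Y → ℂ} (hs : ContMDiff 𝓘(ℝ, E) 𝓘(ℝ, ℂ) ∞ χ)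
    (B : Nc E F V W) (M : Opens Y) (f : Fn E ℂ M) (s : Sec E F V ℂ M) :
    cut hs B M (f • s) = Fn.res E ℂ (inf_le_left : M ⊓ W ≤ M) f • cut hs B M s := by
  change Fn.global hs (M ⊓ W) • B.app inf_le_right (Sec.res inf_le_left (f • s)) =
    Fn.res E ℂ (inf_le_left : M ⊓ W ≤ M) f • Fn.global hs (M ⊓ W) • B.app inf_le_right (Sec.res inf_le_left s)
  rw [Sec.res_smul, map_smul, smul_comm]

theorem Nc.cut_res {W : Opens Y} {χ : Y → ℂ} (hs : ContMDiff 𝓘(ℝ, E) 𝓘(ℝ, ℂ) ∞ χ)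
    (B : Nc E F V W) {M N : Opens Y} (k : N ≤ M) (s : Sec E F V ℂ M) :
    cut hs B N (Sec.res k s) = Sec.res (inf_le_inf_right W k) (cut hs B M s) := by
  change _ = Fn.global hs (N ⊓ W) • Sec.res (inf_le_inf_right W k)
    (B.app inf_le_right (Sec.res (inf_le_left : M ⊓ W ≤ M) s))
  rw [app_res]
  rfl

/-- The section `χ B s` extended by zero, as a linear function of `s`. -/
def Nc.extendLin {W : Opens Y} {χ : Y → ℂ} (hs : ContMDiff 𝓘(ℝ, E) 𝓘(ℝ, ℂ) ∞ χ)
    (hχ : tsupport χ ⊆ W) (B : Nc E F V W) (M : Opens Y) :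
    Module.End (Fn E ℂ M) (Sec E F V ℂ M) where
  toFun s := extSec W (isClosed_tsupport χ) hχ M (cut hs B M s) (cut_eq_zero hs B M s)
  map_add' s s' := (extSec_eq
    (fun z h => by
      rw [Sec.add_apply, extSec_of_mem z h, extSec_of_mem z h, map_add]
      rfl)
    (fun z h => by
      rw [Sec.add_apply, extSec_of_notMem z h, extSec_of_notMem z h, add_zero])).symm
  map_smul' f s := (extSec_eq
    (fun z h => by
      rw [RingHom.id_apply, Sec.smul_apply, extSec_of_mem z h, cut_smul]
      rfl)
    (fun z h => by
      rw [RingHom.id_apply, Sec.smul_apply, extSec_of_notMem z h, smul_zero])).symm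

theorem Nc.extendLin_of_mem {W : Opens Y} {χ : Y → ℂ} (hs : ContMDiff 𝓘(ℝ, E) 𝓘(ℝ, ℂ) ∞ χ)
    (hχ : tsupport χ ⊆ W) (B : Nc E F V W) {M : Opens Y} (s : Sec E F V ℂ M) (z : M)
    (h : z.1 ∈ W) : (extendLin hs hχ B M s).1 z = (cut hs B M s).1 ⟨z.1, z.2, h⟩ :=
  dif_pos h

theorem Nc.extendLin_of_notMem {W : Opens Y} {χ : Y → ℂ} (hs : ContMDiff 𝓘(ℝ, E) 𝓘(ℝ, ℂ) ∞ χ)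
    (hχ : tsupport χ ⊆ W) (B : Nc E F V W) {M : Opens Y} (s : Sec E F V ℂ M) (z : M)
    (h : z.1 ∉ W) : (extendLin hs hχ B M s).1 z = 0 :=
  dif_neg h

/-- If `χ` is a smooth function on `Y` with support in `W`, then `χ B`, for an endomorphism `B`
over `W`, extends by zero to bigger open sets. -/
def Nc.extend (U : Opens Y) {W : Opens Y} {χ : Y → ℂ} (hs : ContMDiff 𝓘(ℝ, E) 𝓘(ℝ, ℂ) ∞ χ)
    (hχ : tsupport χ ⊆ W) (B : Nc E F V W) : Nc E F V U :=
  mk (fun M _ => extendLin hs hχ B M) (fun {_ _} _ k s => Subtype.ext (funext fun z => by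
    rw [Sec.res_apply]
    by_cases h : z.1 ∈ W
    · rw [extendLin_of_mem hs hχ B (Sec.res k s) z h, cut_res]
      exact extendLin_of_mem hs hχ B s ⟨z.1, k z.2⟩ h
    · rw [extendLin_of_notMem hs hχ B (Sec.res k s) z h]
      exact extendLin_of_notMem hs hχ B s ⟨z.1, k z.2⟩ h))

theorem Nc.extend_app {U W N : Opens Y} {χ : Y → ℂ} (hs : ContMDiff 𝓘(ℝ, E) 𝓘(ℝ, ℂ) ∞ χ)
    (hχ : tsupport χ ⊆ W) (B : Nc E F V W) (h : N ≤ U) (k : N ≤ W) (h1 : ∀ z ∈ N, χ z = 1)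
    (s : Sec E F V ℂ N) : (extend U hs hχ B).app h s = B.app k s := by
  refine Subtype.ext (funext fun z => (extendLin_of_mem hs hχ B s z (k z.2)).trans ?_)
  change χ z.1 • (B.app inf_le_right (Sec.res inf_le_left s)).1 ⟨z.1, z.2, k z.2⟩ = _
  rw [h1 _ z.2, one_smul, ← B.app_res k inf_le_left]
  rfl

/-- Restriction maps central elements to central elements. -/
theorem Nc.res_center [FiniteDimensional ℝ E] [T2Space Y] [IsManifold 𝓘(ℝ, E) ∞ Y]
    {U W : Opens Y} (h : W ≤ U) (A : Nc E F V U) (hA : A ∈ Subring.center (Nc E F V U)) :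
    res h A ∈ Subring.center (Nc E F V W) := by
  refine Subring.mem_center_iff.2 fun B => ext fun N k s => Sec.ext_germ fun y => ?_
  obtain ⟨f, -, hf⟩ := (SmoothBumpFunction.nhds_basis_tsupport (I := 𝓘(ℝ, E)) y.1).mem_iff.1
    (W.2.mem_nhds (k y.2))
  have hs : ContMDiff 𝓘(ℝ, E) 𝓘(ℝ, ℂ) ∞ fun z => (f z : ℂ) :=
    Complex.ofRealCLM.contDiff.contMDiff.comp f.contMDiff
  have hχ : tsupport (fun z => (f z : ℂ)) ⊆ W :=
    (closure_mono fun z (hz : (f z : ℂ) ≠ 0) (h0 : f z = 0) => hz (by simp [h0])).trans hf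
  obtain ⟨O, hO, hOo, hyO⟩ := mem_nhds_iff.1 (f.eventuallyEq_one)
  refine ⟨⟨O, hOo⟩ ⊓ N, ⟨hyO, y.2⟩, inf_le_right, ?_⟩
  have hB := fun t => extend_app (U := U) (N := ⟨O, hOo⟩ ⊓ N) hs hχ B
    ((inf_le_right.trans k).trans h) (inf_le_right.trans k)
    (fun z hz => by simp [show f z = 1 from hO hz.1]) t
  rw [app_res, app_res, mul_app, mul_app, ← hB, ← hB, res_app, res_app, ← mul_app, ← mul_app,
    Subring.mem_center_iff.1 hA]

end Center

/-! ### The sheaves of the Azumaya manifold -/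

section Sheaves

open Bundle

variable (E : Type*) [NormedAddCommGroup E] [NormedSpace ℝ E] {Y : Type*} [TopologicalSpace Y]
  [ChartedSpace E Y]
  (F : Type*) [NormedAddCommGroup F] [NormedSpace ℂ F] (V : Y → Type*)
  [TopologicalSpace (TotalSpace F V)] [∀ y, TopologicalSpace (V y)] [FiberBundle F V]
  [∀ y, AddCommGroup (V y)] [∀ y, Module ℂ (V y)] [VectorBundle ℂ F V]

/-- The presheaf of enveloping algebras of the structure sheaf; modules over it are the same as
bimodules over the structure sheaf. -/
def envPre : RingPresheaf Y where
  obj U := Env (Nc E F V U)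
  res h := envMap (Nc.res h)
  res_self _ := envMap_id _ Nc.res_self
  res_res _ _ := envMap_comp _ _ _ fun _ => rfl

/-- Restriction of endomorphisms, as a map of bimodules. -/
def ncRes {U W : Opens Y} (h : W ≤ U) :
    Nc E F V U →ₛₗ[envMap (Nc.res (E := E) (F := F) (V := V) h)] Nc E F V W where
  toFun := Nc.res h
  map_add' := map_add _
  map_smul' e x := by
    induction e using env_induction with
    | h0 => rw [zero_smul, map_zero, map_zero, zero_smul]
    | hadd e e' h h' => rw [add_smul, map_add, map_add, add_smul, h, h']
    | hbi a b => rw [envMap_bi, bi_smul_self, bi_smul_self, map_mul, map_mul]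

/-- The structure sheaf of the Azumaya manifold, as a bimodule over itself. -/
def ncPre : ModPresheaf (envPre E F V) where
  obj U := Nc E F V U
  grp U := inferInstanceAs (AddCommGroup (Nc E F V U))
  mod U := inferInstanceAs (Module (Env (Nc E F V U)) (Nc E F V U))
  res h := ncRes E F V h
  res_self _ _ := rfl
  res_res _ _ _ := rfl

section Differentials

variable {E F V} in
theorem Nc.res_const {U W : Opens Y} {h : W ≤ U} (c : ℂ) :
    res h (algebraMap ℂ (Nc E F V U) c) = algebraMap ℂ (Nc E F V W) (RingHom.id ℂ c) := rfl

variable {E F V} in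
theorem Nc.res_real {U W : Opens Y} (h : W ≤ U) (f : Fn E ℝ U) :
    res h (algebraMap (Fn E ℝ U) (Nc E F V U) f) = algebraMap _ _ (Fn.res E ℝ h f) := rfl

variable {E F V} in
theorem Nc.res_complex {U W : Opens Y} (h : W ≤ U) (f : Fn E ℂ U) :
    res h (algebraMap (Fn E ℂ U) (Nc E F V U) f) = algebraMap _ _ (Fn.res E ℂ h f) := rfl

variable {E} in
theorem Fn.res_op {U W : Opens Y} (h : W ≤ U) {s : ℕ} (g : SmoothFun s) (a : Fin s → Fn E ℝ U) :
    Fn.res E ℝ h (CInfRing.op g a) = CInfRing.op g fun i => Fn.res E ℝ h (a i) := rfl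

variable [FiniteDimensional ℝ E] [T2Space Y] [IsManifold 𝓘(ℝ, E) ∞ Y]

/-- Restriction of differentials. -/
def omegaRes {U W : Opens Y} (h : W ≤ U) :
    Omega ℂ (Fn E ℝ U) (Nc E F V U) →ₛₗ[envMap (Nc.res (E := E) (F := F) (V := V) h)]
    Omega ℂ (Fn E ℝ W) (Nc E F V W) :=
  Omega.map (Nc.res h) (RingHom.id ℂ) (Fn.res E ℝ h) Nc.res_const (Nc.res_real h)
    (Fn.res_op h) (Nc.res_center h)

/-- Restriction of relative differentials. -/
def omegaRelRes {U W : Opens Y} (h : W ≤ U) :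
    Omega (Fn E ℂ U) (Fn E ℝ U) (Nc E F V U) →ₛₗ[envMap (Nc.res (E := E) (F := F) (V := V) h)]
    Omega (Fn E ℂ W) (Fn E ℝ W) (Nc E F V W) :=
  Omega.map (Nc.res h) (Fn.res E ℂ h) (Fn.res E ℝ h) (Nc.res_complex h) (Nc.res_real h)
    (Fn.res_op h) (Nc.res_center h)

/-- The presheaf of differentials of the structure sheaf. -/
def omegaPre : ModPresheaf (envPre E F V) where
  obj U := Omega ℂ (Fn E ℝ U) (Nc E F V U)
  grp U := inferInstanceAs (AddCommGroup (Omega ℂ (Fn E ℝ U) (Nc E F V U)))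
  mod U := inferInstanceAs (Module (Env (Nc E F V U)) (Omega ℂ (Fn E ℝ U) (Nc E F V U)))
  res h := omegaRes E F V h
  res_self _ x := Omega.map_self _ _ _ _ _ _ _ Nc.res_self x
  res_res _ _ x := Omega.map_map _ _ _ _ _ _ _ _ _ _ _ _ _ _ _ _ _ _ _ _ _ (fun _ => rfl) x

/-- The presheaf of relative differentials of the structure sheaf over the complex-valued smooth
functions of `Y`. -/
def omegaRelPre : ModPresheaf (envPre E F V) where
  obj U := Omega (Fn E ℂ U) (Fn E ℝ U) (Nc E F V U)
  grp U := inferInstanceAs (AddCommGroup (Omega (Fn E ℂ U) (Fn E ℝ U) (Nc E F V U)))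
  mod U := inferInstanceAs (Module (Env (Nc E F V U)) (Omega (Fn E ℂ U) (Fn E ℝ U) (Nc E F V U)))
  res h := omegaRelRes E F V h
  res_self _ x := Omega.map_self _ _ _ _ _ _ _ Nc.res_self x
  res_res _ _ x := Omega.map_map _ _ _ _ _ _ _ _ _ _ _ _ _ _ _ _ _ _ _ _ _ (fun _ => rfl) x

end Differentials

variable [IsManifold 𝓘(ℝ, E) ∞ Y]

/-- Restriction on `𝒪^nc(U) ⊗ Ω¹(U)`. -/
def tensRes {U W : Opens Y} (h : W ≤ U) :
    Nc E F V U ⊗[Fn E ℝ U] OneForm E U →+ Nc E F V W ⊗[Fn E ℝ W] OneForm E W :=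
  TensorProduct.liftAddHom
    (AddMonoidHom.mk' (fun A => AddMonoidHom.mk' (fun θ => Nc.res h A ⊗ₜ Sec.res h θ)
      (fun θ θ' => by rw [map_add, TensorProduct.tmul_add]))
      (fun A A' => AddMonoidHom.ext fun θ => by
        simp only [AddMonoidHom.mk'_apply, AddMonoidHom.add_apply, map_add, TensorProduct.add_tmul]))
    (fun f A θ => by
      change Nc.res h (f • A) ⊗ₜ Sec.res h θ = Nc.res h A ⊗ₜ Sec.res h (f • θ)
      rw [Nc.res_smul, Sec.res_smul, TensorProduct.smul_tmul])

theorem tensRes_tmul {U W : Opens Y} (h : W ≤ U) (A : Nc E F V U) (θ : OneForm E U) :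
    tensRes E F V h (A ⊗ₜ θ) = Nc.res h A ⊗ₜ Sec.res h θ := rfl

theorem env_smul_tmul {U : Opens Y} (e : Env (Nc E F V U)) (A : Nc E F V U) (θ : OneForm E U) :
    e • (A ⊗ₜ[Fn E ℝ U] θ) = (e • A) ⊗ₜ[Fn E ℝ U] θ := rfl

theorem tensRes_smul {U W : Opens Y} (h : W ≤ U) (e : Env (Nc E F V U))
    (x : Nc E F V U ⊗[Fn E ℝ U] OneForm E U) :
    tensRes E F V h (e • x) = envMap (Nc.res h) e • tensRes E F V h x := by
  induction x using TensorProduct.induction_on with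
  | zero => rw [smul_zero, map_zero, smul_zero]
  | add x y hx hy => rw [smul_add, map_add, map_add, smul_add, hx, hy]
  | tmul A θ =>
    rw [env_smul_tmul, tensRes_tmul, tensRes_tmul, env_smul_tmul]
    exact congrArg (· ⊗ₜ _) ((ncRes E F V h).map_smulₛₗ e A)

/-- Restriction on `𝒪^nc(U) ⊗ Ω¹(U)`, as a map of bimodules. -/
def tensResₛₗ {U W : Opens Y} (h : W ≤ U) :
    (Nc E F V U ⊗[Fn E ℝ U] OneForm E U) →ₛₗ[envMap (Nc.res (E := E) (F := F) (V := V) h)]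
    (Nc E F V W ⊗[Fn E ℝ W] OneForm E W) where
  toFun := tensRes E F V h
  map_add' := map_add _
  map_smul' := tensRes_smul E F V h

/-- The presheaf `U ↦ 𝒪^nc(U) ⊗ Ω¹(U)`, a bimodule through the first factor. -/
def tensPre : ModPresheaf (envPre E F V) where
  obj U := Nc E F V U ⊗[Fn E ℝ U] OneForm E U
  grp U := inferInstanceAs (AddCommGroup (Nc E F V U ⊗[Fn E ℝ U] OneForm E U))
  mod U := inferInstanceAs (Module (Env (Nc E F V U)) (Nc E F V U ⊗[Fn E ℝ U] OneForm E U))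
  res h := tensResₛₗ E F V h
  res_self U x := by
    change tensRes E F V (le_refl U) x = x
    induction x using TensorProduct.induction_on with
    | zero => rw [map_zero]
    | add x y hx hy => rw [map_add, hx, hy]
    | tmul A θ => rfl
  res_res h k x := by
    change tensRes E F V k (tensRes E F V h x) = tensRes E F V (k.trans h) x
    induction x using TensorProduct.induction_on with
    | zero => rw [map_zero, map_zero, map_zero]
    | add x y hx hy => rw [map_add, map_add, map_add, hx, hy]
    | tmul A θ => rfl

end Sheaves

/-! ### Connections and the splitting -/

section Connections

open Bundle

variable {E : Type*} [NormedAddCommGroup E] [NormedSpace ℝ E] {Y : Type*} [TopologicalSpace Y]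
  [ChartedSpace E Y] [IsManifold 𝓘(ℝ, E) ∞ Y]

variable (E) in
/-- A connection on a sheaf `M` of modules over the complex-valued smooth functions: a covariant
derivative along vector fields, compatible with restriction. -/
structure Connection (M : Opens Y → Type*) [∀ U, AddCommGroup (M U)]
    [∀ U, Module (Fn E ℂ U) (M U)] (res : ∀ {U W : Opens Y}, W ≤ U → M U →+ M W) where
  nabla : ∀ {U : Opens Y}, Vec E U → M U → M U
  nabla_add : ∀ {U : Opens Y} (ξ : Vec E U) (s t : M U), nabla ξ (s + t) = nabla ξ s + nabla ξ t
  add_nabla : ∀ {U : Opens Y} (ξ η : Vec E U) (s : M U), nabla (ξ + η) s = nabla ξ s + nabla η s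
  smul_nabla : ∀ {U : Opens Y} (f : Fn E ℝ U) (ξ : Vec E U) (s : M U),
    nabla (f • ξ) s = Fn.toComplex E U f • nabla ξ s
  leibniz : ∀ {U : Opens Y} (ξ : Vec E U) (f : Fn E ℂ U) (s : M U),
    nabla ξ (f • s) = ξ.deriv f • s + f • nabla ξ s
  res_nabla : ∀ {U W : Opens Y} (h : W ≤ U) (ξ : Vec E U) (s : M U),
    res h (nabla ξ s) = nabla (Sec.res h ξ) (res h s)

variable {F : Type*} [NormedAddCommGroup F] [NormedSpace ℂ F] {V : Y → Type*}
  [TopologicalSpace (TotalSpace F V)] [∀ y, TopologicalSpace (V y)] [FiberBundle F V]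
  [∀ y, AddCommGroup (V y)] [∀ y, Module ℂ (V y)] [VectorBundle ℂ F V]

variable (E F V) in
/-- A connection on the sheaf of smooth sections of the complex vector bundle `V`. -/
abbrev BundleConnection : Type _ :=
  Connection E (fun U : Opens Y => Sec E F V ℂ U) (fun h => Sec.res h)

namespace Connection

theorem nabla_sub (D : BundleConnection E F V) {U : Opens Y} (ξ : Vec E U)
    (s t : Sec E F V ℂ U) : D.nabla ξ (s - t) = D.nabla ξ s - D.nabla ξ t := by
  rw [eq_sub_iff_add_eq, ← D.nabla_add, sub_add_cancel]

/-- The covariant derivative of an endomorphism: the commutator with the covariant derivative of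
sections. -/
def endDeriv (D : BundleConnection E F V) {U : Opens Y} (ξ : Vec E U) (A : Nc E F V U) :
    Nc E F V U :=
  Nc.mk (fun W h =>
    { toFun := fun s => D.nabla (Sec.res h ξ) (A.app h s) - A.app h (D.nabla (Sec.res h ξ) s)
      map_add' := fun s t => by
        rw [D.nabla_add, map_add, map_add, D.nabla_add]
        abel
      map_smul' := fun f s => by
        rw [D.leibniz, map_add, map_smul, map_smul, map_smul, D.leibniz, RingHom.id_apply,
          smul_sub]
        abel })
    (fun {W _} h k s => by
      change Sec.res k (D.nabla (Sec.res h ξ) (A.app h s) - A.app h (D.nabla (Sec.res h ξ) s)) =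
        D.nabla (Sec.res (k.trans h) ξ) (A.app (k.trans h) (Sec.res k s)) -
          A.app (k.trans h) (D.nabla (Sec.res (k.trans h) ξ) (Sec.res k s))
      rw [map_sub, D.res_nabla, A.app_res, A.app_res, D.res_nabla, Sec.res_res])

theorem endDeriv_app (D : BundleConnection E F V) {U W : Opens Y} (ξ : Vec E U) (A : Nc E F V U)
    (h : W ≤ U) (s : Sec E F V ℂ W) : (D.endDeriv ξ A).app h s =
      D.nabla (Sec.res h ξ) (A.app h s) - A.app h (D.nabla (Sec.res h ξ) s) := rfl

theorem endDeriv_add (D : BundleConnection E F V) {U : Opens Y} (ξ : Vec E U)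
    (A B : Nc E F V U) : D.endDeriv ξ (A + B) = D.endDeriv ξ A + D.endDeriv ξ B :=
  Nc.ext fun W h s => by
    simp only [Nc.add_app, endDeriv_app, D.nabla_add]
    abel

theorem endDeriv_mul (D : BundleConnection E F V) {U : Opens Y} (ξ : Vec E U)
    (A B : Nc E F V U) : D.endDeriv ξ (A * B) = D.endDeriv ξ A * B + A * D.endDeriv ξ B :=
  Nc.ext fun W h s => by
    simp only [Nc.add_app, Nc.mul_app, endDeriv_app, map_sub]
    abel

theorem endDeriv_ofFn (D : BundleConnection E F V) {U : Opens Y} (ξ : Vec E U) (f : Fn E ℂ U) :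
    D.endDeriv ξ (Nc.ofFn U f) = Nc.ofFn U (ξ.deriv f) :=
  Nc.ext fun W h s => by
    rw [endDeriv_app, Nc.ofFn_app, Nc.ofFn_app, Nc.ofFn_app, D.leibniz, Vec.deriv_res,
      add_sub_cancel_right]

/-- The connection on the endomorphism sheaf induced by a connection on the sheaf of sections. -/
def endConnection (D : BundleConnection E F V) :
    Connection E (fun U : Opens Y => Nc E F V U) (fun h => (Nc.resHom h).toAddMonoidHom) where
  nabla ξ A := D.endDeriv ξ A
  nabla_add ξ A B := D.endDeriv_add ξ A B
  add_nabla ξ η A := Nc.ext fun W h s => by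
    simp only [Nc.add_app, endDeriv_app, map_add, D.add_nabla]
    abel
  smul_nabla f ξ A := Nc.ext fun W h s => by
    rw [Algebra.smul_def, Nc.algebraMap_complex, Nc.mul_app, Nc.ofFn_app, endDeriv_app,
      endDeriv_app, Sec.res_smul, D.smul_nabla, D.smul_nabla, map_smul, smul_sub]
    rfl
  leibniz ξ f A := by
    rw [Algebra.smul_def, Algebra.smul_def, Algebra.smul_def, Nc.algebraMap_complex,
      Nc.algebraMap_complex, endDeriv_mul, endDeriv_ofFn]
  res_nabla _ _ _ := rfl

theorem endDeriv_const (D : BundleConnection E F V) {U : Opens Y} (ξ : Vec E U) (c : ℂ) :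
    D.endDeriv ξ (algebraMap ℂ (Nc E F V U) c) = 0 := by
  rw [Nc.algebraMap_const, endDeriv_ofFn]
  have : ξ.deriv (Fn.const E U c) = 0 := ContMDiffMap.ext fun y => by
    change dAt E (Fn.const E U c) y (ξ.1 y) = 0
    rw [dAt_congr (Fn.const E U c) (g := fun _ => c) y (Filter.Eventually.of_forall fun _ => rfl),
      mfderiv_const]
    rfl
  rw [this, map_zero]

/-- The pairing of differentials with the horizontal lift of the vector field `ξ`, which is the
derivation `A ↦ ∇_ξ A`; it sends `a · dr · b` to `a · (∇_ξ r) · b`. -/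
def pairing (D : BundleConnection E F V) {U : Opens Y} (ξ : Vec E U) :
    Omega ℂ (Fn E ℝ U) (Nc E F V U) →ₗ[Env (Nc E F V U)] Nc E F V U :=
  Omega.lift (RingHom.id _) (fun A => D.endConnection.nabla ξ A) (freeLift_eq_zero _ _
    (fun a₁ a₂ r₁ r₂ => by
      change D.endDeriv ξ _ = bi _ _ • D.endDeriv ξ _ + bi _ _ • D.endDeriv ξ _
      simp only [bi_smul_self, endDeriv_add, Algebra.smul_def, endDeriv_mul, endDeriv_const,
        zero_mul, zero_add, mul_one])
    (fun a₁ a₂ r₁ r₂ => by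
      change D.endDeriv ξ _ = bi _ _ • D.endDeriv ξ _ + bi _ _ • D.endDeriv ξ _
      simp only [bi_smul_self, endDeriv_add, Algebra.smul_def, endDeriv_mul, endDeriv_const,
        mul_zero, add_zero, one_mul, Algebra.commutes])
    (fun r₁ r₂ => by
      change D.endDeriv ξ _ = bi _ _ • D.endDeriv ξ _ + bi _ _ • D.endDeriv ξ _
      simp only [bi_smul_self, endDeriv_mul, one_mul, mul_one])
    (fun r₁ r₃ h => by
      change bi _ _ • D.endDeriv ξ _ = bi _ _ • D.endDeriv ξ _
      rw [bi_smul_self, bi_smul_self, one_mul, mul_one, Subring.mem_center_iff.1 h])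
    (fun _ h a => by
      change D.endDeriv ξ _ = ∑ i, bi _ _ • D.endDeriv ξ _
      simp only [bi_smul_self, Nc.algebraMap_real, endDeriv_ofFn, Vec.deriv_toComplex,
        Vec.deriv_op, map_sum, map_mul, mul_one]))

theorem pairing_d (D : BundleConnection E F V) {U : Opens Y} (ξ : Vec E U) (A : Nc E F V U) :
    D.pairing ξ (Omega.d ℂ (Fn E ℝ U) (Nc E F V U) A) = D.endDeriv ξ A :=
  Omega.lift_d _ _ _ A

end Connection

/-- The contraction of the 1-form factor with a vector field: `a ⊗ θ ↦ θ(ξ) a`. -/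
def contractTens {U : Opens Y} (ξ : Vec E U) :
    Nc E F V U ⊗[Fn E ℝ U] OneForm E U →ₗ[Fn E ℝ U] Nc E F V U :=
  TensorProduct.lift (LinearMap.mk₂ (Fn E ℝ U) (fun A θ => contract ξ θ • A)
    (fun A A' θ => smul_add _ _ _)
    (fun f A θ => smul_comm _ _ _)
    (fun A θ θ' => by rw [contract_add, add_smul])
    (fun f A θ => by rw [contract_smul, mul_smul]))

theorem contractTens_tmul {U : Opens Y} (ξ : Vec E U) (A : Nc E F V U) (θ : OneForm E U) :
    contractTens ξ (A ⊗ₜ θ) = contract ξ θ • A := rfl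

theorem contractTens_res {U W : Opens Y} (h : W ≤ U) (ξ : Vec E U)
    (x : Nc E F V U ⊗[Fn E ℝ U] OneForm E U) :
    Nc.res h (contractTens ξ x) = contractTens (Sec.res h ξ) (tensRes E F V h x) := by
  induction x using TensorProduct.induction_on with
  | zero => simp only [map_zero]
  | add x y hx hy => simp only [map_add, hx, hy]
  | tmul A θ => rfl

/-- Contraction with a vector field, on germs. -/
def contractStalk {U : Opens Y} (ξ : Vec E U) {y : Y} (hy : y ∈ U) :
    (tensPre E F V).Stalk y →+ (ncPre E F V).Stalk y :=
  ModPresheaf.stalkMap (P := tensPre E F V) (Q := ncPre E F V)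
    (fun _ h => (contractTens (Sec.res h ξ)).toAddMonoidHom)
    (fun h k x => contractTens_res k (Sec.res h ξ) x) hy

variable [FiniteDimensional ℝ E] [T2Space Y]

theorem Connection.pairing_res (D : BundleConnection E F V) {U W : Opens Y} (h : W ≤ U)
    (ξ : Vec E U) (x : Omega ℂ (Fn E ℝ U) (Nc E F V U)) :
    Nc.res h (D.pairing ξ x) = D.pairing (Sec.res h ξ) (omegaRes E F V h x) := by
  induction x using Omega.induction with
  | h0 => simp only [map_zero]
  | hadd x y hx hy => simp only [map_add, hx, hy]
  | hd e A =>
    have h₁ : D.pairing ξ (e • Omega.d ℂ (Fn E ℝ U) (Nc E F V U) A) = e • D.endDeriv ξ A :=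
      ((D.pairing ξ).map_smul e _).trans (congrArg _ (D.pairing_d ξ A))
    have h₂ : omegaRes E F V h (e • Omega.d ℂ (Fn E ℝ U) (Nc E F V U) A) =
        envMap (Nc.res h) e • Omega.d ℂ (Fn E ℝ W) (Nc E F V W) (Nc.res h A) :=
      ((omegaRes E F V h).map_smulₛₗ e _).trans (congrArg _ (Omega.map_d _ _ _ _ _ _ _ A))
    rw [h₁, h₂, LinearMap.map_smul, pairing_d]
    exact (ncRes E F V h).map_smulₛₗ e _

/-- The pairing of differentials with the horizontal lift of a vector field, on germs. -/
def Connection.pairStalk (D : BundleConnection E F V) {U : Opens Y} (ξ : Vec E U) {y : Y}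
    (hy : y ∈ U) : (omegaPre E F V).Stalk y →+ (ncPre E F V).Stalk y :=
  ModPresheaf.stalkMap (P := omegaPre E F V) (Q := ncPre E F V)
    (fun _ h => (D.pairing (Sec.res h ξ)).toAddMonoidHom)
    (fun h k x => D.pairing_res k (Sec.res h ξ) x) hy

variable (E F V)

/-- The sheaf `𝒪^nc ⊗ T^*Y` of bimodules. -/
abbrev tensSheaf : ModPresheaf (envPre E F V) := (tensPre E F V).sheafify

/-- The cotangent sheaf `T^*Y^nc`: the sheaf of differentials of the structure sheaf. -/
abbrev cotangent : ModPresheaf (envPre E F V) := (omegaPre E F V).sheafify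

/-- The relative cotangent sheaf `T^*_{Y^nc/Y}`. -/
abbrev relCotangent : ModPresheaf (envPre E F V) := (omegaRelPre E F V).sheafify

variable {E F V}

/-- The section `A ⊗ θ` of the sheaf `𝒪^nc ⊗ T^*Y`. -/
def tmulSection {U : Opens Y} (A : Nc E F V U) (θ : OneForm E U) : (tensSheaf E F V).obj U :=
  (tensPre E F V).toSh U (A ⊗ₜ[Fn E ℝ U] θ : Nc E F V U ⊗[Fn E ℝ U] OneForm E U)

/-- The differential `dA` as a section of the cotangent sheaf `T^*Y^nc`. -/
def dSection {U : Opens Y} (A : Nc E F V U) : (cotangent E F V).obj U :=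
  (omegaPre E F V).toSh U (Omega.d ℂ (Fn E ℝ U) (Nc E F V U) A)

/-- The differential `dA` as a section of the relative cotangent sheaf `T^*_{Y^nc/Y}`. -/
def dRelSection {U : Opens Y} (A : Nc E F V U) : (relCotangent E F V).obj U :=
  (omegaRelPre E F V).toSh U (Omega.d (Fn E ℂ U) (Fn E ℝ U) (Nc E F V U) A)

/-- The bimodule structure of the sections of a sheaf of bimodules: `a · m · b`. -/
def bimul {P : ModPresheaf (envPre E F V)} {U : Opens Y} (a : Nc E F V U) (m : P.obj U)
    (b : Nc E F V U) : P.obj U :=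
  (show (envPre E F V).obj U from bi a b) • m

end Connections

end
end Azu

/-! Everything is built over coordinate charts and glued on germs. On a chart with coordinates xⱼ
and coordinate fields ∂ⱼ, a 1-form is Σ θ(∂ⱼ) dxⱼ, so an element t of 𝒪^nc ⊗ Ω¹ is determined by its
contractions tⱼ with the ∂ⱼ (`CoordFrame.tens_eq_sum`, `CoordFrame.contractTens_ext`). Put i(t) = Σ
tⱼ dxⱼ. This is a bimodule map because the differential of a central element x commutes with every
b: expand d(xb) = d(bx) by Leibniz on both sides and cancel (`Omega.bi_smul_d_of_mem_center`). It
does not depend on the chart: near each point a function g is a smooth function of the coordinates,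
so the chain-rule relation gives dg = Σ ∂ⱼg dxⱼ there, and the germ of i(a ⊗ dg) is that of a dg in
every chart (`CoordFrame.germ_incl_tmul_d`, `CoordFrame.germ_incl_eq`).

A connection gives π(w) = Σ ⟨w, ∇''_{∂ⱼ}⟩ ⊗ dxⱼ. The pairing is linear over functions in the vector
field, so contracting π(w) with any ξ yields ⟨w, ∇''_ξ⟩ (`CoordFrame.contractTens_proj`). That
property determines π(w), hence chart independence. On a function f of Y the operator ∇''_ξ is
ordinary differentiation, so ⟨Σ tₖ dxₖ, ∇''_{∂ⱼ}⟩ = tⱼ and π ∘ i = id (`CoordFrame.proj_incl`); in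
particular π is an epimorphism.

Injectivity of i must not presuppose a connection on all of Y. It is a local matter, and over a
trivializing open set the flat connection recovers the coefficients tⱼ in the same way
(`CoordFrame.incl_injective`).

For exactness in the middle, divide the differentials over ℂ by the sub-bimodule generated by the
df, for f real on Y. Writing f = u + v·I and using d(I) = 0, the differentials of complex functions
die as well, so by Leibniz d becomes linear over 𝒪^ℂ. The quotient therefore satisfies the relations
of the relative differentials, and the kernel of p is no larger than this sub-bimodule
(`mem_horizontal_of_relProj_eq_zero`), which lies in the image of i. The map p is surjective already
on presheaves, the symbols dr being generators. -/

namespace Azu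
noncomputable section

/-! ### Morphisms of associated sheaves glued from local maps of presheaves -/

namespace ModPresheaf

variable {Y : Type*} [TopologicalSpace Y] {E : RingPresheaf Y}

theorem germOf_res {P : ModPresheaf E} {U W : Opens Y} (h : W ≤ U) (s : P.sheafify.obj U) {y : Y}
    (hy : y ∈ W) : germOf (P.sheafify.res h s) hy = germOf s (h hy) := rfl

theorem germOf_toSh {P : ModPresheaf E} {U : Opens Y} (x : P.obj U) {y : Y} (hy : y ∈ U) :
    germOf (P.toSh U x) hy = P.germ hy x := rfl

theorem sheafify_ext {P : ModPresheaf E} {U : Opens Y} {s t : P.sheafify.obj U}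
    (h : ∀ (y : Y) (hy : y ∈ U), germOf s hy = germOf t hy) : s = t :=
  Subtype.ext (funext fun y => h y.1 y.2)

/-- A section of the associated sheaf is locally the image of a section of the presheaf, over an
arbitrarily small neighbourhood. -/
theorem exists_toSh {P : ModPresheaf E} {U : Opens Y} (s : P.sheafify.obj U) {y : Y} (hy : y ∈ U)
    {N : Opens Y} (hN : y ∈ N) : ∃ (W : Opens Y) (h : W ≤ U) (_ : W ≤ N) (_ : y ∈ W) (x : P.obj W),
      P.sheafify.res h s = P.toSh W x := by
  obtain ⟨W, h, hW, x, hx⟩ := s.2 ⟨y, hy⟩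
  refine ⟨W ⊓ N, inf_le_left.trans h, inf_le_right, ⟨hW, hN⟩, P.res inf_le_left x, ?_⟩
  refine sheafify_ext fun z hz => ?_
  rw [germOf_toSh, P.germ_res]
  exact hx z hz.1

theorem res_toSh {P : ModPresheaf E} {U W : Opens Y} (h : W ≤ U) (x : P.obj U) :
    P.sheafify.res h (P.toSh U x) = P.toSh W (P.res h x) :=
  sheafify_ext fun _ hz => (P.germ_res h hz x).symm

/-- A section has zero germ at a point iff it vanishes on a neighbourhood of the point. -/
theorem germ_eq_zero_iff (P : ModPresheaf E) {U : Opens Y} {y : Y} (hy : y ∈ U) (x : P.obj U) :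
    P.germ hy x = 0 ↔ ∃ (N : Opens Y) (_ : y ∈ N) (h : N ≤ U), P.res h x = 0 := by
  rw [← map_zero (P.germ hy), P.germ_eq_iff]
  constructor
  · rintro ⟨N, hN, h, k, e⟩
    exact ⟨N, hN, h, by rw [e, map_zero]⟩
  · rintro ⟨N, hN, h, e⟩
    exact ⟨N, hN, h, h, by rw [e, map_zero]⟩

/-- A family of maps of stalks which is locally induced by linear maps of sections defines a
morphism of the associated sheaves. -/
def sheafHom {P Q : ModPresheaf E} (Φ : ∀ y, P.Stalk y →+ Q.Stalk y)
    (hΦ : ∀ y, ∃ (N : Opens Y) (_ : y ∈ N) (φ : ∀ W : Opens Y, W ≤ N → P.obj W →ₗ[E.obj W] Q.obj W),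
      ∀ (W : Opens Y) (h : W ≤ N) (z : Y) (hz : z ∈ W) (x : P.obj W),
        Φ z (P.germ hz x) = Q.germ hz (φ W h x)) : Hom P.sheafify Q.sheafify where
  app U :=
    { toFun := fun s => ⟨fun y => Φ y.1 (germOf s y.2), fun y => by
        obtain ⟨N, hN, φ, hφ⟩ := hΦ y.1
        obtain ⟨W, h, hW, hy, x, hx⟩ := exists_toSh s y.2 hN
        refine ⟨W, h, hy, φ W hW x, fun z hz => ?_⟩
        rw [← hφ W hW z hz x, ← germOf_toSh x hz, ← hx, germOf_res]⟩
      map_add' := fun s t => sheafify_ext fun y hy => map_add (Φ y) (germOf s hy) (germOf t hy)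
      map_smul' := fun e s => sheafify_ext fun y hy => by
        obtain ⟨N, hN, φ, hφ⟩ := hΦ y
        obtain ⟨W, h, hW, hy', x, hx⟩ := exists_toSh s hy hN
        have hs : germOf s hy = P.germ hy' x := by
          rw [← germOf_toSh x hy', ← hx, germOf_res]
        -- The germ at y comes from a presheaf section over some W inside N, where Φ is induced by
        -- the linear map φ; linearity on the stalk follows from linearity there.
        change Φ y (P.stalkAct hy e (germOf s hy)) = Q.stalkAct hy e (Φ y (germOf s hy))
        rw [hs, P.stalkAct_germ hy' h, hφ W hW, hφ W hW, Q.stalkAct_germ hy' h, map_smul] }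
  naturality _ _ := rfl

/-- Linear maps of sections over the members of an open cover and their open subsets, which
commute with restriction and agree on germs, glue to a morphism of the associated sheaves. -/
theorem exists_hom {P Q : ModPresheaf E} {I : Type*} (N : I → Opens Y) (hN : ∀ y, ∃ i, y ∈ N i)
    (φ : ∀ (i : I) (W : Opens Y), W ≤ N i → P.obj W →ₗ[E.obj W] Q.obj W)
    (hres : ∀ (i : I) {W W' : Opens Y} (h : W ≤ N i) (k : W' ≤ W) (x : P.obj W),
      Q.res k (φ i W h x) = φ i W' (k.trans h) (P.res k x))
    (hφ : ∀ (i j : I) (W : Opens Y) (h : W ≤ N i) (h' : W ≤ N j) (z : Y) (hz : z ∈ W) (x : P.obj W),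
      Q.germ hz (φ i W h x) = Q.germ hz (φ j W h' x)) :
    ∃ G : Hom P.sheafify Q.sheafify, ∀ (i : I) (W : Opens Y) (h : W ≤ N i) (x : P.obj W),
      G.app W (P.toSh W x) = Q.toSh W (φ i W h x) := by
  choose i hi using hN
  -- At each point one member of the cover is chosen arbitrarily and its map is passed to the stalk;
  -- `hφ` makes the choice immaterial.
  let Φ : ∀ y, P.Stalk y →+ Q.Stalk y := fun y =>
    stalkMap (fun W h => (φ (i y) W h).toAddMonoidHom) (fun h k x => hres (i y) h k x) (hi y)
  have hΦ : ∀ (j : I) (W : Opens Y) (h : W ≤ N j) (z : Y) (hz : z ∈ W) (x : P.obj W),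
      Φ z (P.germ hz x) = Q.germ hz (φ j W h x) := fun j W h z hz x => by
    -- The set W lies in N j but perhaps not in the set chosen at z, so the two maps are compared on
    -- the intersection.
    have hz' : z ∈ W ⊓ N (i z) := mem_inf hz (hi z)
    rw [← P.germ_res inf_le_left hz', ← Q.germ_res inf_le_left hz', hres,
      ← hφ (i z) j _ inf_le_right]
    exact stalkMap_germ _ (fun h k x => hres (i z) h k x) _ _ _ _
  exact ⟨sheafHom Φ fun y => ⟨N (i y), hi y, φ (i y), hΦ (i y)⟩, fun j W h x =>
    sheafify_ext fun z hz => hΦ j W h z hz x⟩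

end ModPresheaf

/-! ### Formal consequences of the relations between differentials -/

section OmegaLemmas

variable {S A R : Type*} [CommRing S] [CommRing A] [CInfRing A] [Ring R] [Algebra ℂ R]
  [Algebra S R] [Algebra A R]

namespace Omega

theorem d_zero : d S A R 0 = 0 := by
  have h := d_linear_left (S := S) (A := A) (R := R) 0 0 0 0
  have hb : (bi 0 1 : Env R) = 0 := TensorProduct.zero_tmul _ _
  simpa [hb] using h

theorem d_add (r r' : R) : d S A R (r + r') = d S A R r + d S A R r' := by
  have h := d_linear_left (S := S) (A := A) (R := R) 1 1 r r'
  simpa [bi_one] using h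

theorem d_one : d S A R 1 = 0 := by
  have h := d_mul (S := S) (A := A) (R := R) 1 1
  simpa [bi_one] using h

/-- Linearity turns d(a·1) into a d(1), and d(1) = 0 by Leibniz applied to 1 = 1·1. -/
theorem d_algebraMap (a : S) : d S A R (algebraMap S R a) = 0 := by
  have h := d_linear_left (S := S) (A := A) (R := R) a 0 1 0
  have hb : (bi 0 1 : Env R) = 0 := TensorProduct.zero_tmul _ _
  simpa [hb, d_one, Algebra.smul_def] using h

/-- The differential of a central element commutes with `R`. -/
theorem bi_smul_d_of_mem_center {x : R} (hx : x ∈ Subring.center R) (a b : R) :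
    bi a b • d S A R x = bi (a * b) 1 • d S A R x := by
  -- Expand d(xb) and d(bx) by Leibniz. The two are equal since x is central, and the terms d(b)x
  -- and x d(b) agree by the centre relation; what is left after cancelling is d(x)b = b d(x).
  have h : bi 1 b • d S A R x = bi b 1 • d S A R x := by
    have h₁ := d_mul (S := S) (A := A) x b
    rw [← Subring.mem_center_iff.1 hx b, d_mul, d_center b x hx] at h₁
    exact (add_left_cancel (h₁.trans (add_comm _ _))).symm
  have hb : bi a b = bi a 1 * bi 1 b := by rw [bi_mul, mul_one, mul_one]
  rw [hb, mul_smul, h, ← mul_smul, bi_mul, mul_one]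

/-- The chain rule, including the case of a function of no variables. -/
theorem d_op {s : ℕ} (f : SmoothFun s) (a : Fin s → A) :
    d S A R (algebraMap A R (CInfRing.op f a)) =
      ∑ i, bi (algebraMap A R (CInfRing.op (f.pd i) a)) 1 • d S A R (algebraMap A R (a i)) := by
  rcases Nat.eq_zero_or_pos s with rfl | hs
  · have h := CInfRing.op_comp f (fun i : Fin 0 => (i.elim0 : SmoothFun 1)) (fun _ => (0 : A))
    rw [Subsingleton.elim a fun i => CInfRing.op (i.elim0 : SmoothFun 1) fun _ => (0 : A), ← h,
      d_chain le_rfl]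
    simp [d_zero]
  · exact d_chain hs f a

end Omega

end OmegaLemmas

/-! ### Local coordinates and coordinate vector fields -/

section Frames

open Bundle

variable {E : Type*} [NormedAddCommGroup E] [NormedSpace ℝ E] {Y : Type*} [TopologicalSpace Y]
  [ChartedSpace E Y] [IsManifold 𝓘(ℝ, E) ∞ Y]

theorem Sec.sum_apply {F : Type*} [NormedAddCommGroup F] [NormedSpace ℝ F] {V : Y → Type*}
    [TopologicalSpace (TotalSpace F V)] [∀ y, TopologicalSpace (V y)] [FiberBundle F V]
    {𝕂 : Type*} [NontriviallyNormedField 𝕂] [NormedAlgebra ℝ 𝕂] [NormedSpace 𝕂 F]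
    [IsScalarTower ℝ 𝕂 F] [∀ y, AddCommGroup (V y)] [∀ y, Module 𝕂 (V y)] [VectorBundle 𝕂 F V]
    {ι : Type*} (s : Finset ι) {U : Opens Y} (f : ι → Sec E F V 𝕂 U) (z : U) :
    (∑ i ∈ s, f i).1 z = ∑ i ∈ s, (f i).1 z := by
  rw [AddSubgroup.val_finsetSum, Finset.sum_apply]

variable (E) in
/-- Smooth coordinates `x` on the open set `N`, with the coordinate vector fields, such that every
smooth function is locally a smooth function of the coordinates. -/
structure CoordFrame (N : Opens Y) where
  /-- the number of coordinates -/
  n : ℕ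
  /-- the coordinates -/
  x : Fin n → Fn E ℝ N
  /-- the coordinate vector fields -/
  del : Fin n → Vec E N
  vec_eq : ∀ (z : N) (v : Tan E Y z.1), v = ∑ j, (dAt E (x j) z v : ℝ) • (del j).1 z
  dual : ∀ (z : N) (j k : Fin n), (dAt E (x j) z ((del k).1 z) : ℝ) = if j = k then 1 else 0
  exists_op : ∀ {W : Opens Y} (h : W ≤ N) (g : Fn E ℝ W) (z : Y), z ∈ W →
    ∃ (N' : Opens Y) (k : N' ≤ W) (_ : z ∈ N') (f : SmoothFun n),
      Fn.res E ℝ k g = CInfRing.op f fun j => Fn.res E ℝ (k.trans h) (x j)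

namespace CoordFrame

variable {N : Opens Y} (c : CoordFrame E N)

/-- The restriction of a coordinate vector field. -/
def del' {W : Opens Y} (h : W ≤ N) (j : Fin c.n) : Vec E W := Sec.res h (c.del j)

/-- The restriction of a coordinate. -/
def x' {W : Opens Y} (h : W ≤ N) (j : Fin c.n) : Fn E ℝ W := Fn.res E ℝ h (c.x j)

theorem res_del {W W' : Opens Y} (h : W ≤ N) (k : W' ≤ W) (j : Fin c.n) :
    Sec.res k (c.del' h j) = c.del' (k.trans h) j := rfl

theorem deriv_x {W : Opens Y} (h : W ≤ N) (j k : Fin c.n) :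
    (c.del' h k).deriv (c.x' h j) = if j = k then 1 else 0 := by
  refine ContMDiffMap.ext fun z => ?_
  change (dAt E (Fn.res E ℝ h (c.x j)) z ((c.del k).1 ⟨z.1, h z.2⟩) : ℝ) = _
  rw [dAt_res, c.dual]
  split_ifs <;> rfl

theorem vec_eq_sum {W : Opens Y} (h : W ≤ N) (ξ : Vec E W) :
    ξ = ∑ j, ξ.deriv (c.x' h j) • c.del' h j := by
  refine Subtype.ext (funext fun z => ?_)
  rw [Sec.sum_apply]
  refine (c.vec_eq ⟨z.1, h z.2⟩ (ξ.1 z)).trans (Finset.sum_congr rfl fun j _ => ?_)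
  change _ = (dAt E (Fn.res E ℝ h (c.x j)) z (ξ.1 z) : ℝ) • (c.del j).1 ⟨z.1, h z.2⟩
  rw [dAt_res]

/-- Evaluate θ on the expansion of a tangent vector in the coordinate fields. -/
theorem oneForm_eq_sum {W : Opens Y} (h : W ≤ N) (θ : OneForm E W) :
    θ = ∑ j, contract (c.del' h j) θ • OneForm.d (c.x' h j) := by
  refine Subtype.ext (funext fun z => ContinuousLinearMap.ext fun v => ?_)
  rw [Sec.sum_apply]
  have h1 := congrArg (θ.1 z) (c.vec_eq ⟨z.1, h z.2⟩ v)
  rw [map_sum] at h1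
  refine h1.trans ?_
  rw [sum_apply]
  refine Finset.sum_congr rfl fun j _ => ?_
  rw [map_smul]
  change (dAt E (c.x j) ⟨z.1, h z.2⟩ v : ℝ) * _ = _ * (dAt E (Fn.res E ℝ h (c.x j)) z v : ℝ)
  rw [dAt_res, mul_comm]
  rfl

end CoordFrame

variable [FiniteDimensional ℝ E] [T2Space Y]

/-- The operations of a C^∞-ring are functions smooth on all of ℝⁿ, whereas a local coordinate
expression is smooth only near a point. Multiplying by a bump function equal to 1 near a extends it
by zero without changing its germ. -/
theorem exists_smoothFun_eventuallyEq {n : ℕ} (L : E ≃L[ℝ] (Fin n → ℝ)) {g : E → ℝ} {a : E}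
    (hg : ∀ᶠ b in nhds a, ContDiffAt ℝ ∞ g b) :
    ∃ f : SmoothFun n, ∀ᶠ b in nhds a, g b = f.fn (L b) := by
  obtain ⟨ε, hε, hb⟩ := Metric.eventually_nhds_iff_ball.1 hg
  -- The outer radius ε/2 is strictly less than ε, so every point off the ball of radius ε has a
  -- neighbourhood on which χ vanishes, and the product is smooth there too.
  let χ : ContDiffBump a := ⟨ε / 4, ε / 2, by positivity, by linarith⟩
  have hs : ContDiff ℝ ∞ fun b => χ b * g b := by
    refine contDiff_iff_contDiffAt.2 fun b => ?_
    by_cases hbt : b ∈ Metric.ball a ε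
    · exact χ.contDiffAt.mul (hb b hbt)
    · refine (contDiffAt_const (c := (0 : ℝ))).congr_of_eventuallyEq ?_
      have hbn : b ∈ (Metric.closedBall a (ε / 2))ᶜ := fun h =>
        hbt (Metric.closedBall_subset_ball (by linarith) h)
      filter_upwards [Metric.isClosed_closedBall.isOpen_compl.mem_nhds hbn] with z hz
      have : χ z = 0 := by
        refine χ.zero_of_le_dist ?_
        have : ¬ dist z a ≤ ε / 2 := hz
        exact (not_le.1 this).le
      rw [this, zero_mul]
  refine ⟨⟨fun v => χ (L.symm v) * g (L.symm v), hs.comp L.symm.contDiff⟩, ?_⟩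
  filter_upwards [χ.eventuallyEq_one] with b hb1
  rw [L.symm_apply_apply, hb1, Pi.one_apply, one_mul]

variable (E) in
-- The coordinates are those of the chart at y in a basis of the model space, and the vector fields
-- are the basis vectors transported by the tangent trivialization at y. They are dual to each other
-- because that trivialization is the derivative of the chart.
theorem exists_coordFrame (y : Y) : ∃ N : Opens Y, y ∈ N ∧ Nonempty (CoordFrame E N) := by
  let e := trivializationAt E (Tan E Y) y
  let b := Module.finBasis ℝ E
  let N : Opens Y := ⟨(chartAt E y).source, (chartAt E y).open_source⟩
  have hN : ∀ z : N, z.1 ∈ e.baseSet := fun z => z.2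
  have hx : ∀ j, ContMDiffOn 𝓘(ℝ, E) 𝓘(ℝ, ℝ) ∞ (fun z => b.equivFunL (extChartAt 𝓘(ℝ, E) y z) j)
      (chartAt E y).source := fun j =>
    ((ContinuousLinearMap.proj (R := ℝ) (φ := fun _ => ℝ) j).comp
      b.equivFunL.toContinuousLinearMap).contDiff.contMDiff.comp_contMDiffOn
      contMDiffOn_extChartAt
  let x : Fin (Module.finrank ℝ E) → Fn E ℝ N := fun j =>
    ⟨fun z => b.equivFunL (extChartAt 𝓘(ℝ, E) y z.1) j,
      contMDiffOn_univ.1 ((hx j).comp contMDiff_subtype_val.contMDiffOn fun z _ => z.2)⟩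
  -- The differential of the j-th coordinate reads off the j-th component in the tangent
  -- trivialization; the expansion and the duality then reduce to linear algebra in the basis b.
  have hdx : ∀ j (z : N) (v : Tan E Y z.1),
      (dAt E (x j) z v : ℝ) = b.equivFunL (e.continuousLinearMapAt ℝ z.1 v) j := by
    intro j z v
    have hz : MDifferentiableAt 𝓘(ℝ, E) 𝓘(ℝ, E) (extChartAt 𝓘(ℝ, E) y) z.1 :=
      mdifferentiableAt_extChartAt z.2
    let ℓ : E →L[ℝ] ℝ := (ContinuousLinearMap.proj (R := ℝ) (φ := fun _ => ℝ) j).comp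
      b.equivFunL.toContinuousLinearMap
    have hℓ : HasMFDerivAt 𝓘(ℝ, E) 𝓘(ℝ, ℝ) ℓ (extChartAt 𝓘(ℝ, E) y z.1) ℓ :=
      ℓ.hasFDerivAt.hasMFDerivAt
    rw [dAt_congr (x j) (g := ℓ ∘ extChartAt 𝓘(ℝ, E) y) z
      (Filter.Eventually.of_forall fun _ => rfl), (hℓ.comp z.1 hz.hasMFDerivAt).mfderiv]
    have := TangentBundle.continuousLinearMapAt_trivializationAt (I := 𝓘(ℝ, E)) (x₀ := y) z.2
    change ℓ (mfderiv 𝓘(ℝ, E) 𝓘(ℝ, E) (extChartAt 𝓘(ℝ, E) y) z.1 v) = ℓ _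
    rw [← this]
    rfl
  let del : Fin (Module.finrank ℝ E) → Vec E N := fun j => ⟨fun z => e.symmL ℝ z.1 (b j), by
    have h := e.contMDiffOn_localFrame_baseSet (I := 𝓘(ℝ, E)) (n := ∞) b j
    have h' := contMDiffOn_univ.1 (h.comp (contMDiff_subtype_val (I := 𝓘(ℝ, E))
      (U := N)).contMDiffOn fun z _ => hN z)
    refine h'.congr fun z => ?_
    simp only [Function.comp_apply, e.localFrame_apply_of_mem_baseSet b (hN z)]
    rw [e.symmL_apply (hN z)]
    simp [Trivialization.basisAt]⟩
  refine ⟨N, mem_chart_source E y, ⟨⟨Module.finrank ℝ E, x, del, ?_, ?_, ?_⟩⟩⟩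
  · intro z v
    simp only [hdx]
    change v = ∑ j, _ • e.symmL ℝ z.1 (b j)
    conv_lhs => rw [← e.symmL_continuousLinearMapAt (R := ℝ) (hN z) v,
      ← b.sum_equivFun (e.continuousLinearMapAt ℝ z.1 v), map_sum]
    exact Finset.sum_congr rfl fun j _ => map_smul _ _ _
  · intro z j k
    rw [hdx]
    change b.equivFunL (e.continuousLinearMapAt ℝ z.1 (e.symmL ℝ z.1 (b k))) j = _
    rw [e.continuousLinearMapAt_symmL (hN z)]
    simp [Finsupp.single_apply, eq_comm]
  · intro W h g z hz
    let φ := extChartAt 𝓘(ℝ, E) y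
    have hzs : z ∈ φ.source := by rw [extChartAt_source]; exact h hz
    -- The coordinate expression of g is smooth near φ(z), so its germ is that of a globally smooth
    -- function of the coordinates.
    have hg : ∀ᶠ b in nhds (φ z), ContDiffAt ℝ ∞ (extZero g ∘ φ.symm) b := by
      have h1 : ContinuousAt φ.symm (φ z) := continuousAt_extChartAt_symm' hzs
      have h2 : φ.symm (φ z) ∈ W := by rw [φ.left_inv hzs]; exact hz
      filter_upwards [extChartAt_target_mem_nhds' (φ.map_source hzs),
        h1.preimage_mem_nhds (W.2.mem_nhds h2)] with b hb hbW
      have h3 : ContMDiffAt 𝓘(ℝ, E) 𝓘(ℝ, E) ∞ φ.symm b :=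
        (contMDiffOn_extChartAt_symm y).contMDiffAt (extChartAt_target_mem_nhds' hb)
      exact ((extZero_contMDiffAt E g ⟨φ.symm b, hbW⟩).comp b h3).contDiffAt
    obtain ⟨f, hf⟩ := exists_smoothFun_eventuallyEq b.equivFunL hg
    have h4 : ContinuousAt φ z := continuousAt_extChartAt' hzs
    obtain ⟨O, hO, hOo, hzO⟩ := mem_nhds_iff.1 (h4.eventually hf)
    refine ⟨⟨O, hOo⟩ ⊓ W, inf_le_right, ⟨hzO, hz⟩, f, ContMDiffMap.ext fun w => ?_⟩
    have h5 : extZero g (φ.symm (φ w.1)) = f.fn (b.equivFunL (φ w.1)) := hO w.2.1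
    rw [φ.left_inv (by rw [extChartAt_source]; exact h w.2.2), extZero_apply g ⟨w.1, w.2.2⟩] at h5
    exact h5

end Frames

/-! ### The inclusion and the splitting in coordinates -/

section LocalMaps

open Bundle

variable {E : Type*} [NormedAddCommGroup E] [NormedSpace ℝ E] {Y : Type*} [TopologicalSpace Y]
  [ChartedSpace E Y] [IsManifold 𝓘(ℝ, E) ∞ Y]
  {F : Type*} [NormedAddCommGroup F] [NormedSpace ℂ F] {V : Y → Type*}
  [TopologicalSpace (TotalSpace F V)] [∀ y, TopologicalSpace (V y)] [FiberBundle F V]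
  [∀ y, AddCommGroup (V y)] [∀ y, Module ℂ (V y)] [VectorBundle ℂ F V]

theorem Nc.algebraMap_mem_center {U : Opens Y} (f : Fn E ℝ U) :
    algebraMap (Fn E ℝ U) (Nc E F V U) f ∈ Subring.center (Nc E F V U) :=
  Subring.mem_center_iff.2 fun A => (Algebra.commutes f A).symm

theorem contractTens_smul {U : Opens Y} (ξ : Vec E U) (e : Env (Nc E F V U))
    (x : Nc E F V U ⊗[Fn E ℝ U] OneForm E U) : contractTens ξ (e • x) = e • contractTens ξ x := by
  induction x using TensorProduct.induction_on with
  | zero => rw [smul_zero, map_zero, smul_zero]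
  | add x y hx hy => rw [smul_add, map_add, map_add, smul_add, hx, hy]
  | tmul A θ => rw [env_smul_tmul, contractTens_tmul, contractTens_tmul, smul_comm]

theorem contract_d {U : Opens Y} (ξ : Vec E U) (f : Fn E ℝ U) :
    contract ξ (OneForm.d f) = ξ.deriv f := rfl

namespace CoordFrame

variable {N : Opens Y} (c : CoordFrame E N)

/-- For a pure tensor the scalars θ(∂ⱼ) move across the tensor sign and reassemble θ; the general
case is additive. -/
theorem tens_eq_sum {W : Opens Y} (h : W ≤ N) (x : Nc E F V W ⊗[Fn E ℝ W] OneForm E W) :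
    x = ∑ j, contractTens (c.del' h j) x ⊗ₜ OneForm.d (c.x' h j) := by
  induction x using TensorProduct.induction_on with
  | zero => simp only [map_zero, TensorProduct.zero_tmul, Finset.sum_const_zero]
  | add x y hx hy =>
    simp only [map_add, TensorProduct.add_tmul, Finset.sum_add_distrib]
    rw [← hx, ← hy]
  | tmul A θ =>
    simp only [contractTens_tmul, TensorProduct.smul_tmul]
    rw [← TensorProduct.tmul_sum, ← c.oneForm_eq_sum h θ]

/-- Reduces equalities in the tensor product over a chart to equalities in 𝒪^nc. Chart independence
of the splitting, π ∘ i = id and the injectivity of i are all checked this way. -/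
theorem contractTens_ext {W : Opens Y} (h : W ≤ N) {x y : Nc E F V W ⊗[Fn E ℝ W] OneForm E W}
    (hxy : ∀ j, contractTens (c.del' h j) x = contractTens (c.del' h j) y) : x = y := by
  rw [c.tens_eq_sum h x, c.tens_eq_sum h y]
  simp only [hxy]

end CoordFrame

variable [FiniteDimensional ℝ E] [T2Space Y]

theorem omegaRes_bi_smul_d {U W : Opens Y} (h : W ≤ U) (e : Env (Nc E F V U)) (A : Nc E F V U) :
    omegaRes E F V h (e • Omega.d ℂ (Fn E ℝ U) (Nc E F V U) A) =
      envMap (Nc.res h) e • Omega.d ℂ (Fn E ℝ W) (Nc E F V W) (Nc.res h A) :=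
  ((omegaRes E F V h).map_smulₛₗ e _).trans (congrArg _ (Omega.map_d _ _ _ _ _ _ _ A))

/-- The differential, in the differentials of `𝒪^nc`, of a smooth function of `Y`. -/
def dFn (F : Type*) [NormedAddCommGroup F] [NormedSpace ℂ F] (V : Y → Type*)
    [TopologicalSpace (TotalSpace F V)] [∀ y, TopologicalSpace (V y)] [FiberBundle F V]
    [∀ y, AddCommGroup (V y)] [∀ y, Module ℂ (V y)] [VectorBundle ℂ F V]
    {U : Opens Y} (f : Fn E ℝ U) : Omega ℂ (Fn E ℝ U) (Nc E F V U) :=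
  Omega.d ℂ (Fn E ℝ U) (Nc E F V U) (algebraMap _ _ f)

theorem omegaRes_bi_smul_dFn {U W : Opens Y} (h : W ≤ U) (A : Nc E F V U) (f : Fn E ℝ U) :
    omegaRes E F V h (bi A 1 • dFn F V f) = bi (Nc.res h A) 1 • dFn F V (Fn.res E ℝ h f) := by
  rw [dFn, omegaRes_bi_smul_d, envMap_bi, map_one, Nc.res_real, dFn]

theorem bi_smul_dFn {U : Opens Y} (A B : Nc E F V U) (f : Fn E ℝ U) :
    bi A B • dFn F V f = bi (A * B) 1 • dFn F V f :=
  Omega.bi_smul_d_of_mem_center (Nc.algebraMap_mem_center f) A B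

/-- Right multiplication passes through df because f is central, so the two-sided action on A df is
the action on its coefficient A. This is why the inclusion in coordinates is linear on both sides.
-/
theorem bi_env_smul_dFn {U : Opens Y} (e : Env (Nc E F V U)) (A : Nc E F V U) (f : Fn E ℝ U) :
    bi (e • A) 1 • dFn F V f = e • bi A 1 • dFn F V f := by
  induction e using env_induction with
  | h0 =>
    have : (bi 0 1 : Env (Nc E F V U)) = 0 := TensorProduct.zero_tmul _ _
    rw [zero_smul, this, zero_smul, zero_smul]
  | hadd e e' h h' => rw [add_smul, bi_add_left, add_smul, add_smul, h, h']
  | hbi a b => rw [bi_smul_self, ← mul_smul, bi_mul, one_mul, bi_smul_dFn (a * A) b]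

/-- The chain rule for the derivatives of a function of the coordinates. -/
theorem CoordFrame.deriv_op {N : Opens Y} (c : CoordFrame E N) {W : Opens Y} (h : W ≤ N)
    (f : SmoothFun c.n) (k : Fin c.n) :
    (c.del' h k).deriv (CInfRing.op f (c.x' h)) = CInfRing.op (f.pd k) (c.x' h) := by
  rw [Vec.deriv_op]
  simp only [c.deriv_x, mul_ite, mul_one, mul_zero, Finset.sum_ite_eq', Finset.mem_univ, if_true]

/-- Locally, the differential of a function of `Y` is given by its partial derivatives. -/
theorem CoordFrame.exists_dFn_eq {N : Opens Y} (c : CoordFrame E N) {W : Opens Y} (h : W ≤ N)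
    (g : Fn E ℝ W) (z : Y) (hz : z ∈ W) : ∃ (N' : Opens Y) (k : N' ≤ W) (_ : z ∈ N'),
      dFn F V (Fn.res E ℝ k g) =
        ∑ j, bi (algebraMap _ (Nc E F V N') (Fn.res E ℝ k ((c.del' h j).deriv g))) 1 •
          dFn F V (c.x' (k.trans h) j) := by
  -- Shrinking the open set makes g an honest smooth function f of the coordinates, to which the
  -- chain-rule relation applies; its partial derivatives are the derivatives of g along the ∂ⱼ.
  obtain ⟨N', k, hz', f, hf⟩ := c.exists_op h g z hz
  refine ⟨N', k, hz', ?_⟩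
  simp only [Vec.deriv_res, c.res_del]
  rw [hf]
  simp only [dFn]
  refine (Omega.d_op f _).trans (Finset.sum_congr rfl fun j _ => ?_)
  exact congrArg (fun t => bi (algebraMap _ (Nc E F V N') t) 1 • dFn F V (c.x' (k.trans h) j))
    (c.deriv_op (k.trans h) f j).symm

variable (F V) in
/-- The map `a ⊗ θ ↦ ∑ θ(∂ⱼ) a dxⱼ` in coordinates. -/
def CoordFrame.incl {N : Opens Y} (c : CoordFrame E N) {W : Opens Y} (h : W ≤ N) :
    (Nc E F V W ⊗[Fn E ℝ W] OneForm E W) →ₗ[Env (Nc E F V W)]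
      Omega ℂ (Fn E ℝ W) (Nc E F V W) where
  toFun x := ∑ j, bi (contractTens (c.del' h j) x) 1 • dFn F V (c.x' h j)
  map_add' x y := by
    simp only [map_add, bi_add_left, add_smul, Finset.sum_add_distrib]
  map_smul' e x := by
    simp only [contractTens_smul, bi_env_smul_dFn, RingHom.id_apply, Finset.smul_sum]

theorem CoordFrame.incl_apply {N : Opens Y} (c : CoordFrame E N) {W : Opens Y} (h : W ≤ N)
    (x : Nc E F V W ⊗[Fn E ℝ W] OneForm E W) :
    c.incl F V h x = ∑ j, bi (contractTens (c.del' h j) x) 1 • dFn F V (c.x' h j) := rfl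

theorem CoordFrame.incl_res {N : Opens Y} (c : CoordFrame E N) {W W' : Opens Y} (h : W ≤ N)
    (k : W' ≤ W) (x : Nc E F V W ⊗[Fn E ℝ W] OneForm E W) :
    omegaRes E F V k (c.incl F V h x) = c.incl F V (k.trans h) (tensRes E F V k x) := by
  rw [incl_apply, incl_apply, map_sum]
  refine Finset.sum_congr rfl fun j _ => ?_
  rw [omegaRes_bi_smul_dFn, contractTens_res]
  rfl

/-- On germs, the map in coordinates sends `a ⊗ dg` to `a dg`. -/
theorem CoordFrame.germ_incl_tmul_d {N : Opens Y} (c : CoordFrame E N) {W : Opens Y} (h : W ≤ N)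
    (A : Nc E F V W) (g : Fn E ℝ W) {z : Y} (hz : z ∈ W) :
    (omegaPre E F V).germ hz (c.incl F V h (A ⊗ₜ OneForm.d g)) =
      (omegaPre E F V).germ hz (bi A 1 • dFn F V g) := by
  obtain ⟨N', k, hz', e⟩ := c.exists_dFn_eq (F := F) (V := V) h g z hz
  refine ((omegaPre E F V).germ_eq_iff _ _ _ _).2 ⟨N', hz', k, k, ?_⟩
  change omegaRes E F V k _ = omegaRes E F V k _
  rw [omegaRes_bi_smul_dFn, e, c.incl_apply, map_sum, Finset.smul_sum]
  refine Finset.sum_congr rfl fun j _ => ?_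
  rw [omegaRes_bi_smul_dFn, contractTens_tmul, contract_d, ← mul_smul, bi_mul, mul_one,
    Nc.res_smul, Algebra.smul_def, Algebra.commutes]
  rfl

/-- Expand x in the coordinates of c as a sum of terms A ⊗ dxⱼ. The second chart sends each of
these, on germs, to A dxⱼ, which is the definition in the first chart. Only germs are compared,
since a function need not be a function of the other coordinates on the whole of W. -/
theorem CoordFrame.germ_incl_eq {N N' : Opens Y} (c : CoordFrame E N) (c' : CoordFrame E N')
    {W : Opens Y} (h : W ≤ N) (h' : W ≤ N') (x : Nc E F V W ⊗[Fn E ℝ W] OneForm E W) {z : Y}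
    (hz : z ∈ W) : (omegaPre E F V).germ hz (c.incl F V h x) =
      (omegaPre E F V).germ hz (c'.incl F V h' x) := by
  conv_rhs => rw [c.tens_eq_sum h x, map_sum]
  rw [c.incl_apply]
  refine (map_sum ((omegaPre E F V).germ hz) _ _).trans (Eq.trans ?_
    (map_sum ((omegaPre E F V).germ hz) _ _).symm)
  exact Finset.sum_congr rfl fun j _ => (c'.germ_incl_tmul_d h' _ _ hz).symm

/-- Both sides are bimodule maps in w, so it is enough to take w = dA, where the claim is the
linearity of ∇''_ξ A over functions in ξ. -/
theorem Connection.pairing_sum (D : BundleConnection E F V) {U : Opens Y} {ι : Type*}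
    (s : Finset ι) (f : ι → Fn E ℝ U) (ξ : ι → Vec E U) (w : Omega ℂ (Fn E ℝ U) (Nc E F V U)) :
    D.pairing (∑ j ∈ s, f j • ξ j) w = ∑ j ∈ s, f j • D.pairing (ξ j) w := by
  -- The empty sum requires the derivative along the zero field to vanish, which follows from
  -- additivity applied to 0 + 0.
  have hz : ∀ A : Nc E F V U, D.endDeriv (0 : Vec E U) A = 0 := fun A => by
    have := D.endConnection.add_nabla (0 : Vec E U) 0 A
    rw [add_zero] at this
    exact left_eq_add.1 this
  induction w using Omega.induction with
  | h0 => simp only [map_zero, smul_zero, Finset.sum_const_zero]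
  | hadd x y hx hy => simp only [map_add, smul_add, Finset.sum_add_distrib, hx, hy]
  | hd e A =>
    simp only [map_smul, D.pairing_d, smul_comm _ e, ← Finset.smul_sum]
    congr 1
    classical
    induction s using Finset.induction_on with
    | empty => simp only [Finset.sum_empty, hz]
    | insert j s hj ih =>
      rw [Finset.sum_insert hj, Finset.sum_insert hj, ← ih]
      refine (D.endConnection.add_nabla _ _ A).trans (congrArg (· + _) ?_)
      exact D.endConnection.smul_nabla _ _ A

/-- The projection `w ↦ ∑ ⟨w, ∇_{∂ⱼ}⟩ ⊗ dxⱼ` in coordinates. -/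
def CoordFrame.proj {N : Opens Y} (c : CoordFrame E N) (D : BundleConnection E F V) {W : Opens Y}
    (h : W ≤ N) : Omega ℂ (Fn E ℝ W) (Nc E F V W) →ₗ[Env (Nc E F V W)]
      (Nc E F V W ⊗[Fn E ℝ W] OneForm E W) where
  toFun w := ∑ j, D.pairing (c.del' h j) w ⊗ₜ OneForm.d (c.x' h j)
  map_add' x y := by
    simp only [map_add, TensorProduct.add_tmul, Finset.sum_add_distrib]
  map_smul' e x := by
    simp only [map_smul, RingHom.id_apply, Finset.smul_sum, env_smul_tmul]

/-- Expanding ξ as Σ ξ(xⱼ) ∂ⱼ, both sides become Σ ξ(xⱼ) ⟨w, ∇''_{∂ⱼ}⟩. The right side of the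
statement does not mention the chart, which gives independence of coordinates and compatibility with
restriction at once. -/
theorem CoordFrame.contractTens_proj {N : Opens Y} (c : CoordFrame E N)
    (D : BundleConnection E F V) {W : Opens Y} (h : W ≤ N) (ξ : Vec E W)
    (w : Omega ℂ (Fn E ℝ W) (Nc E F V W)) :
    contractTens ξ (c.proj D h w) = D.pairing ξ w := by
  conv_rhs => rw [c.vec_eq_sum h ξ, D.pairing_sum]
  change contractTens ξ (∑ j, D.pairing (c.del' h j) w ⊗ₜ OneForm.d (c.x' h j)) = _
  rw [map_sum]
  rfl

theorem CoordFrame.proj_res {N : Opens Y} (c : CoordFrame E N) (D : BundleConnection E F V)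
    {W W' : Opens Y} (h : W ≤ N) (k : W' ≤ W) (w : Omega ℂ (Fn E ℝ W) (Nc E F V W)) :
    tensRes E F V k (c.proj D h w) = c.proj D (k.trans h) (omegaRes E F V k w) := by
  refine c.contractTens_ext (k.trans h) fun j => ?_
  rw [← c.res_del h k, ← contractTens_res, contractTens_proj, contractTens_proj, D.pairing_res]

theorem CoordFrame.proj_eq {N N' : Opens Y} (c : CoordFrame E N) (c' : CoordFrame E N')
    (D : BundleConnection E F V) {W : Opens Y} (h : W ≤ N) (h' : W ≤ N')
    (w : Omega ℂ (Fn E ℝ W) (Nc E F V W)) : c.proj D h w = c'.proj D h' w :=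
  c.contractTens_ext h fun j => by rw [contractTens_proj, contractTens_proj]

theorem Connection.endDeriv_real (D : BundleConnection E F V) {U : Opens Y} (ξ : Vec E U)
    (f : Fn E ℝ U) :
    D.endDeriv ξ (algebraMap (Fn E ℝ U) (Nc E F V U) f) = algebraMap _ _ (ξ.deriv f) := by
  rw [Nc.algebraMap_real, D.endDeriv_ofFn, Vec.deriv_toComplex, Nc.algebraMap_real]

theorem Connection.pairing_dFn (D : BundleConnection E F V) {U : Opens Y} (ξ : Vec E U)
    (A : Nc E F V U) (f : Fn E ℝ U) :
    D.pairing ξ (bi A 1 • dFn F V f) = ξ.deriv f • A := by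
  rw [map_smul, dFn, pairing_d, endDeriv_real, bi_smul_self, mul_one, Algebra.smul_def,
    Algebra.commutes]

/-- After contraction with ∂ⱼ the claim is Σₖ ∂ⱼ(xₖ) tₖ = tⱼ, where the tₖ are the contractions of
x. The connection drops out because it differentiates functions in the ordinary way. -/
theorem CoordFrame.proj_incl {N : Opens Y} (c : CoordFrame E N) (D : BundleConnection E F V)
    {W : Opens Y} (h : W ≤ N) (x : Nc E F V W ⊗[Fn E ℝ W] OneForm E W) :
    c.proj D h (c.incl F V h x) = x := by
  refine c.contractTens_ext h fun j => ?_
  rw [contractTens_proj, incl_apply, map_sum]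
  simp only [D.pairing_dFn, c.deriv_x, ite_smul, one_smul, zero_smul, Finset.sum_ite_eq',
    Finset.mem_univ, if_true]

end LocalMaps

/-! ### The flat connection of a local trivialization and injectivity of the inclusion -/

section FlatConnection

open Bundle

variable {E : Type*} [NormedAddCommGroup E] [NormedSpace ℝ E] {Y : Type*} [TopologicalSpace Y]
  [ChartedSpace E Y]
  {F : Type*} [NormedAddCommGroup F] [NormedSpace ℂ F] {V : Y → Type*}
  [TopologicalSpace (TotalSpace F V)] [∀ y, TopologicalSpace (V y)] [FiberBundle F V]
  [∀ y, AddCommGroup (V y)] [∀ y, Module ℂ (V y)] [VectorBundle ℂ F V]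
  [SmoothComplexBundle E F V]

/-- The two coordinate expressions differ by the transition function, and this is where the
smoothness of the bundle enters. -/
theorem contMDiffAt_change_trivialization (e e' : Trivialization F (TotalSpace.proj : TotalSpace F V → Y))
    [MemTrivializationAtlas e] [MemTrivializationAtlas e'] {U : Opens Y} {s : ∀ y : U, V y} {y : U}
    (he : y.1 ∈ e.baseSet) (he' : y.1 ∈ e'.baseSet)
    (h : ContMDiffAt 𝓘(ℝ, E) 𝓘(ℝ, F) ∞ (fun z : U => (e (TotalSpace.mk' F z.1 (s z))).2) y) :
    ContMDiffAt 𝓘(ℝ, E) 𝓘(ℝ, F) ∞ (fun z : U => (e' (TotalSpace.mk' F z.1 (s z))).2) y := by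
  have hb : e.baseSet ∩ e'.baseSet ∈ nhds y.1 :=
    (e.open_baseSet.inter e'.open_baseSet).mem_nhds ⟨he, he'⟩
  have h1 : ContMDiffAt 𝓘(ℝ, E) 𝓘(ℝ, F →L[ℂ] F) ∞
      (fun z : U => (e.coordChangeL ℂ e' z.1 : F →L[ℂ] F)) y :=
    ((SmoothComplexBundle.contMDiffOn_coordChangeL e e').contMDiffAt hb).comp y
      contMDiff_subtype_val.contMDiffAt
  -- Smoothness is over ℝ, so the complex-linear transition maps are first viewed as real-linear
  -- ones and then applied to the smooth coordinate vector.
  have h2 := ((ContinuousLinearMap.restrictScalarsL ℂ F F ℝ ℝ).contDiff.contMDiff.contMDiffAt.comp y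
    h1).clm_apply h
  refine h2.congr_of_eventuallyEq ?_
  filter_upwards [continuous_subtype_val.continuousAt.preimage_mem_nhds hb] with z hz
  have hz' : z.1 ∈ e.baseSet ∩ e'.baseSet := hz
  change _ = e.coordChangeL ℂ e' z.1 (e (TotalSpace.mk' F z.1 (s z))).2
  rw [e.coordChangeL_apply e' hz', e.symm_apply_apply_mk hz'.1]

/-- Smoothness of a section is tested by default in a trivialization depending on the point; here a
single one serves for all of U, so that sections can be differentiated componentwise. -/
theorem isSmoothSec_iff_trivialization (e : Trivialization F (TotalSpace.proj : TotalSpace F V → Y))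
    [MemTrivializationAtlas e] {U : Opens Y} (he : (U : Set Y) ⊆ e.baseSet) {s : ∀ y : U, V y} :
    IsSmoothSec E F V s ↔
      ContMDiff 𝓘(ℝ, E) 𝓘(ℝ, F) ∞ (fun z : U => (e (TotalSpace.mk' F z.1 (s z))).2) := by
  rw [isSmoothSec_iff]
  exact forall_congr' fun y =>
    ⟨contMDiffAt_change_trivialization _ _ (mem_baseSet_trivializationAt F V y.1) (he y.2),
      contMDiffAt_change_trivialization _ _ (he y.2) (mem_baseSet_trivializationAt F V y.1)⟩

variable (e : Trivialization F (TotalSpace.proj : TotalSpace F V → Y)) [MemTrivializationAtlas e]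

/-- The section with given coordinates in a local trivialization. -/
def Sec.ofCoord {U : Opens Y} (he : (U : Set Y) ⊆ e.baseSet) (f : Fn E F U) : Sec E F V ℂ U :=
  ⟨fun z => e.symm z.1 (f z), (isSmoothSec_iff_trivialization e he).2 (f.contMDiff.congr fun z => by
    rw [e.apply_mk_symm (he z.2)])⟩

/-- The coordinates of a section in a local trivialization. -/
def Sec.coord {U : Opens Y} (he : (U : Set Y) ⊆ e.baseSet) (s : Sec E F V ℂ U) : Fn E F U :=
  ⟨fun z => (e (TotalSpace.mk' F z.1 (s.1 z))).2, (isSmoothSec_iff_trivialization e he).1 s.2⟩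

theorem Sec.symm_coord {U : Opens Y} (he : (U : Set Y) ⊆ e.baseSet) (s : Sec E F V ℂ U) (z : U) :
    e.symm z.1 (Sec.coord e he s z) = s.1 z :=
  e.symm_apply_apply_mk (he z.2) (s.1 z)

theorem Sec.coord_add {U : Opens Y} (he : (U : Set Y) ⊆ e.baseSet) (s t : Sec E F V ℂ U) :
    Sec.coord e he (s + t) = Sec.coord e he s + Sec.coord e he t :=
  ContMDiffMap.ext fun z => (e.linear ℂ (he z.2)).map_add (s.1 z) (t.1 z)

theorem Sec.coord_smul {U : Opens Y} (he : (U : Set Y) ⊆ e.baseSet) (f : Fn E ℂ U)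
    (s : Sec E F V ℂ U) (z : U) : Sec.coord e he (f • s) z = f z • Sec.coord e he s z :=
  (e.linear ℂ (he z.2)).map_smul (f z) (s.1 z)

theorem hasMFDerivAt_extZero {T : Type*} [NormedAddCommGroup T] [NormedSpace ℝ T] {U : Opens Y}
    (f : Fn E T U) (y : U) : HasMFDerivAt 𝓘(ℝ, E) 𝓘(ℝ, T) (extZero f) y.1 (dAt E f y) :=
  ((extZero_contMDiffAt E f y).mdifferentiableAt (by simp)).hasMFDerivAt

variable [IsManifold 𝓘(ℝ, E) ∞ Y]

theorem dAt_add {T : Type*} [NormedAddCommGroup T] [NormedSpace ℝ T] {U : Opens Y} (f g : Fn E T U)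
    (y : U) (v : Tan E Y y.1) : (dAt E (f + g) y v : T) = dAt E f y v + dAt E g y v := by
  have h := dAt_congr (f + g) (g := extZero f + extZero g) y
    (Filter.Eventually.of_forall fun z => by
      simp only [Pi.add_apply, extZero_apply]; rfl)
  rw [h, ((hasMFDerivAt_extZero f y).add (hasMFDerivAt_extZero g y)).mfderiv]
  rfl

theorem dAt_smul {T : Type*} [NormedAddCommGroup T] [NormedSpace ℂ T] {U : Opens Y} (f : Fn E ℂ U)
    {g k : Fn E T U} (hk : ∀ z, k z = f z • g z) (y : U) (v : Tan E Y y.1) :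
    (dAt E k y v : T) = (dAt E f y v : ℂ) • g y + f y • (dAt E g y v : T) := by
  have h := dAt_congr k (g := fun z => extZero f z • extZero g z) y
    (Filter.Eventually.of_forall fun z => by
      simp only [extZero_apply, hk])
  have hb : HasMFDerivAt 𝓘(ℝ, E) 𝓘(ℝ, ℂ × T) (fun z => (extZero f z, extZero g z)) y.1
      ((dAt E f y : E →L[ℝ] ℂ).prod (dAt E g y : E →L[ℝ] T)) :=
    ⟨(hasMFDerivAt_extZero f y).1.prodMk (hasMFDerivAt_extZero g y).1,
      (hasMFDerivAt_extZero f y).2.prodMk (hasMFDerivAt_extZero g y).2⟩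
  -- The product rule is the derivative of the bounded bilinear scalar multiplication, composed with
  -- the pair (f, g).
  have hs : IsBoundedBilinearMap ℝ fun p : ℂ × T => p.1 • p.2 := isBoundedBilinearMap_smul
  have hc := ((hs.hasFDerivAt (extZero f y.1, extZero g y.1)).hasMFDerivAt.comp y.1 hb).mfderiv
  rw [h]
  refine (congrArg (fun L : E →L[ℝ] T => L v) hc).trans ?_
  change extZero f y.1 • (dAt E g y v : T) + (dAt E f y v : ℂ) • extZero g y.1 = _
  rw [extZero_apply, extZero_apply, add_comm]

/-- The flat connection of a local trivialization. -/
def flatNabla {U : Opens Y} (he : (U : Set Y) ⊆ e.baseSet) (ξ : Vec E U) (s : Sec E F V ℂ U) :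
    Sec E F V ℂ U :=
  Sec.ofCoord e he (ξ.deriv (Sec.coord e he s))

theorem flatNabla_apply {U : Opens Y} (he : (U : Set Y) ⊆ e.baseSet) (ξ : Vec E U)
    (s : Sec E F V ℂ U) (z : U) : (flatNabla e he ξ s).1 z =
      e.symmL ℂ z.1 (dAt E (Sec.coord e he s) z (ξ.1 z) : F) :=
  (e.symmL_apply (he z.2) _).symm

theorem flatNabla_add {U : Opens Y} (he : (U : Set Y) ⊆ e.baseSet) (ξ : Vec E U)
    (s t : Sec E F V ℂ U) : flatNabla e he ξ (s + t) = flatNabla e he ξ s + flatNabla e he ξ t :=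
  Subtype.ext (funext fun z => by
    rw [Sec.add_apply]
    simp only [flatNabla_apply, Sec.coord_add, dAt_add, map_add])

theorem flatNabla_smul {U : Opens Y} (he : (U : Set Y) ⊆ e.baseSet) (ξ : Vec E U) (f : Fn E ℂ U)
    (s : Sec E F V ℂ U) :
    flatNabla e he ξ (f • s) = ξ.deriv f • s + f • flatNabla e he ξ s :=
  Subtype.ext (funext fun z => by
    rw [Sec.add_apply, Sec.smul_apply, Sec.smul_apply, flatNabla_apply, flatNabla_apply,
      dAt_smul f (Sec.coord_smul e he f s), map_add, map_smul, map_smul,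
      e.symmL_apply (he z.2) (Sec.coord e he s z), Sec.symm_coord]
    rfl)

theorem flatNabla_res {U W : Opens Y} (he : (U : Set Y) ⊆ e.baseSet) (h : W ≤ U) (ξ : Vec E U)
    (s : Sec E F V ℂ U) : Sec.res h (flatNabla e he ξ s) =
      flatNabla e (Set.Subset.trans h he) (Sec.res h ξ) (Sec.res h s) :=
  Subtype.ext (funext fun z => by
    rw [flatNabla_apply, Sec.res_apply, flatNabla_apply,
      dAt_congr (Sec.coord e (Set.Subset.trans h he) (Sec.res h s))
        (g := extZero (Sec.coord e he s)) z (Filter.Eventually.of_forall fun w =>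
          (extZero_apply (Sec.coord e he s) ⟨w.1, h w.2⟩).symm)]
    rfl)

/-- The derivation of the endomorphisms given by the commutator with the flat connection. -/
def flatDeriv {U : Opens Y} (he : (U : Set Y) ⊆ e.baseSet) (ξ : Vec E U) (A : Nc E F V U) :
    Nc E F V U :=
  Nc.mk (fun W h =>
    { toFun := fun s => flatNabla e (Set.Subset.trans h he) (Sec.res h ξ) (A.app h s) -
        A.app h (flatNabla e (Set.Subset.trans h he) (Sec.res h ξ) s)
      map_add' := fun s t => by
        rw [flatNabla_add, map_add, map_add, flatNabla_add]
        abel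
      map_smul' := fun f s => by
        rw [flatNabla_smul, map_add, map_smul, map_smul, map_smul, flatNabla_smul,
          RingHom.id_apply, smul_sub]
        abel })
    (fun {W _} h k s => by
      simp only [LinearMap.coe_mk, AddHom.coe_mk, map_sub, flatNabla_res, A.app_res, Sec.res_res])

theorem flatDeriv_app {U W : Opens Y} (he : (U : Set Y) ⊆ e.baseSet) (ξ : Vec E U)
    (A : Nc E F V U) (h : W ≤ U) (s : Sec E F V ℂ W) : (flatDeriv e he ξ A).app h s =
      flatNabla e (Set.Subset.trans h he) (Sec.res h ξ) (A.app h s) -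
        A.app h (flatNabla e (Set.Subset.trans h he) (Sec.res h ξ) s) := rfl

theorem flatDeriv_add {U : Opens Y} (he : (U : Set Y) ⊆ e.baseSet) (ξ : Vec E U)
    (A B : Nc E F V U) : flatDeriv e he ξ (A + B) = flatDeriv e he ξ A + flatDeriv e he ξ B :=
  Nc.ext fun W h s => by
    simp only [Nc.add_app, flatDeriv_app, flatNabla_add]
    abel

theorem flatDeriv_mul {U : Opens Y} (he : (U : Set Y) ⊆ e.baseSet) (ξ : Vec E U)
    (A B : Nc E F V U) :
    flatDeriv e he ξ (A * B) = flatDeriv e he ξ A * B + A * flatDeriv e he ξ B :=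
  Nc.ext fun W h s => by
    simp only [Nc.add_app, Nc.mul_app, flatDeriv_app, map_sub]
    abel

theorem flatDeriv_ofFn {U : Opens Y} (he : (U : Set Y) ⊆ e.baseSet) (ξ : Vec E U) (f : Fn E ℂ U) :
    flatDeriv e he ξ (Nc.ofFn U f : Nc E F V U) = Nc.ofFn U (ξ.deriv f) :=
  Nc.ext fun W h s => by
    rw [flatDeriv_app, Nc.ofFn_app, Nc.ofFn_app, Nc.ofFn_app, flatNabla_smul, Vec.deriv_res,
      add_sub_cancel_right]

theorem Vec.deriv_const {U : Opens Y} (ξ : Vec E U) (c : ℂ) : ξ.deriv (Fn.const E U c) = 0 :=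
  ContMDiffMap.ext fun y => by
    change dAt E (Fn.const E U c) y (ξ.1 y) = 0
    rw [dAt_congr (Fn.const E U c) (g := fun _ => c) y (Filter.Eventually.of_forall fun _ => rfl),
      mfderiv_const]
    rfl

theorem flatDeriv_const {U : Opens Y} (he : (U : Set Y) ⊆ e.baseSet) (ξ : Vec E U) (c : ℂ) :
    flatDeriv e he ξ (algebraMap ℂ (Nc E F V U) c) = 0 := by
  rw [Nc.algebraMap_const, flatDeriv_ofFn, ξ.deriv_const, map_zero]

variable [FiniteDimensional ℝ E] [T2Space Y]

/-- The pairing of differentials with the horizontal lift of a vector field for the flat connection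
of a local trivialization. -/
def flatPairing {U : Opens Y} (he : (U : Set Y) ⊆ e.baseSet) (ξ : Vec E U) :
    Omega ℂ (Fn E ℝ U) (Nc E F V U) →ₗ[Env (Nc E F V U)] Nc E F V U :=
  Omega.lift (RingHom.id _) (flatDeriv e he ξ) (freeLift_eq_zero _ _
    (fun a₁ a₂ r₁ r₂ => by
      simp only [RingHom.id_apply, bi_smul_self, flatDeriv_add, Algebra.smul_def, flatDeriv_mul,
        flatDeriv_const, zero_mul, zero_add, mul_one])
    (fun a₁ a₂ r₁ r₂ => by
      simp only [RingHom.id_apply, bi_smul_self, flatDeriv_add, Algebra.smul_def, flatDeriv_mul,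
        flatDeriv_const, mul_zero, add_zero, one_mul, Algebra.commutes])
    (fun r₁ r₂ => by
      simp only [RingHom.id_apply, bi_smul_self, flatDeriv_mul, one_mul, mul_one])
    (fun r₁ r₃ h => by
      rw [RingHom.id_apply, RingHom.id_apply, bi_smul_self, bi_smul_self, one_mul, mul_one,
        Subring.mem_center_iff.1 h])
    (fun _ h a => by
      simp only [RingHom.id_apply, bi_smul_self, Nc.algebraMap_real, flatDeriv_ofFn,
        Vec.deriv_toComplex, Vec.deriv_op, map_sum, map_mul, mul_one]))

/-- The commutator of the flat connection with multiplication by f is multiplication by ξf, and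
scalars commute with A. -/
theorem flatPairing_dFn {U : Opens Y} (he : (U : Set Y) ⊆ e.baseSet) (ξ : Vec E U) (A : Nc E F V U)
    (f : Fn E ℝ U) : flatPairing e he ξ (bi A 1 • dFn F V f) = ξ.deriv f • A := by
  have h : flatPairing e he ξ (dFn F V f) = algebraMap _ (Nc E F V U) (ξ.deriv f) := by
    refine (Omega.lift_d _ _ _ _).trans ?_
    rw [Nc.algebraMap_real, flatDeriv_ofFn, Vec.deriv_toComplex, Nc.algebraMap_real]
  rw [map_smul, h, bi_smul_self, mul_one, Algebra.smul_def, Algebra.commutes]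

/-- Pairing Σ tₖ dxₖ with the flat horizontal lift of ∂ⱼ returns tⱼ, so every coefficient of an
element of the kernel vanishes. A trivialization over W suffices; no connection on the whole bundle
is involved. -/
theorem CoordFrame.incl_injective {N : Opens Y} (c : CoordFrame E N) {W : Opens Y} (h : W ≤ N)
    (he : (W : Set Y) ⊆ e.baseSet) : Function.Injective (c.incl F V h) := by
  refine (injective_iff_map_eq_zero _).2 fun x hx => ?_
  refine c.contractTens_ext h fun j => ?_
  have h1 := congrArg (flatPairing e he (c.del' h j)) hx
  rw [incl_apply, map_sum, map_zero] at h1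
  simp only [flatPairing_dFn, c.deriv_x, ite_smul, one_smul, zero_smul, Finset.sum_ite_eq',
    Finset.mem_univ, if_true] at h1
  rw [h1, map_zero]

end FlatConnection

/-! ### Relative differentials as a quotient of the absolute ones -/

section Relative

open Bundle

variable {E : Type*} [NormedAddCommGroup E] [NormedSpace ℝ E] {Y : Type*} [TopologicalSpace Y]
  [ChartedSpace E Y] [IsManifold 𝓘(ℝ, E) ∞ Y]
  {F : Type*} [NormedAddCommGroup F] [NormedSpace ℂ F] {V : Y → Type*}
  [TopologicalSpace (TotalSpace F V)] [∀ y, TopologicalSpace (V y)] [FiberBundle F V]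
  [∀ y, AddCommGroup (V y)] [∀ y, Module ℂ (V y)] [VectorBundle ℂ F V]
  [FiniteDimensional ℝ E] [T2Space Y]

variable (E F V) in
/-- The projection from the differentials of the structure sheaf to the relative differentials. -/
def relProj (U : Opens Y) : Omega ℂ (Fn E ℝ U) (Nc E F V U) →ₗ[Env (Nc E F V U)]
    Omega (Fn E ℂ U) (Fn E ℝ U) (Nc E F V U) :=
  Omega.lift (RingHom.id _) (Omega.d (Fn E ℂ U) (Fn E ℝ U) (Nc E F V U)) (freeLift_eq_zero _ _
    -- Complex scalars act through constant functions, so ℂ-linearity is a special case of linearity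
    -- over 𝒪^ℂ; the remaining relations coincide.
    (fun a₁ a₂ r₁ r₂ => Omega.d_linear_left (Fn.const E U a₁) (Fn.const E U a₂) r₁ r₂)
    (fun a₁ a₂ r₁ r₂ => Omega.d_linear_right (Fn.const E U a₁) (Fn.const E U a₂) r₁ r₂)
    (fun r₁ r₂ => Omega.d_mul r₁ r₂)
    (fun r₁ r₃ h => Omega.d_center r₁ r₃ h)
    (fun hs h a => Omega.d_chain hs h a))

theorem relProj_d {U : Opens Y} (A : Nc E F V U) :
    relProj E F V U (Omega.d _ _ _ A) = Omega.d _ _ _ A :=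
  Omega.lift_d _ _ _ A

theorem relProj_dFn {U : Opens Y} (f : Fn E ℝ U) : relProj E F V U (dFn F V f) = 0 :=
  (relProj_d _).trans (Omega.d_algebraMap (Fn.toComplex E U f))

theorem relProj_res {U W : Opens Y} (h : W ≤ U) (x : Omega ℂ (Fn E ℝ U) (Nc E F V U)) :
    omegaRelRes E F V h (relProj E F V U x) = relProj E F V W (omegaRes E F V h x) := by
  induction x using Omega.induction with
  | h0 => simp only [map_zero]
  | hadd x y hx hy => simp only [map_add, hx, hy]
  | hd e A =>
    rw [omegaRes_bi_smul_d, LinearMap.map_smul, LinearMap.map_smul, relProj_d, relProj_d]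
    exact ((omegaRelRes E F V h).map_smulₛₗ e _).trans
      (congrArg _ (Omega.map_d _ _ _ _ _ _ _ A))

theorem relProj_surjective {U : Opens Y} : Function.Surjective (relProj E F V U) := by
  intro x
  induction x using Omega.induction with
  | h0 => exact ⟨0, map_zero _⟩
  | hadd x y hx hy =>
    obtain ⟨x', rfl⟩ := hx
    obtain ⟨y', rfl⟩ := hy
    exact ⟨x' + y', map_add _ _ _⟩
  | hd e A => exact ⟨e • Omega.d _ _ _ A, by rw [map_smul, relProj_d]⟩

variable (E F V) in
/-- The sub-bimodule generated by the differentials of the functions of `Y`. -/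
def horizontal (U : Opens Y) : Submodule (Env (Nc E F V U)) (Omega ℂ (Fn E ℝ U) (Nc E F V U)) :=
  Submodule.span _ (Set.range (dFn F V))

/-- Write f = u + v·I with u and v real. Since d(I) = 0 over ℂ, Leibniz gives df = du + dv·I, a
combination of differentials of real functions. -/
theorem d_ofFn_mem_horizontal {U : Opens Y} (f : Fn E ℂ U) :
    Omega.d ℂ (Fn E ℝ U) (Nc E F V U) (Nc.ofFn U f) ∈ horizontal E F V U := by
  let u : Fn E ℝ U := ⟨fun z => (f z).re, Complex.reCLM.contDiff.contMDiff.comp f.contMDiff⟩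
  let v : Fn E ℝ U := ⟨fun z => (f z).im, Complex.imCLM.contDiff.contMDiff.comp f.contMDiff⟩
  have hf : f = Fn.toComplex E U u + Fn.toComplex E U v * Fn.const E U Complex.I :=
    ContMDiffMap.ext fun z => (Complex.re_add_im (f z)).symm
  have hI : Omega.d ℂ (Fn E ℝ U) (Nc E F V U) (Nc.ofFn U (Fn.const E U Complex.I)) = 0 :=
    Omega.d_algebraMap (S := ℂ) Complex.I
  rw [hf, map_add, map_mul, Omega.d_add, Omega.d_mul, hI, smul_zero, add_zero]
  exact add_mem (Submodule.subset_span ⟨u, rfl⟩)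
    (Submodule.smul_mem _ _ (Submodule.subset_span ⟨v, rfl⟩))

/-- The kernel of the projection to the relative differentials. -/
theorem mem_horizontal_of_relProj_eq_zero {U : Opens Y} {x : Omega ℂ (Fn E ℝ U) (Nc E F V U)}
    (hx : relProj E F V U x = 0) : x ∈ horizontal E F V U := by
  let S := horizontal E F V U
  -- Modulo the horizontal part the Leibniz term containing da disappears, so d becomes linear over
  -- complex functions on the left; `hsmul'` is the same on the right, using that a is central.
  have hsmul : ∀ (a : Fn E ℂ U) (r : Nc E F V U),
      S.mkQ (Omega.d ℂ (Fn E ℝ U) (Nc E F V U) (a • r)) =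
        bi (algebraMap _ (Nc E F V U) a) 1 • S.mkQ (Omega.d ℂ (Fn E ℝ U) (Nc E F V U) r) := fun a r => by
    have h0 : S.mkQ (Omega.d ℂ (Fn E ℝ U) (Nc E F V U) (algebraMap _ _ a)) = 0 :=
      (Submodule.Quotient.mk_eq_zero _).2 (d_ofFn_mem_horizontal a)
    rw [Algebra.smul_def, Omega.d_mul, map_add, map_smul, map_smul, h0, smul_zero, zero_add]
  have hsmul' : ∀ (a : Fn E ℂ U) (r : Nc E F V U),
      S.mkQ (Omega.d ℂ (Fn E ℝ U) (Nc E F V U) (a • r)) =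
        bi 1 (algebraMap _ (Nc E F V U) a) • S.mkQ (Omega.d ℂ (Fn E ℝ U) (Nc E F V U) r) := fun a r => by
    have h0 : S.mkQ (Omega.d ℂ (Fn E ℝ U) (Nc E F V U) (algebraMap _ _ a)) = 0 :=
      (Submodule.Quotient.mk_eq_zero _).2 (d_ofFn_mem_horizontal a)
    rw [Algebra.smul_def, Algebra.commutes, Omega.d_mul, map_add, map_smul, map_smul, h0,
      smul_zero, add_zero]
  -- The quotient therefore satisfies all the relative relations, and r ↦ [dr] extends to the
  -- relative differentials.
  let q : Omega (Fn E ℂ U) (Fn E ℝ U) (Nc E F V U) →ₗ[Env (Nc E F V U)] (_ ⧸ S) :=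
    Omega.lift (RingHom.id _) (fun r => S.mkQ (Omega.d ℂ (Fn E ℝ U) (Nc E F V U) r)) (freeLift_eq_zero _ _
      (fun a₁ a₂ r₁ r₂ => by
        rw [Omega.d_add, map_add, hsmul, hsmul]; rfl)
      (fun a₁ a₂ r₁ r₂ => by
        rw [Omega.d_add, map_add, hsmul', hsmul']; rfl)
      (fun r₁ r₂ => by
        rw [Omega.d_mul, map_add, map_smul, map_smul]; rfl)
      (fun r₁ r₃ h => by
        rw [RingHom.id_apply, RingHom.id_apply, ← map_smul, ← map_smul]
        exact congrArg _ (Omega.d_center r₁ r₃ h))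
      (fun hs h a => by
        rw [Omega.d_chain hs h a, map_sum]
        exact Finset.sum_congr rfl fun i _ => map_smul _ _ _))
  -- The quotient map factors through the projection to relative differentials, so whatever the
  -- projection kills has zero class.
  have hq : q.comp (relProj E F V U) = S.mkQ := Omega.hom_ext fun r => by
    rw [LinearMap.comp_apply, relProj_d]
    exact Omega.lift_d _ _ _ r
  rw [← Submodule.Quotient.mk_eq_zero, ← Submodule.mkQ_apply, ← show S.mkQ = _ from rfl, ← hq,
    LinearMap.comp_apply, hx, map_zero]

end Relative

/-! ### The sheaf morphisms and exactness of the sequence -/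

section Sequence

open Bundle ModPresheaf

variable {E : Type*} [NormedAddCommGroup E] [NormedSpace ℝ E] {Y : Type*} [TopologicalSpace Y]
  [ChartedSpace E Y] [IsManifold 𝓘(ℝ, E) ∞ Y]
  {F : Type*} [NormedAddCommGroup F] [NormedSpace ℂ F] {V : Y → Type*}
  [TopologicalSpace (TotalSpace F V)] [∀ y, TopologicalSpace (V y)] [FiberBundle F V]
  [∀ y, AddCommGroup (V y)] [∀ y, Module ℂ (V y)] [VectorBundle ℂ F V]
  [FiniteDimensional ℝ E] [T2Space Y]

theorem exists_coordFrame_cover (y : Y) : ∃ c : Σ N : Opens Y, CoordFrame E N, y ∈ c.1 := by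
  obtain ⟨N, hN, ⟨c⟩⟩ := exists_coordFrame E y
  exact ⟨⟨N, c⟩, hN⟩

variable (F V) in
/-- The inclusion in coordinates, as a map of sections of presheaves of bimodules. -/
def CoordFrame.inclMap {N : Opens Y} (c : CoordFrame E N) {W : Opens Y} (h : W ≤ N) :
    (tensPre E F V).obj W →ₗ[(envPre E F V).obj W] (omegaPre E F V).obj W := c.incl F V h

/-- The projection in coordinates, as a map of sections of presheaves of bimodules. -/
def CoordFrame.projMap {N : Opens Y} (c : CoordFrame E N) (D : BundleConnection E F V)
    {W : Opens Y} (h : W ≤ N) :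
    (omegaPre E F V).obj W →ₗ[(envPre E F V).obj W] (tensPre E F V).obj W := c.proj D h

variable (E F V) in
/-- The projection to relative differentials, as a map of sections of presheaves of bimodules. -/
def relMap (W : Opens Y) :
    (omegaPre E F V).obj W →ₗ[(envPre E F V).obj W] (omegaRelPre E F V).obj W := relProj E F V W

theorem CoordFrame.inclMap_res {N : Opens Y} (c : CoordFrame E N) {W W' : Opens Y} (h : W ≤ N)
    (k : W' ≤ W) (x : (tensPre E F V).obj W) : (omegaPre E F V).res k (c.inclMap F V h x) =
      c.inclMap F V (k.trans h) ((tensPre E F V).res k x) :=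
  c.incl_res h k x

theorem relMap_res {U W : Opens Y} (h : W ≤ U) (x : (omegaPre E F V).obj U) :
    (omegaRelPre E F V).res h (relMap E F V U x) = relMap E F V W ((omegaPre E F V).res h x) :=
  relProj_res h x

theorem relMap_inclMap {N : Opens Y} (c : CoordFrame E N) {W : Opens Y} (h : W ≤ N)
    (x : (tensPre E F V).obj W) : relMap E F V W (c.inclMap F V h x) = 0 := by
  change relProj E F V W (∑ j, bi (contractTens (c.del' h j) x) 1 • dFn F V (c.x' h j)) = 0
  rw [map_sum]
  exact Finset.sum_eq_zero fun j _ => by rw [map_smul, relProj_dFn, smul_zero]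

theorem CoordFrame.projMap_inclMap {N : Opens Y} (c : CoordFrame E N) (D : BundleConnection E F V)
    {W : Opens Y} (h : W ≤ N) (x : (tensPre E F V).obj W) :
    c.projMap D h (c.inclMap F V h x) = x :=
  c.proj_incl D h x

/-- The defining property of the splitting carried to germs; ξ may live on a set U larger than the
chart, as only its restriction to W matters. -/
theorem CoordFrame.contractStalk_projMap {N : Opens Y} (c : CoordFrame E N)
    (D : BundleConnection E F V) {U W : Opens Y} (h : W ≤ N) (k : W ≤ U) (ξ : Vec E U) {y : Y}
    (hy : y ∈ W) (w : (omegaPre E F V).obj W) :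
    contractStalk ξ (k hy) ((tensPre E F V).germ hy (c.projMap D h w)) =
      D.pairStalk ξ (k hy) ((omegaPre E F V).germ hy w) := by
  refine (stalkMap_germ (P := tensPre E F V) (Q := ncPre E F V) _
    (fun h k x => contractTens_res k (Sec.res h ξ) x) _ hy k _).trans (Eq.trans ?_
    (stalkMap_germ (P := omegaPre E F V) (Q := ncPre E F V) _
      (fun h k x => D.pairing_res k (Sec.res h ξ) x) _ hy k w).symm)
  exact congrArg ((ncPre E F V).germ hy) (c.contractTens_proj D h _ w)

variable (E F V) in
theorem exists_inclusion : ∃ i : Hom (tensSheaf E F V) (cotangent E F V),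
    ∀ (N : Opens Y) (c : CoordFrame E N) (W : Opens Y) (h : W ≤ N) (x : (tensPre E F V).obj W),
      i.app W ((tensPre E F V).toSh W x) = (omegaPre E F V).toSh W (c.inclMap F V h x) := by
  obtain ⟨i, hi⟩ := exists_hom (P := tensPre E F V) (Q := omegaPre E F V)
    (I := Σ N : Opens Y, CoordFrame E N) (fun c => c.1) exists_coordFrame_cover
    (fun c W h => c.2.inclMap F V h) (fun c {W W'} h k x => c.2.inclMap_res h k x)
    (fun c c' W h h' z hz x => c.2.germ_incl_eq c'.2 h h' x hz)
  exact ⟨i, fun N c => hi ⟨N, c⟩⟩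

variable (E F V) in
theorem exists_projection : ∃ p : Hom (cotangent E F V) (relCotangent E F V),
    ∀ (W : Opens Y) (x : (omegaPre E F V).obj W),
      p.app W ((omegaPre E F V).toSh W x) = (omegaRelPre E F V).toSh W (relMap E F V W x) := by
  obtain ⟨p, hp⟩ := exists_hom (P := omegaPre E F V) (Q := omegaRelPre E F V)
    -- This projection is defined over every open set without coordinates, so the cover consists of
    -- the whole space alone.
    (I := Unit) (fun _ => ⊤) (fun _ => ⟨(), trivial⟩)
    (fun _ W _ => relMap E F V W) (fun _ {W W'} _ k x => relMap_res k x)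
    (fun _ _ _ _ _ _ _ _ => rfl)
  exact ⟨p, fun W => hp () W le_top⟩

theorem exists_splitting (D : BundleConnection E F V) :
    ∃ pr : Hom (cotangent E F V) (tensSheaf E F V),
    ∀ (N : Opens Y) (c : CoordFrame E N) (W : Opens Y) (h : W ≤ N) (x : (omegaPre E F V).obj W),
      pr.app W ((omegaPre E F V).toSh W x) = (tensPre E F V).toSh W (c.projMap D h x) := by
  obtain ⟨pr, hpr⟩ := exists_hom (P := omegaPre E F V) (Q := tensPre E F V)
    (I := Σ N : Opens Y, CoordFrame E N) (fun c => c.1) exists_coordFrame_cover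
    (fun c W h => c.2.projMap D h) (fun c {W W'} h k x => c.2.proj_res D h k x)
    (fun c c' W h h' z hz x => congrArg _ (c.2.proj_eq c'.2 D h h' x))
  exact ⟨pr, fun N c => hpr ⟨N, c⟩⟩

/-- The formula is global while i is known only in charts; germs are compared at each z after
restricting to the part of U inside a chart around z. -/
theorem inclusion_tmulSection {i : Hom (tensSheaf E F V) (cotangent E F V)}
    (hi : ∀ (N : Opens Y) (c : CoordFrame E N) (W : Opens Y) (h : W ≤ N) (x : (tensPre E F V).obj W),
      i.app W ((tensPre E F V).toSh W x) = (omegaPre E F V).toSh W (c.inclMap F V h x))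
    (U : Opens Y) (A : Nc E F V U) (f : Fn E ℝ U) : i.app U (tmulSection A (OneForm.d f)) =
      bimul A (dSection (algebraMap (Fn E ℝ U) (Nc E F V U) f)) 1 := by
  let x : (tensPre E F V).obj U := A ⊗ₜ[Fn E ℝ U] OneForm.d f
  let w : (omegaPre E F V).obj U := bi A 1 • dFn F V f
  -- The factor A is moved inside the sheafification map, so that both sides come from presheaf
  -- sections.
  suffices i.app U ((tensPre E F V).toSh U x) = (omegaPre E F V).toSh U w from
    this.trans (((omegaPre E F V).toSh U).map_smul (bi A 1) _)
  refine sheafify_ext fun z hz => ?_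
  obtain ⟨N, hN, ⟨c⟩⟩ := exists_coordFrame E z
  have hz' : z ∈ U ⊓ N := mem_inf hz hN
  rw [← germOf_res (inf_le_left : U ⊓ N ≤ U) _ hz', i.naturality, res_toSh,
    hi N c _ inf_le_right, germOf_toSh, germOf_toSh, ← (omegaPre E F V).germ_res inf_le_left hz']
  have hx : (tensPre E F V).res (inf_le_left : U ⊓ N ≤ U) x =
      Nc.res inf_le_left A ⊗ₜ[Fn E ℝ _] OneForm.d (Fn.res E ℝ inf_le_left f) :=
    (tensRes_tmul E F V _ _ _).trans (congrArg _ (OneForm.d_res _ f))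
  rw [hx]
  exact (c.germ_incl_tmul_d inf_le_right _ _ hz').trans
    (congrArg ((omegaPre E F V).germ hz') (omegaRes_bi_smul_dFn inf_le_left A f).symm)

/-- Near each point the section is represented over a set lying both in a chart and in a
trivializing open set, where the presheaf map is already injective. -/
theorem inclusion_isMono [SmoothComplexBundle E F V] {i : Hom (tensSheaf E F V) (cotangent E F V)}
    (hi : ∀ (N : Opens Y) (c : CoordFrame E N) (W : Opens Y) (h : W ≤ N) (x : (tensPre E F V).obj W),
      i.app W ((tensPre E F V).toSh W x) = (omegaPre E F V).toSh W (c.inclMap F V h x)) : i.IsMono := by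
  intro U
  refine (injective_iff_map_eq_zero _).2 fun t ht => sheafify_ext fun z hz => ?_
  obtain ⟨N, hN, ⟨c⟩⟩ := exists_coordFrame E z
  let e := trivializationAt F V z
  let B : Opens Y := ⟨e.baseSet, e.open_baseSet⟩
  have hB : z ∈ N ⊓ B := mem_inf hN (mem_baseSet_trivializationAt F V z)
  obtain ⟨W, h, hW, hzW, x, hx⟩ := exists_toSh t hz hB
  have h0 : (omegaPre E F V).germ hzW (c.inclMap F V (hW.trans inf_le_left) x) = 0 := by
    rw [← germOf_toSh _ hzW, ← hi, ← hx, ← i.naturality, ht, map_zero]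
    rfl
  -- A vanishing germ gives vanishing only on a smaller neighbourhood, so x is restricted to it
  -- before injectivity is applied.
  obtain ⟨N', hz', k, hk⟩ := ((omegaPre E F V).germ_eq_zero_iff hzW _).1 h0
  rw [c.inclMap_res] at hk
  have h2 : (tensPre E F V).res k x = 0 :=
    c.incl_injective e (k.trans (hW.trans inf_le_left))
      (fun w hw => (hW.trans inf_le_right) (k hw))
      (hk.trans (map_zero (c.inclMap F V (k.trans (hW.trans inf_le_left)))).symm)
  rw [← germOf_res h t hzW, hx, germOf_toSh,
    ((tensPre E F V).germ_eq_zero_iff hzW x).2 ⟨N', hz', k, h2⟩]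
  rfl

/-- The image over U is a sub-bimodule and contains the generators, as df = i(1 ⊗ df); lifts
therefore exist on all of U. -/
theorem horizontal_lift {i : Hom (tensSheaf E F V) (cotangent E F V)}
    (hi : ∀ (N : Opens Y) (c : CoordFrame E N) (W : Opens Y) (h : W ≤ N) (x : (tensPre E F V).obj W),
      i.app W ((tensPre E F V).toSh W x) = (omegaPre E F V).toSh W (c.inclMap F V h x))
    {U : Opens Y}
    {x : Omega ℂ (Fn E ℝ U) (Nc E F V U)} (hx : x ∈ horizontal E F V U) :
    ∃ t, i.app U t = (omegaPre E F V).toSh U x := by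
  induction hx using Submodule.span_induction with
  | mem x hx =>
    obtain ⟨f, rfl⟩ := hx
    exact ⟨tmulSection 1 (OneForm.d f),
      (inclusion_tmulSection hi U 1 f).trans (one_smul ((envPre E F V).obj U) _)⟩
  | zero => exact ⟨0, (map_zero _).trans (map_zero ((omegaPre E F V).toSh U)).symm⟩
  | add x y _ _ hx hy =>
    obtain ⟨t, ht⟩ := hx
    obtain ⟨t', ht'⟩ := hy
    exact ⟨t + t', (map_add _ _ _).trans ((congrArg₂ (· + ·) ht ht').trans
      (map_add ((omegaPre E F V).toSh U) _ _).symm)⟩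
  | smul e x _ hx =>
    obtain ⟨t, ht⟩ := hx
    exact ⟨(show (envPre E F V).obj U from e) • t, (map_smul (i.app U) _ _).trans
      ((congrArg _ ht).trans (((omegaPre E F V).toSh U).map_smul e _).symm)⟩

theorem sequence_exact {i : Hom (tensSheaf E F V) (cotangent E F V)}
    (hi : ∀ (N : Opens Y) (c : CoordFrame E N) (W : Opens Y) (h : W ≤ N) (x : (tensPre E F V).obj W),
      i.app W ((tensPre E F V).toSh W x) = (omegaPre E F V).toSh W (c.inclMap F V h x))
    {p : Hom (cotangent E F V) (relCotangent E F V)}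
    (hp : ∀ (W : Opens Y) (x : (omegaPre E F V).obj W),
      p.app W ((omegaPre E F V).toSh W x) = (omegaRelPre E F V).toSh W (relMap E F V W x)) :
    i.Exact p := by
  intro U w
  constructor
  · intro hw y hy
    obtain ⟨W, h, -, hyW, x, hx⟩ := exists_toSh w hy hy
    have h0 : (omegaRelPre E F V).germ hyW (relMap E F V W x) = 0 := by
      rw [← germOf_toSh _ hyW, ← hp, ← hx, ← p.naturality, hw, map_zero]
      rfl
    obtain ⟨N, hyN, k, hk⟩ := ((omegaRelPre E F V).germ_eq_zero_iff hyW _).1 h0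
    rw [relMap_res] at hk
    -- On N a presheaf representative of w is killed by the presheaf projection, hence is
    -- horizontal, hence lifts.
    obtain ⟨t, ht⟩ := horizontal_lift hi (mem_horizontal_of_relProj_eq_zero hk)
    refine ⟨N, k.trans h, hyN, t, ht.trans ?_⟩
    rw [← (cotangent E F V).res_res h k, hx]
    exact (res_toSh k x).symm
  · intro hw
    refine sheafify_ext fun y hy => ?_
    obtain ⟨W, h, hyW, t, ht⟩ := hw y hy
    obtain ⟨N, hN, ⟨c⟩⟩ := exists_coordFrame E y
    obtain ⟨W', h', hW', hy', x, hx⟩ := exists_toSh t hyW hN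
    rw [← germOf_res (h'.trans h) _ hy', p.naturality, ← (cotangent E F V).res_res h h', ← ht,
      i.naturality, hx, hi N c W' hW', hp, relMap_inclMap, map_zero]
    rfl

end Sequence

end
end Azu

/-! ### The exact sequence and its splitting -/

theorem lemma3p2p4 {E : Type*} [NormedAddCommGroup E] [NormedSpace ℝ E] [FiniteDimensional ℝ E]
    {Y : Type*} [TopologicalSpace Y] [T2Space Y] [ParacompactSpace Y] [ChartedSpace E Y]
    [IsManifold 𝓘(ℝ, E) ∞ Y]
    {F : Type*} [NormedAddCommGroup F] [NormedSpace ℂ F] [FiniteDimensional ℂ F] {V : Y → Type*}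
    [TopologicalSpace (Bundle.TotalSpace F V)] [∀ y, TopologicalSpace (V y)] [FiberBundle F V]
    [∀ y, AddCommGroup (V y)] [∀ y, Module ℂ (V y)] [VectorBundle ℂ F V]
    [Azu.SmoothComplexBundle E F V] :
    ∃ (i : Azu.ModPresheaf.Hom (Azu.tensSheaf E F V) (Azu.cotangent E F V))
      (p : Azu.ModPresheaf.Hom (Azu.cotangent E F V) (Azu.relCotangent E F V)),
      (∀ (U : Opens Y) (A : Azu.Nc E F V U) (f : Azu.Fn E ℝ U),
        i.app U (Azu.tmulSection A (Azu.OneForm.d f)) =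
          Azu.bimul A (Azu.dSection (algebraMap (Azu.Fn E ℝ U) (Azu.Nc E F V U) f)) 1) ∧
      (∀ (U : Opens Y) (A : Azu.Nc E F V U), p.app U (Azu.dSection A) = Azu.dRelSection A) ∧
      i.IsMono ∧ i.Exact p ∧ p.IsEpi ∧
      ∀ D : Azu.BundleConnection E F V,
        ∃ pr : Azu.ModPresheaf.Hom (Azu.cotangent E F V) (Azu.tensSheaf E F V),
          (∀ (U : Opens Y) (w : (Azu.cotangent E F V).obj U) (ξ : Azu.Vec E U) (y : Y)
            (hy : y ∈ U),
            Azu.contractStalk ξ hy (Azu.ModPresheaf.germOf (pr.app U w) hy) =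
              D.pairStalk ξ hy (Azu.ModPresheaf.germOf w hy)) ∧
          pr.IsEpi ∧
          ∀ (U : Opens Y) (t : (Azu.tensSheaf E F V).obj U), pr.app U (i.app U t) = t := by
  obtain ⟨i, hi⟩ := Azu.exists_inclusion E F V
  obtain ⟨p, hp⟩ := Azu.exists_projection E F V
  have hit := Azu.inclusion_tmulSection hi
  refine ⟨i, p, hit, fun U A => ?_, Azu.inclusion_isMono hi, Azu.sequence_exact hi hp,
    fun U x y hy => ?_, fun D => ?_⟩
  · exact (hp U _).trans (congrArg ((Azu.omegaRelPre E F V).toSh U) (Azu.relProj_d A))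
  · obtain ⟨W, h, -, hyW, x', hx⟩ := Azu.ModPresheaf.exists_toSh x hy hy
    -- Once the section is represented in the presheaf it lifts there, since the presheaf projection
    -- is surjective over every open set.
    obtain ⟨w, hw⟩ := Azu.relProj_surjective x'
    refine ⟨W, h, hyW, (Azu.omegaPre E F V).toSh W w, ?_⟩
    exact (hp W w).trans ((congrArg _ hw).trans hx.symm)
  · obtain ⟨pr, hpr⟩ := Azu.exists_splitting D
    -- Checked on germs: near y everything is represented in one chart, where the two coordinate
    -- maps compose to the identity.
    have hsplit : ∀ (U : Opens Y) (t : (Azu.tensSheaf E F V).obj U),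
        pr.app U (i.app U t) = t := fun U t =>
      Azu.ModPresheaf.sheafify_ext fun y hy => by
        obtain ⟨N, hN, ⟨c⟩⟩ := Azu.exists_coordFrame E y
        obtain ⟨W, h, hW, hyW, x, hx⟩ := Azu.ModPresheaf.exists_toSh t hy hN
        rw [← Azu.ModPresheaf.germOf_res h _ hyW, ← Azu.ModPresheaf.germOf_res h _ hyW,
          pr.naturality, i.naturality, hx, hi N c W hW, hpr N c W hW, c.projMap_inclMap]
    -- The epimorphism property comes from the splitting: i(x) is a preimage of x on all of U, with
    -- no shrinking.
    refine ⟨pr, fun U w ξ y hy => ?_, fun U x y hy => ⟨U, le_refl U, hy, i.app U x, ?_⟩, hsplit⟩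
    · obtain ⟨N, hN, ⟨c⟩⟩ := Azu.exists_coordFrame E y
      obtain ⟨W, h, hW, hyW, x, hx⟩ := Azu.ModPresheaf.exists_toSh w hy hN
      rw [← Azu.ModPresheaf.germOf_res h _ hyW, ← Azu.ModPresheaf.germOf_res h _ hyW,
        pr.naturality, hx, hpr N c W hW, Azu.ModPresheaf.germOf_toSh,
        Azu.ModPresheaf.germOf_toSh, c.contractStalk_projMap D hW h]
    · rw [hsplit]
      rfl
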